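/- Let $V:[0,1]\to\mathbb R$ be continuous and strictly positive. Let $\mathcal P_1$ be the set of strictly positive functions $f\in H^1(0,1)$ (identified with their continuous representatives on $[0,1]$) with $\int_0^1 f=1$. Consider on $[0,1]$ the nonlinear heat equation $$\partial_t\tilde v=\partial_{xx}^2\tilde v-V\tilde v+\Big(\int_0^1V(\xi)\tilde v(t,\xi)\,d\xi\Big)\tilde v,\qquad \partial_x\tilde v(t,0)=\partial_x\tilde v(t,1)=0,\qquad \tilde v(0,\cdot)=\tilde v_0\in\mathcal P_1, \tag{N}$$ whose solutions are classical for $t>0$ and attain the initial value in $L^2(0,1)$. There is an *eigenbasis*: a complete orthonormal system $(e_n)_{n\ge 0}$ of $L^2(0,1)$ with $-e_n''+Ve_n=\mu_ne_n$, $e_n'(0)=e_n'(1)=0$, $\mu_0\le\mu_1\le\cdots$, and $e_0>0$ on $(0,1)$; and for every $\tilde v_0\in\mathcal P_1$ equation (N) has a solution on $[0,\infty)$ with $\tilde v(t,\cdot)\in\mathcal P_1$ for all $t\ge 0$. Fix any eigenbasis, and put $c_n(f)=\int_0^1e_nf$, $p_q=\int_0^1e_q/\int_0^1e_0$, $C_V=\max(1,\sup_{[0,1]}V)$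 and $$h_2(t)=\Big(\sum_{q\ge1}\frac{e^{-2(\mu_q-\mu_0)t}}{\mu_q^3}\Big)^{1/2}\quad(t\ge0),$$ where the series converges for all $t\ge 0$. For $\tilde v_0\in\mathcal P_1$ let $$\tau_{\mathcal N}(\tilde v_0)=\frac1{\mu_1-\mu_0}\log\frac{\|\tilde v_0-c_0(\tilde v_0)e_0\|_{L^2}\,\|1-c_0(1)e_0\|_{L^2}}{c_0(\tilde v_0)\int_0^1e_0}\in[-\infty,\infty),$$ $$\tilde\tau_{\mathcal N}(\tilde v_0)=\inf\Big\{t>0:\ h_2(t)<\frac{c_0(\tilde v_0)\int_0^1e_0}{C_V\|V\|_{L^2}\|\tilde v_0-c_0(\tilde v_0)e_0\|_{H^1}}\Big\},$$ with $\log 0=-\infty$, and with the last quotient read as $+\infty$ if its denominator is $0$; here $\|f\|_{H^1}^2=\|f\|_{L^2}^2+\|\partial_xf\|_{L^2}^2$. Let $\mathcal B=\bigcup_{m\ge0}\mathcal B_m$, where $\mathcal B_m$ is the set of $\nu=(q_0,\dots,q_m)$ with $q_0\in\mathbb N$ and $q_1,\dots,q_m\in\mathbb N\setminus\{0\}$,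 and for $\nu\in\mathcal B_m$ let $$\lambda_\nu=\sum_{i=0}^m(\mu_{q_i}-\mu_0),\qquad \psi_\nu=\prod_{i=0}^m\frac{c_{q_i}}{c_0},\qquad b_\nu(x)=(-1)^m\,\frac{\prod_{i=1}^mp_{q_i}}{\int_0^1e_0}\,e_{q_0}(x).$$ 1. For every $\tilde v_0\in\mathcal P_1$ and every solution $\tilde v$ of (N) on $[0,\infty)$, one has $\psi_\nu(\tilde v(t,\cdot))=e^{-\lambda_\nu t}\psi_\nu(\tilde v_0)$ for all $\nu\in\mathcal B$ and $t\ge0$; and for every $t>\max(\tilde\tau_{\mathcal N}(\tilde v_0),\tau_{\mathcal N}(\tilde v_0))$ the Koopman decomposition $$\tilde v(t,x)=\sum_{\nu\in\mathcal B}e^{-\lambda_\nu t}\,\psi_\nu(\tilde v_0)\,b_\nu(x)\qquad(x\in[0,1])\tag{KN}$$ holds, with $\sum_{\nu\in\mathcal B}\sup_{x\in[0,1]}|e^{-\lambda_\nu t}\psi_\nu(\tilde v_0)b_\nu(x)|<\infty$. 2. The set $$\tilde\Omega_{\mathcal N}=\Big\{\tilde v_0\in\mathcal P_1:\ \|\tilde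 v_0-c_0(\tilde v_0)e_0\|_{H^1}<\frac{c_0(\tilde v_0)\int_0^1e_0}{\max\big(C_V\|V\|_{L^2}h_2(0),\ \|1-c_0(1)e_0\|_{L^2}\big)}\Big\}$$ is a neighbourhood, in $\mathcal P_1$ with the $H^1$ norm, of the sink $\tilde f_0=e_0/\int_0^1e_0$, and for every $\tilde v_0\in\tilde\Omega_{\mathcal N}$ and every solution $\tilde v$ of (N), the decomposition (KN) holds with the same absolute convergence for all $t>0$. -/

import Mathlib

open Set Filter Topology MeasureTheory
open scoped ContDiff

noncomputable section

namespace KoopmanHeat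

/-! Functions on `[0,1]` are represented by functions `ℝ → ℝ`; every notion below only uses
their values on `[0,1]`. -/

/-- Membership in `L²(0,1)`. -/
def MemL2 (f : ℝ → ℝ) : Prop := MemLp f 2 (volume.restrict (Ioo (0 : ℝ) 1))

/-- `g` is a weak derivative of `f` on `(0,1)` (tested against `C_c^∞(0,1)`). -/
def IsWeakDeriv (f g : ℝ → ℝ) : Prop :=
  ∀ φ : ℝ → ℝ, ContDiff ℝ ∞ φ → HasCompactSupport φ → tsupport φ ⊆ Ioo (0 : ℝ) 1 →
    ∫ x in (0 : ℝ)..1, f x * deriv φ x = - ∫ x in (0 : ℝ)..1, g x * φ x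

/-- Membership in the Sobolev space `H¹(0,1)`. -/
def MemH1 (f : ℝ → ℝ) : Prop := MemL2 f ∧ ∃ g : ℝ → ℝ, MemL2 g ∧ IsWeakDeriv f g

open Classical in
/-- The square integrable weak derivative of `f` (unique almost everywhere on `(0,1)`), when
there is one; `0` otherwise. -/
def weakDeriv (f : ℝ → ℝ) : ℝ → ℝ :=
  if h : ∃ g : ℝ → ℝ, MemL2 g ∧ IsWeakDeriv f g then h.choose else 0

/-- The norm of `L²(0,1)`. -/
def l2Norm (f : ℝ → ℝ) : ℝ := Real.sqrt (∫ x in (0 : ℝ)..1, f x ^ 2)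

/-- The norm of `H¹(0,1)`. -/
def h1Norm (f : ℝ → ℝ) : ℝ := Real.sqrt (l2Norm f ^ 2 + l2Norm (weakDeriv f) ^ 2)

/-- The set `𝒫₁`: (continuous representatives of) functions of `H¹(0,1)` that are strictly
positive on `[0,1]` and have integral `1`. -/
def P1 : Set (ℝ → ℝ) :=
  {f | ContinuousOn f (Icc 0 1) ∧ MemH1 f ∧ (∀ x ∈ Icc (0 : ℝ) 1, 0 < f x) ∧
    ∫ x in (0 : ℝ)..1, f x = 1}

/-- `f` solves `f'' - V f = -μ f` on `[0,1]` with `f'(0) = f'(1) = 0`. -/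
def SolvesNeumannEigen (V : ℝ → ℝ) (μ : ℝ) (f : ℝ → ℝ) : Prop :=
  ∃ f' f'' : ℝ → ℝ,
    (∀ x ∈ Icc (0 : ℝ) 1, HasDerivWithinAt f (f' x) (Icc 0 1) x) ∧
    (∀ x ∈ Icc (0 : ℝ) 1, HasDerivWithinAt f' (f'' x) (Icc 0 1) x) ∧
    (∀ x ∈ Icc (0 : ℝ) 1, f'' x - V x * f x = -μ * f x) ∧
    f' 0 = 0 ∧ f' 1 = 0

/-- `(e n)` is a complete orthonormal system of `L²(0,1)` made of Neumann eigenfunctions of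
`-∂ₓₓ + V`, with eigenvalues `μ n` in increasing order, and the sign of `e 0` chosen so that it
is positive. -/
structure IsNeumannEigenbasis (V : ℝ → ℝ) (μ : ℕ → ℝ) (e : ℕ → ℝ → ℝ) : Prop where
  eigen : ∀ n, SolvesNeumannEigen V (μ n) (e n)
  mono : Monotone μ
  orthonormal : ∀ m n, ∫ x in (0 : ℝ)..1, e m x * e n x = if m = n then 1 else 0
  complete : ∀ f : ℝ → ℝ, MemL2 f → (∀ n, ∫ x in (0 : ℝ)..1, e n x * f x = 0) →
    f =ᵐ[volume.restrict (Ioo (0 : ℝ) 1)] 0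
  pos : ∀ x ∈ Ioo (0 : ℝ) 1, 0 < e 0 x

/-- `v` (time first, space second) is a solution on `[0,∞) × [0,1]` of
`∂ₜv = ∂ₓₓv - V v + (∫₀¹ V v) v`, `∂ₓv(t,0) = ∂ₓv(t,1) = 0`, `v(0,·) = v₀`:
classical for `t > 0`, with the initial value attained in `L²(0,1)`. -/
def IsNonlinearHeatSolution (V v₀ : ℝ → ℝ) (v : ℝ → ℝ → ℝ) : Prop :=
  (∃ vt vx vxx : ℝ → ℝ → ℝ,
    ContinuousOn (fun p : ℝ × ℝ => v p.1 p.2) (Ioi 0 ×ˢ Icc 0 1) ∧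
    ContinuousOn (fun p : ℝ × ℝ => vt p.1 p.2) (Ioi 0 ×ˢ Icc 0 1) ∧
    ContinuousOn (fun p : ℝ × ℝ => vx p.1 p.2) (Ioi 0 ×ˢ Icc 0 1) ∧
    ContinuousOn (fun p : ℝ × ℝ => vxx p.1 p.2) (Ioi 0 ×ˢ Icc 0 1) ∧
    ∀ t : ℝ, 0 < t →
      (∀ x ∈ Icc (0 : ℝ) 1,
        HasDerivAt (fun s => v s x) (vt t x) t ∧
        HasDerivWithinAt (v t) (vx t x) (Icc 0 1) x ∧
        HasDerivWithinAt (vx t) (vxx t x) (Icc 0 1) x ∧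
        vt t x = vxx t x - V x * v t x + (∫ y in (0 : ℝ)..1, V y * v t y) * v t x) ∧
      vx t 0 = 0 ∧ vx t 1 = 0) ∧
  (∀ x ∈ Icc (0 : ℝ) 1, v 0 x = v₀ x) ∧
  Tendsto (fun t => l2Norm (fun x => v t x - v₀ x)) (𝓝[>] 0) (𝓝 0)

/-- The functional `c_n(f) = ∫₀¹ e_n f`. -/
def coeff (e : ℕ → ℝ → ℝ) (n : ℕ) (f : ℝ → ℝ) : ℝ := ∫ x in (0 : ℝ)..1, e n x * f x

/-- The mean `∫₀¹ e_n`. -/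
def mean (e : ℕ → ℝ → ℝ) (n : ℕ) : ℝ := ∫ x in (0 : ℝ)..1, e n x

/-- The function `f - c₀(f) e₀`. -/
def deviation (e : ℕ → ℝ → ℝ) (f : ℝ → ℝ) : ℝ → ℝ := fun x => f x - coeff e 0 f * e 0 x

/-- The index set `ℬ = ⋃ₘ ℬₘ`: an index is `⟨m, (q₀, (q₁, …, qₘ))⟩` with `q₀ ∈ ℕ` and
`q₁, …, qₘ ∈ ℕ \ {0}`. -/
abbrev B : Type := Σ m : ℕ, ℕ × (Fin m → ℕ+)

/-- `λ_ν = ∑_{i=0}^m (μ_{q_i} - μ₀)`. -/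
def rate (μ : ℕ → ℝ) (ν : B) : ℝ := (μ ν.2.1 - μ 0) + ∑ i, (μ (ν.2.2 i) - μ 0)

/-- `ψ_ν = ∏_{i=0}^m c_{q_i} / c₀`. -/
def psi (e : ℕ → ℝ → ℝ) (ν : B) (f : ℝ → ℝ) : ℝ :=
  (coeff e ν.2.1 f / coeff e 0 f) * ∏ i, (coeff e (ν.2.2 i) f / coeff e 0 f)

/-- The mode `b_ν(x) = (-1)^m (∏_{i=1}^m p_{q_i}) e_{q₀}(x) / ∫₀¹ e₀`, where
`p_q = ∫₀¹ e_q / ∫₀¹ e₀`. -/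
def mode (e : ℕ → ℝ → ℝ) (ν : B) (x : ℝ) : ℝ :=
  (-1) ^ ν.1 * ((∏ i, (mean e (ν.2.2 i) / mean e 0)) / mean e 0) * e ν.2.1 x

/-- The term `e^{-λ_ν t} ψ_ν(v₀) b_ν(x)`. -/
def koopmanTerm (μ : ℕ → ℝ) (e : ℕ → ℝ → ℝ) (v₀ : ℝ → ℝ) (t : ℝ) (ν : B) (x : ℝ) : ℝ :=
  Real.exp (-rate μ ν * t) * psi e ν v₀ * mode e ν x

/-- The Koopman series at time `t` converges absolutely for the norm `sup_{x ∈ [0,1]}`, with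
sum `w`. -/
def HasKoopmanDecomposition (μ : ℕ → ℝ) (e : ℕ → ℝ → ℝ) (v₀ : ℝ → ℝ) (t : ℝ) (w : ℝ → ℝ) :
    Prop :=
  (Summable fun ν : B => ⨆ x : Icc (0 : ℝ) 1, |koopmanTerm μ e v₀ t ν x|) ∧
  ∀ x ∈ Icc (0 : ℝ) 1, HasSum (fun ν : B => koopmanTerm μ e v₀ t ν x) (w x)

/-- `C_V = max(1, sup_{[0,1]} V)`. -/
def CV (V : ℝ → ℝ) : ℝ := max 1 (sSup (V '' Icc 0 1))

/-- `h₂(t) = (∑_{q ≥ 1} e^{-2(μ_q - μ₀)t} / μ_q³)^{1/2}`. -/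
def h2 (μ : ℕ → ℝ) (t : ℝ) : ℝ :=
  Real.sqrt (∑' q : ℕ+, Real.exp (-2 * (μ q - μ 0) * t) / μ q ^ 3)

/-- `τ_N(v₀) = (μ₁ - μ₀)⁻¹ log (‖v₀ - c₀(v₀)e₀‖_{L²} ‖1 - c₀(1)e₀‖_{L²} / (c₀(v₀) ∫₀¹ e₀))`,
with `log 0 = -∞`. -/
def tauN (μ : ℕ → ℝ) (e : ℕ → ℝ → ℝ) (v₀ : ℝ → ℝ) : EReal :=
  ((1 / (μ 1 - μ 0) : ℝ) : EReal) *
    ENNReal.log (ENNReal.ofReal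
      (l2Norm (deviation e v₀) * l2Norm (deviation e 1) / (coeff e 0 v₀ * mean e 0)))

/-- `τ̃_N(v₀) = inf {t > 0 ; h₂(t) < c₀(v₀) ∫₀¹ e₀ / (C_V ‖V‖_{L²} ‖v₀ - c₀(v₀)e₀‖_{H¹})}`.
The denominator is multiplied out, so that the quotient counts as `+∞` where it vanishes. -/
def tauTildeN (V : ℝ → ℝ) (μ : ℕ → ℝ) (e : ℕ → ℝ → ℝ) (v₀ : ℝ → ℝ) : EReal :=
  sInf ((fun t : ℝ => (t : EReal)) '' {t : ℝ | 0 < t ∧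
    h2 μ t * (CV V * l2Norm V * h1Norm (deviation e v₀)) < coeff e 0 v₀ * mean e 0})

/-- The sink `f̃₀ = e₀ / ∫₀¹ e₀`. -/
def sink (e : ℕ → ℝ → ℝ) : ℝ → ℝ := fun x => e 0 x / mean e 0

/-- The set `Ω̃_N`. -/
def OmegaTildeN (V : ℝ → ℝ) (μ : ℕ → ℝ) (e : ℕ → ℝ → ℝ) : Set (ℝ → ℝ) :=
  {v₀ | v₀ ∈ P1 ∧ h1Norm (deviation e v₀) <
    coeff e 0 v₀ * mean e 0 / max (CV V * l2Norm V * h2 μ 0) (l2Norm (deviation e 1))}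

end KoopmanHeat

end

open KoopmanHeat

open Set Filter Topology MeasureTheory
open scoped ContDiff

noncomputable section

namespace KoopmanHeat

/-! ### The space `L²(0,1)` -/

/-! Write $a(t)=\int V\tilde v(t)$. Testing the equation against $e_n$, with Neumann conditions on
both factors, gives $\dot c_n=(a-\mu_n)c_n$. The nonlinearity is one scalar factor shared by all
modes, so it cancels in ratios: $c_n/c_0$ evolves exactly by $e^{-(\mu_n-\mu_0)t}$ (`coeff_ratio`),
and products of such ratios are the $\psi_\nu$. The mass defect $\int\tilde v-1$ solves $\dot y=ay$
with limit $0$ at time $0$, hence vanishes (`integral_eq_one`).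

With $u_n=c_n/c_0$ at time $t$, the expansion is $\tilde v=c_0\sum u_ne_n$. Unit mass determines
$c_0$, whence $\tilde v=\sum_n u_ne_n\big/\big(\int e_0\,(1+\sum_{q\ge1}u_qp_q)\big)$. Expanding the
denominator as a geometric series, and its powers as sums over words $(q_1,\dots,q_m)$, is the
Koopman series (`hasSum_words`). Absolute convergence needs $\sum_{q\ge1}|u_qp_q|<1$. By
Cauchy–Schwarz this follows from $e^{-(\mu_1-\mu_0)t}\|v_0-c_0e_0\|\,\|1-c_0(1)e_0\|<c_0(v_0)\int
e_0$. Both the condition $t>\tau_{\mathcal N}$ and membership in $\tilde\Omega_{\mathcal N}$ imply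
that inequality, so both parts reduce to `hasKoopmanDecomposition_of_lt`.

Uniform convergence at positive times rests on the estimate $\sum e_n(x)^2/\mu_n\le 2/\kappa$
(`sum_sq_div_le`), where $0<\kappa\le\min(1,V)$. It yields $\sum1/\mu_n<\infty$ and $|e_n|\le
K\mu_n$, and the factors $e^{-\mu_nt}$ absorb any power of $\mu_n$.

The eigenbasis comes from the Green function of $-u''+Vu$: it defines an injective compact symmetric
operator, whose eigenfunctions are complete (`ae_eq_zero_of_orthogonal`). Eigenvalues are simple and
have finite initial segments, so they can be listed; the ground state has no interior zero by an
energy argument. The flow is the linear heat flow divided by its mass; positivity follows from a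
convex penalty functional (`le_of_le`). -/

/-- Lebesgue measure on `(0,1)`. -/
abbrev unitMeasure : Measure ℝ := volume.restrict (Ioo (0 : ℝ) 1)

lemma integral_unitMeasure (f : ℝ → ℝ) : ∫ x, f x ∂unitMeasure = ∫ x in (0 : ℝ)..1, f x := by
  rw [intervalIntegral.integral_of_le zero_le_one, integral_Ioc_eq_integral_Ioo]

lemma ae_unitMeasure_of_forall {p : ℝ → Prop} (h : ∀ x ∈ Icc (0 : ℝ) 1, p x) :
    ∀ᵐ x ∂unitMeasure, p x :=
  (ae_restrict_iff' measurableSet_Ioo).2 (ae_of_all _ fun x hx => h x (Ioo_subset_Icc_self hx))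

lemma integrable_unitMeasure_iff {f : ℝ → ℝ} :
    Integrable f unitMeasure ↔ IntervalIntegrable f volume 0 1 := by
  rw [intervalIntegrable_iff_integrableOn_Ioo_of_le zero_le_one]; rfl

lemma memL2_of_continuousOn {f : ℝ → ℝ} (hf : ContinuousOn f (Icc 0 1)) : MemL2 f := by
  obtain ⟨C, hC⟩ := isCompact_Icc.exists_bound_of_continuousOn hf
  exact MemLp.of_bound ((hf.mono Ioo_subset_Icc_self).aestronglyMeasurable measurableSet_Ioo) C
    (ae_unitMeasure_of_forall hC)

lemma MemL2.add {f g : ℝ → ℝ} (hf : MemL2 f) (hg : MemL2 g) : MemL2 fun x => f x + g x :=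
  MemLp.add hf hg

lemma MemL2.sub {f g : ℝ → ℝ} (hf : MemL2 f) (hg : MemL2 g) : MemL2 fun x => f x - g x :=
  MemLp.sub hf hg

lemma MemL2.const_mul {f : ℝ → ℝ} (hf : MemL2 f) (c : ℝ) : MemL2 fun x => c * f x :=
  MemLp.const_mul hf c

/-- The class of `f` in `L²(0,1)`. -/
def toL2 {f : ℝ → ℝ} (hf : MemL2 f) : Lp ℝ 2 unitMeasure := MemLp.toLp f hf

lemma inner_toL2 {f g : ℝ → ℝ} (hf : MemL2 f) (hg : MemL2 g) :
    inner ℝ (toL2 hf) (toL2 hg) = ∫ x in (0 : ℝ)..1, f x * g x := by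
  rw [L2.inner_def, ← integral_unitMeasure]
  refine integral_congr_ae ?_
  filter_upwards [MemLp.coeFn_toLp hf, MemLp.coeFn_toLp hg] with x h1 h2
  simp only [toL2, h1, h2, RCLike.inner_apply, conj_trivial]
  ring

lemma norm_toL2 {f : ℝ → ℝ} (hf : MemL2 f) : ‖toL2 hf‖ = l2Norm f := by
  rw [norm_eq_sqrt_real_inner, inner_toL2, l2Norm]
  simp only [sq]

lemma l2Norm_nonneg (f : ℝ → ℝ) : 0 ≤ l2Norm f := Real.sqrt_nonneg _

lemma l2Norm_sq (f : ℝ → ℝ) : l2Norm f ^ 2 = ∫ x in (0 : ℝ)..1, f x ^ 2 :=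
  Real.sq_sqrt (intervalIntegral.integral_nonneg zero_le_one fun _ _ => sq_nonneg _)

lemma abs_integral_mul_le {f g : ℝ → ℝ} (hf : MemL2 f) (hg : MemL2 g) :
    |∫ x in (0 : ℝ)..1, f x * g x| ≤ l2Norm f * l2Norm g := by
  rw [← inner_toL2 hf hg, ← norm_toL2 hf, ← norm_toL2 hg]
  exact abs_real_inner_le_norm _ _

lemma l2Norm_add_le {f g : ℝ → ℝ} (hf : MemL2 f) (hg : MemL2 g) :
    l2Norm (fun x => f x + g x) ≤ l2Norm f + l2Norm g := by
  rw [← norm_toL2 hf, ← norm_toL2 hg, ← norm_toL2 (hf.add hg)]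
  exact norm_add_le (toL2 hf) (toL2 hg)

lemma l2Norm_const_mul (c : ℝ) (f : ℝ → ℝ) : l2Norm (fun x => c * f x) = |c| * l2Norm f := by
  simp only [l2Norm, mul_pow, intervalIntegral.integral_const_mul]
  rw [Real.sqrt_mul (sq_nonneg c), Real.sqrt_sq_eq_abs]

lemma l2Norm_congr {f g : ℝ → ℝ} (h : f =ᵐ[unitMeasure] g) : l2Norm f = l2Norm g := by
  rw [l2Norm, l2Norm, ← integral_unitMeasure, ← integral_unitMeasure]
  congr 1
  exact integral_congr_ae (h.mono fun x hx => by simp only [hx])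

lemma MemL2.integrable_mul {f g : ℝ → ℝ} (hf : MemL2 f) (hg : MemL2 g) :
    IntervalIntegrable (fun x => f x * g x) volume 0 1 :=
  integrable_unitMeasure_iff.1 (MemLp.integrable_mul hf hg)

lemma coeff_congr {e : ℕ → ℝ → ℝ} {f g : ℝ → ℝ} (n : ℕ) (h : ∀ x ∈ Icc (0 : ℝ) 1, f x = g x) :
    coeff e n f = coeff e n g :=
  intervalIntegral.integral_congr fun x hx => by
    rw [uIcc_of_le zero_le_one] at hx
    simp only [h x hx]

lemma eqOn_Icc_of_ae_eq {f g : ℝ → ℝ} (hf : ContinuousOn f (Icc 0 1))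
    (hg : ContinuousOn g (Icc 0 1)) (h : f =ᵐ[unitMeasure] g) : EqOn f g (Icc 0 1) := by
  have h1 : EqOn f g (Ioo 0 1) :=
    Measure.eqOn_open_of_ae_eq h isOpen_Ioo (hf.mono Ioo_subset_Icc_self)
      (hg.mono Ioo_subset_Icc_self)
  refine h1.of_subset_closure hf hg Ioo_subset_Icc_self ?_
  rw [closure_Ioo zero_ne_one]

/-! ### Calculus on `[0,1]` -/

lemma continuousOn_of_hasDerivWithinAt {f f' : ℝ → ℝ} {s : Set ℝ}
    (h : ∀ x ∈ s, HasDerivWithinAt f (f' x) s x) : ContinuousOn f s :=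
  fun x hx => (h x hx).continuousWithinAt

lemma integral_mul_deriv_Icc {a b : ℝ} {u u' v v' : ℝ → ℝ} (ha : 0 ≤ a) (hab : a ≤ b) (hb : b ≤ 1)
    (hu : ∀ x ∈ Icc (0 : ℝ) 1, HasDerivWithinAt u (u' x) (Icc 0 1) x)
    (hv : ∀ x ∈ Icc (0 : ℝ) 1, HasDerivWithinAt v (v' x) (Icc 0 1) x)
    (hu' : ContinuousOn u' (Icc 0 1)) (hv' : ContinuousOn v' (Icc 0 1)) :
    ∫ x in a..b, u x * v' x = u b * v b - u a * v a - ∫ x in a..b, u' x * v x := by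
  have hs : uIcc a b ⊆ Icc 0 1 := by rw [uIcc_of_le hab]; exact Icc_subset_Icc ha hb
  exact intervalIntegral.integral_mul_deriv_eq_deriv_mul_of_hasDerivWithinAt
    (fun x hx => (hu x (hs hx)).mono hs) (fun x hx => (hv x (hs hx)).mono hs)
    (hu'.mono hs).intervalIntegrable (hv'.mono hs).intervalIntegrable

lemma integral_deriv_Icc {a b : ℝ} {u u' : ℝ → ℝ} (ha : a ∈ Icc (0 : ℝ) 1)
    (hb : b ∈ Icc (0 : ℝ) 1) (hu : ∀ x ∈ Icc (0 : ℝ) 1, HasDerivWithinAt u (u' x) (Icc 0 1) x)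
    (hu' : ContinuousOn u' (Icc 0 1)) :
    ∫ x in a..b, u' x = u b - u a := by
  have hs : uIcc a b ⊆ Icc 0 1 := uIcc_subset_Icc ha hb
  have := intervalIntegral.integral_mul_deriv_eq_deriv_mul_of_hasDerivWithinAt
    (u := fun _ => 1) (u' := fun _ => 0) (fun x _ => hasDerivWithinAt_const _ _ _)
    (fun x hx => (hu x (hs hx)).mono hs) (by simp)
    (hu'.mono hs).intervalIntegrable
  simpa using this

/-- The primitive of a function that is continuous on `[0,1]`. -/
lemma hasDerivWithinAt_integral_Icc {f : ℝ → ℝ} (hf : ContinuousOn f (Icc 0 1)) {a : ℝ}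
    (ha : a ∈ Icc (0 : ℝ) 1) :
    ∀ x ∈ Icc (0 : ℝ) 1, HasDerivWithinAt (fun x => ∫ y in a..x, f y) (f x) (Icc 0 1) x := by
  intro x hx
  have : Fact (x ∈ Icc (0 : ℝ) 1) := ⟨hx⟩
  exact intervalIntegral.integral_hasDerivWithinAt_right
    (hf.mono (uIcc_subset_Icc ha hx)).intervalIntegrable
    (hf.stronglyMeasurableAtFilter_nhdsWithin measurableSet_Icc x) (hf x hx)

lemma intervalIntegrable_of_continuousOn {f : ℝ → ℝ} (hf : ContinuousOn f (Icc 0 1)) :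
    IntervalIntegrable f volume 0 1 := hf.intervalIntegrable_of_Icc zero_le_one

lemma monotoneOn_of_hasDerivWithinAt {f f' : ℝ → ℝ}
    (h : ∀ x ∈ Icc (0 : ℝ) 1, HasDerivWithinAt f (f' x) (Icc 0 1) x)
    (h0 : ∀ x ∈ Icc (0 : ℝ) 1, 0 ≤ f' x) : MonotoneOn f (Icc 0 1) := by
  refine monotoneOn_of_hasDerivWithinAt_nonneg (convex_Icc 0 1) (continuousOn_of_hasDerivWithinAt h)
    (f' := f') (fun x hx => ?_) fun x hx => h0 x (interior_subset hx)
  exact (h x (interior_subset hx)).mono interior_subset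

/-- Uniqueness for the Cauchy problem of `f'' = q f`. -/
lemma eq_zero_of_cauchy {q f f' : ℝ → ℝ} (hq : ContinuousOn q (Icc 0 1))
    (hf : ∀ x ∈ Icc (0 : ℝ) 1, HasDerivWithinAt f (f' x) (Icc 0 1) x)
    (hf' : ∀ x ∈ Icc (0 : ℝ) 1, HasDerivWithinAt f' (q x * f x) (Icc 0 1) x)
    {z : ℝ} (hz : z ∈ Icc (0 : ℝ) 1) (h0 : f z = 0) (h1 : f' z = 0) :
    ∀ x ∈ Icc (0 : ℝ) 1, f x = 0 := by
  obtain ⟨C, hC⟩ := isCompact_Icc.exists_bound_of_continuousOn hq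
  simp only [Real.norm_eq_abs] at hC
  have hexp : ∀ k x : ℝ, HasDerivWithinAt (fun y => Real.exp (k * y)) (k * Real.exp (k * x))
      (Icc 0 1) x := fun k x => by
    have := ((hasDerivAt_id x).const_mul k).exp.hasDerivWithinAt (s := Icc 0 1)
    simpa [mul_comm] using this
  -- Gronwall by hand: the energy $E=f^2+f'^2$ satisfies $|E'|\le(1+C)E$. Multiplying by
  -- $e^{\mp(1+C)x}$ makes it monotone, which carries $E(z)=0$ to the right and to the left of `z`.
  have hE : ∀ x ∈ Icc (0 : ℝ) 1, HasDerivWithinAt (fun y => f y ^ 2 + f' y ^ 2)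
      (2 * (1 + q x) * (f x * f' x)) (Icc 0 1) x := fun x hx => by
    convert! ((hf x hx).pow 2).add ((hf' x hx).pow 2) using 1
    simp; ring
  have hb : ∀ x ∈ Icc (0 : ℝ) 1,
      |2 * (1 + q x) * (f x * f' x)| ≤ (1 + C) * (f x ^ 2 + f' x ^ 2) := fun x hx => by
    have h3 : |1 + q x| ≤ 1 + C := (abs_add_le _ _).trans (by simpa using hC x hx)
    have h4 : 2 * |f x * f' x| ≤ f x ^ 2 + f' x ^ 2 := by
      rw [abs_mul, ← sq_abs (f x), ← sq_abs (f' x)]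
      nlinarith [sq_nonneg (|f x| - |f' x|)]
    have h5 : 0 ≤ 1 + C := (abs_nonneg _).trans h3
    calc |2 * (1 + q x) * (f x * f' x)| = |1 + q x| * (2 * |f x * f' x|) := by
          rw [abs_mul, abs_mul, abs_two]; ring
      _ ≤ _ := by gcongr
  have key : ∀ x ∈ Icc (0 : ℝ) 1, f x ^ 2 + f' x ^ 2 ≤ 0 := by
    intro x hx
    rcases le_total z x with hzx | hxz
    · have := monotoneOn_of_hasDerivWithinAt
        (f := fun y => -(Real.exp (-(1 + C) * y) * (f y ^ 2 + f' y ^ 2)))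
        (fun x hx => ((hexp _ x).mul (hE x hx)).neg) (fun x hx => by
          have := (abs_le.1 (hb x hx)).2
          have h6 := Real.exp_pos (-(1 + C) * x)
          nlinarith) hz hx hzx
      simp only [h0, h1] at this
      have h6 := Real.exp_pos (-(1 + C) * x)
      by_contra! h7
      have := mul_pos h6 h7
      norm_num at *
      linarith
    · have := monotoneOn_of_hasDerivWithinAt
        (f := fun y => (Real.exp ((1 + C) * y) * (f y ^ 2 + f' y ^ 2)))
        (fun x hx => ((hexp _ x).mul (hE x hx))) (fun x hx => by
          have := (abs_le.1 (hb x hx)).1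
          have h6 := Real.exp_pos ((1 + C) * x)
          nlinarith) hx hz hxz
      simp only [h0, h1] at this
      have h6 := Real.exp_pos ((1 + C) * x)
      by_contra! h7
      have := mul_pos h6 h7
      norm_num at *
      linarith
  intro x hx
  have := key x hx
  exact pow_eq_zero_iff two_ne_zero |>.1
    (le_antisymm (by linarith [sq_nonneg (f' x)]) (sq_nonneg _))

/-- A Sobolev inequality. -/
lemma sq_le_integral_sq_add {g g' : ℝ → ℝ}
    (hg : ∀ x ∈ Icc (0 : ℝ) 1, HasDerivWithinAt g (g' x) (Icc 0 1) x)
    (hg' : ContinuousOn g' (Icc 0 1)) {x : ℝ} (hx : x ∈ Icc (0 : ℝ) 1) :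
    g x ^ 2 ≤ 2 * (∫ y in (0 : ℝ)..1, g y ^ 2) + 2 * ∫ y in (0 : ℝ)..1, g' y ^ 2 := by
  have hgc := continuousOn_of_hasDerivWithinAt hg
  have hg2 : IntervalIntegrable (fun y => g y ^ 2) volume 0 1 :=
    (hgc.pow 2).intervalIntegrable_of_Icc zero_le_one
  -- Use $g(x)^2\le2g(y)^2+2(g(x)-g(y))^2$, which amounts to $(g(x)-2g(y))^2\ge0$, and bound the
  -- increment by Cauchy–Schwarz; then average over $y$.
  have key : ∀ y ∈ Icc (0 : ℝ) 1, g x ^ 2 ≤ 2 * g y ^ 2 + 2 * ∫ y in (0 : ℝ)..1, g' y ^ 2 := by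
    intro y hy
    have hd := integral_deriv_Icc hy hx hg hg'
    have hcs : (g x - g y) ^ 2 ≤ ∫ y in (0 : ℝ)..1, g' y ^ 2 := by
      rw [← hd]
      have h1 : |∫ y in y..x, g' y| ≤ ∫ y in (0 : ℝ)..1, |g' y| := by
        refine (intervalIntegral.norm_integral_le_integral_norm_uIoc (f := g')).trans ?_
        rw [intervalIntegral.integral_of_le zero_le_one]
        refine setIntegral_mono_set (hg'.abs.intervalIntegrable_of_Icc zero_le_one).1
          (ae_of_all _ fun _ => abs_nonneg _) (LE.le.eventuallyLE ?_)
        exact Ioc_subset_Ioc (le_min hy.1 hx.1) (max_le hy.2 hx.2)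
      have h2 := abs_integral_mul_le (memL2_of_continuousOn hg'.abs)
        (memL2_of_continuousOn (continuousOn_const (c := (1 : ℝ))))
      have h3 : l2Norm (fun _ => 1) = 1 := by simp [l2Norm]
      simp only [h3, mul_one] at h2
      have h4 := l2Norm_sq fun y => |g' y|
      simp only [sq_abs] at h4
      rw [← h4, ← sq_abs]
      gcongr
      exact h1.trans ((le_abs_self _).trans h2)
    nlinarith [sq_nonneg (g x - 2 * g y)]
  have := intervalIntegral.integral_mono_on zero_le_one (by simp)
    ((hg2.const_mul 2).add (intervalIntegrable_const (c := 2 * ∫ y in (0 : ℝ)..1, g' y ^ 2))) key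
  rw [intervalIntegral.integral_add (hg2.const_mul 2) intervalIntegrable_const] at this
  simpa using this

/-! ### Neumann eigenfunctions -/

/-- `f` is a Neumann solution of `f'' = (V - μ) f` on `[0,1]` with derivative `f'`. -/
structure IsEigenpair (V : ℝ → ℝ) (μ : ℝ) (f f' : ℝ → ℝ) : Prop where
  deriv : ∀ x ∈ Icc (0 : ℝ) 1, HasDerivWithinAt f (f' x) (Icc 0 1) x
  deriv' : ∀ x ∈ Icc (0 : ℝ) 1, HasDerivWithinAt f' ((V x - μ) * f x) (Icc 0 1) x
  left : f' 0 = 0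
  right : f' 1 = 0

lemma SolvesNeumannEigen.exists_isEigenpair {V f : ℝ → ℝ} {μ : ℝ} (h : SolvesNeumannEigen V μ f) :
    ∃ f', IsEigenpair V μ f f' := by
  obtain ⟨f', f'', h1, h2, h3, h4, h5⟩ := h
  refine ⟨f', h1, fun x hx => ?_, h4, h5⟩
  convert! h2 x hx using 1
  linarith [h3 x hx]

namespace IsEigenpair

variable {V : ℝ → ℝ} {μ : ℝ} {f f' : ℝ → ℝ}

lemma solves (h : IsEigenpair V μ f f') : SolvesNeumannEigen V μ f :=
  ⟨f', _, h.deriv, h.deriv', fun x _ => by ring, h.left, h.right⟩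

lemma continuousOn (h : IsEigenpair V μ f f') : ContinuousOn f (Icc 0 1) :=
  continuousOn_of_hasDerivWithinAt h.deriv

lemma continuousOn' (h : IsEigenpair V μ f f') : ContinuousOn f' (Icc 0 1) :=
  continuousOn_of_hasDerivWithinAt h.deriv'

lemma const_mul (h : IsEigenpair V μ f f') (c : ℝ) :
    IsEigenpair V μ (fun x => c * f x) fun x => c * f' x where
  deriv x hx := (h.deriv x hx).const_mul c
  deriv' x hx := by
    convert! (h.deriv' x hx).const_mul c using 1
    ring
  left := by simp [h.left]
  right := by simp [h.right]

/-- Green's formula on a subinterval. -/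
lemma weak_on (hV : ContinuousOn V (Icc 0 1)) (h : IsEigenpair V μ f f') {g g' : ℝ → ℝ}
    (hg : ∀ x ∈ Icc (0 : ℝ) 1, HasDerivWithinAt g (g' x) (Icc 0 1) x)
    (hg' : ContinuousOn g' (Icc 0 1)) {a b : ℝ} (ha : 0 ≤ a) (hab : a ≤ b) (hb : b ≤ 1) :
    ∫ x in a..b, (g' x * f' x + V x * (g x * f x)) =
      g b * f' b - g a * f' a + μ * ∫ x in a..b, g x * f x := by
  have hs : uIcc a b ⊆ Icc 0 1 := by rw [uIcc_of_le hab]; exact Icc_subset_Icc ha hb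
  have hgc := continuousOn_of_hasDerivWithinAt hg
  have h1 := integral_mul_deriv_Icc ha hab hb hg h.deriv' hg'
    ((hV.sub continuousOn_const).mul h.continuousOn)
  have i1 : IntervalIntegrable (fun x => g' x * f' x) volume a b :=
    ((hg'.mul h.continuousOn').mono hs).intervalIntegrable
  have i2 : IntervalIntegrable (fun x => V x * (g x * f x)) volume a b :=
    ((hV.mul (hgc.mul h.continuousOn)).mono hs).intervalIntegrable
  have i3 : IntervalIntegrable (fun x => μ * (g x * f x)) volume a b :=
    ((continuousOn_const.mul (hgc.mul h.continuousOn)).mono hs).intervalIntegrable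
  have h2 : ∫ x in a..b, g x * ((V x - μ) * f x) =
      (∫ x in a..b, V x * (g x * f x)) - ∫ x in a..b, μ * (g x * f x) := by
    rw [← intervalIntegral.integral_sub i2 i3]
    congr 1; ext x; ring
  rw [intervalIntegral.integral_const_mul] at h2
  rw [intervalIntegral.integral_add i1 i2]
  linarith

lemma weak (hV : ContinuousOn V (Icc 0 1)) (h : IsEigenpair V μ f f') {g g' : ℝ → ℝ}
    (hg : ∀ x ∈ Icc (0 : ℝ) 1, HasDerivWithinAt g (g' x) (Icc 0 1) x)
    (hg' : ContinuousOn g' (Icc 0 1)) :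
    ∫ x in (0 : ℝ)..1, (g' x * f' x + V x * (g x * f x)) = μ * ∫ x in (0 : ℝ)..1, g x * f x := by
  rw [h.weak_on hV hg hg' le_rfl zero_le_one le_rfl, h.left, h.right]
  ring

lemma eq_zero_of_cauchy (hV : ContinuousOn V (Icc 0 1)) (h : IsEigenpair V μ f f') {z : ℝ}
    (hz : z ∈ Icc (0 : ℝ) 1) (h0 : f z = 0) (h1 : f' z = 0) : ∀ x ∈ Icc (0 : ℝ) 1, f x = 0 :=
  KoopmanHeat.eq_zero_of_cauchy (hV.sub continuousOn_const) h.deriv h.deriv' hz h0 h1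

/-- Neumann eigenvalues are simple. -/
lemma mul_eq_mul (hV : ContinuousOn V (Icc 0 1)) (h : IsEigenpair V μ f f') {g g' : ℝ → ℝ}
    (hg : IsEigenpair V μ g g') : ∀ x ∈ Icc (0 : ℝ) 1, g 0 * f x = f 0 * g x := by
  intro x hx
  -- The combination $g(0)f-f(0)g$ has zero Cauchy data at $0$, both derivatives vanishing there.
  refine sub_eq_zero.1 (KoopmanHeat.eq_zero_of_cauchy (q := fun x => V x - μ)
    (f := fun x => g 0 * f x - f 0 * g x) (f' := fun x => g 0 * f' x - f 0 * g' x)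
    (hV.sub continuousOn_const)
    (fun x hx => ((h.deriv x hx).const_mul _).sub ((hg.deriv x hx).const_mul _))
    (fun x hx => ?_) (left_mem_Icc.2 zero_le_one) (by ring) (by simp [h.left, hg.left]) x hx)
  convert! ((h.deriv' x hx).const_mul (g 0)).sub ((hg.deriv' x hx).const_mul (f 0)) using 1
  ring

end IsEigenpair

/-- The cap at $1$ lets the same `κ` bound both coefficients of the energy $g'^2+Vg^2$ from below.
-/
lemma exists_pos_le (V : ℝ → ℝ) (hV : ContinuousOn V (Icc 0 1))
    (hVpos : ∀ x ∈ Icc (0 : ℝ) 1, 0 < V x) :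
    ∃ κ : ℝ, 0 < κ ∧ κ ≤ 1 ∧ ∀ x ∈ Icc (0 : ℝ) 1, κ ≤ V x := by
  obtain ⟨z, hz, hm⟩ := isCompact_Icc.exists_isMinOn (nonempty_Icc.2 zero_le_one) hV
  exact ⟨min 1 (V z), lt_min one_pos (hVpos z hz), min_le_left _ _,
    fun x hx => (min_le_right _ _).trans (hm hx)⟩

/-- The energy `∫ g'² + V g²` controls the `H¹` norm. -/
lemma mul_integral_sq_add_le {V : ℝ → ℝ} (hV : ContinuousOn V (Icc 0 1)) {κ : ℝ} (hκ1 : κ ≤ 1)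
    (hκ : ∀ x ∈ Icc (0 : ℝ) 1, κ ≤ V x) {g g' : ℝ → ℝ} (hg : ContinuousOn g (Icc 0 1))
    (hg' : ContinuousOn g' (Icc 0 1)) :
    κ * ((∫ x in (0 : ℝ)..1, g x ^ 2) + ∫ x in (0 : ℝ)..1, g' x ^ 2) ≤
      ∫ x in (0 : ℝ)..1, (g' x * g' x + V x * (g x * g x)) := by
  have i1 : IntervalIntegrable (fun x => g x ^ 2) volume 0 1 :=
    intervalIntegrable_of_continuousOn (hg.pow 2)
  have i2 : IntervalIntegrable (fun x => g' x ^ 2) volume 0 1 :=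
    intervalIntegrable_of_continuousOn (hg'.pow 2)
  rw [← intervalIntegral.integral_add i1 i2, ← intervalIntegral.integral_const_mul]
  refine intervalIntegral.integral_mono_on zero_le_one
    (intervalIntegrable_of_continuousOn
      (continuousOn_const.mul ((hg.pow 2).add (hg'.pow 2))))
    (intervalIntegrable_of_continuousOn
      ((hg'.mul hg').add (hV.mul (hg.mul hg)))) fun x hx => ?_
  nlinarith [hκ x hx, sq_nonneg (g x), sq_nonneg (g' x),
    mul_nonneg (sub_nonneg.2 (hκ x hx)) (sq_nonneg (g x)),
    mul_nonneg (sub_nonneg.2 hκ1) (sq_nonneg (g' x))]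

/-- An orthonormal family of Neumann eigenfunctions. -/
structure IsEigenfamily {ι : Type*} [DecidableEq ι] (V : ℝ → ℝ) (μ : ι → ℝ) (e e' : ι → ℝ → ℝ) :
    Prop where
  pair : ∀ i, IsEigenpair V (μ i) (e i) (e' i)
  orthonormal : ∀ i j, ∫ x in (0 : ℝ)..1, e i x * e j x = if i = j then 1 else 0

namespace IsEigenfamily

variable {ι : Type*} [DecidableEq ι] {V : ℝ → ℝ} {μ : ι → ℝ} {e e' : ι → ℝ → ℝ}

/-- The energy of a normalised eigenfunction is its eigenvalue, and the energy dominates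
$\kappa\|e_i\|^2$. -/
lemma le_eigenvalue (h : IsEigenfamily V μ e e') (hV : ContinuousOn V (Icc 0 1)) {κ : ℝ}
    (hκ0 : 0 < κ) (hκ1 : κ ≤ 1) (hκ : ∀ x ∈ Icc (0 : ℝ) 1, κ ≤ V x) (i : ι) : κ ≤ μ i := by
  have h1 := (h.pair i).weak hV (h.pair i).deriv (h.pair i).continuousOn'
  have h2 := mul_integral_sq_add_le hV hκ1 hκ (h.pair i).continuousOn (h.pair i).continuousOn'
  have h3 : 0 ≤ ∫ x in (0 : ℝ)..1, e' i x ^ 2 :=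
    intervalIntegral.integral_nonneg zero_le_one fun _ _ => sq_nonneg _
  have h4 := h.orthonormal i i
  rw [h1, h4] at h2
  simp only [← sq, if_true] at h2 h4
  rw [h4] at h2
  nlinarith

lemma hasDerivWithinAt_sum (h : IsEigenfamily V μ e e') (s : Finset ι) (k : ι → ℝ) :
    ∀ x ∈ Icc (0 : ℝ) 1, HasDerivWithinAt (fun y => ∑ i ∈ s, k i * e i y)
      (∑ i ∈ s, k i * e' i x) (Icc 0 1) x :=
  fun x hx => HasDerivWithinAt.fun_sum fun i _ => ((h.pair i).deriv x hx).const_mul _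

lemma continuousOn_sum' (h : IsEigenfamily V μ e e') (s : Finset ι) (k : ι → ℝ) :
    ContinuousOn (fun y => ∑ i ∈ s, k i * e' i y) (Icc 0 1) :=
  continuousOn_finsetSum _ fun i _ => continuousOn_const.mul (h.pair i).continuousOn'

lemma integral_sum_mul (h : IsEigenfamily V μ e e') (s : Finset ι) (k : ι → ℝ) {j : ι}
    (hj : j ∈ s) : ∫ x in (0 : ℝ)..1, (∑ i ∈ s, k i * e i x) * e j x = k j := by
  simp_rw [Finset.sum_mul]
  have hi : ∀ i, IntervalIntegrable (fun x => k i * e i x * e j x) volume 0 1 := fun i =>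
    intervalIntegrable_of_continuousOn
      ((continuousOn_const.mul (h.pair i).continuousOn).mul (h.pair j).continuousOn)
  rw [intervalIntegral.integral_finsetSum fun i _ => hi i]
  simp_rw [mul_assoc, intervalIntegral.integral_const_mul, h.orthonormal]
  simp [hj]

/-- The energy of a linear combination of eigenfunctions. -/
lemma energy_sum (h : IsEigenfamily V μ e e') (hV : ContinuousOn V (Icc 0 1)) (s : Finset ι)
    (k : ι → ℝ) :
    ∫ x in (0 : ℝ)..1, ((∑ i ∈ s, k i * e' i x) * (∑ i ∈ s, k i * e' i x) +
      V x * ((∑ i ∈ s, k i * e i x) * (∑ i ∈ s, k i * e i x))) = ∑ i ∈ s, μ i * k i ^ 2 := by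
  have hc := continuousOn_of_hasDerivWithinAt (h.hasDerivWithinAt_sum s k)
  have h1 : ∀ x, (∑ i ∈ s, k i * e' i x) * (∑ i ∈ s, k i * e' i x) +
      V x * ((∑ i ∈ s, k i * e i x) * (∑ i ∈ s, k i * e i x)) =
      ∑ j ∈ s, k j * ((∑ i ∈ s, k i * e' i x) * e' j x +
        V x * ((∑ i ∈ s, k i * e i x) * e j x)) := fun x => by
    simp only [mul_add, Finset.sum_add_distrib]
    congr 1
    · rw [Finset.mul_sum]
      exact Finset.sum_congr rfl fun j _ => by ring
    · rw [Finset.mul_sum, Finset.mul_sum]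
      exact Finset.sum_congr rfl fun j _ => by ring
  simp_rw [h1]
  have hi : ∀ j, IntervalIntegrable (fun x => k j * ((∑ i ∈ s, k i * e' i x) * e' j x +
      V x * ((∑ i ∈ s, k i * e i x) * e j x))) volume 0 1 := fun j =>
    intervalIntegrable_of_continuousOn (continuousOn_const.mul
      (((h.continuousOn_sum' s k).mul (h.pair j).continuousOn').add
        (hV.mul (hc.mul (h.pair j).continuousOn))))
  rw [intervalIntegral.integral_finsetSum fun j _ => hi j]
  refine Finset.sum_congr rfl fun j hj => ?_
  rw [intervalIntegral.integral_const_mul,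
    (h.pair j).weak hV (h.hasDerivWithinAt_sum s k) (h.continuousOn_sum' s k),
    h.integral_sum_mul s k hj]
  ring

/-- Take $g=\sum(e_i(x)/\mu_i)e_i$, a partial sum of the Green function with pole $x$. Both $g(x)$
and the energy of $g$ equal the sum $S$ to be bounded, so the Sobolev inequality reads
$S^2\le(2/\kappa)S$. -/
lemma sum_sq_div_le (h : IsEigenfamily V μ e e') (hV : ContinuousOn V (Icc 0 1)) {κ : ℝ}
    (hκ0 : 0 < κ) (hκ1 : κ ≤ 1) (hκ : ∀ x ∈ Icc (0 : ℝ) 1, κ ≤ V x) (s : Finset ι) {x : ℝ}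
    (hx : x ∈ Icc (0 : ℝ) 1) : ∑ i ∈ s, e i x ^ 2 / μ i ≤ 2 / κ := by
  have hμ : ∀ i, 0 < μ i := fun i => hκ0.trans_le (h.le_eigenvalue hV hκ0 hκ1 hκ i)
  set k : ι → ℝ := fun i => e i x / μ i
  have h1 := sq_le_integral_sq_add (h.hasDerivWithinAt_sum s k) (h.continuousOn_sum' s k) hx
  have h2 := mul_integral_sq_add_le hV hκ1 hκ
    (continuousOn_of_hasDerivWithinAt (h.hasDerivWithinAt_sum s k)) (h.continuousOn_sum' s k)
  rw [h.energy_sum hV] at h2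
  have h3 : ∑ i ∈ s, μ i * k i ^ 2 = ∑ i ∈ s, e i x ^ 2 / μ i :=
    Finset.sum_congr rfl fun i _ => by
      have := (hμ i).ne'
      simp only [k]; field_simp
  have h4 : ∑ i ∈ s, k i * e i x = ∑ i ∈ s, e i x ^ 2 / μ i :=
    Finset.sum_congr rfl fun i _ => by simp only [k]; ring
  rw [h3] at h2
  rw [h4] at h1
  have h0 : 0 ≤ ∑ i ∈ s, e i x ^ 2 / μ i :=
    Finset.sum_nonneg fun i _ => div_nonneg (sq_nonneg _) (hμ i).le
  set S := ∑ i ∈ s, e i x ^ 2 / μ i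
  rw [le_div_iff₀ hκ0]
  by_contra! h5
  have h6 : 0 < S := by by_contra! h7; nlinarith
  nlinarith [mul_lt_mul_of_pos_left h5 h6]

/-- A trace bound: integrate the pointwise estimate of `sum_sq_div_le` over $x$, each $e_i^2$ having
integral $1$. -/
lemma sum_inv_le (h : IsEigenfamily V μ e e') (hV : ContinuousOn V (Icc 0 1)) {κ : ℝ}
    (hκ0 : 0 < κ) (hκ1 : κ ≤ 1) (hκ : ∀ x ∈ Icc (0 : ℝ) 1, κ ≤ V x) (s : Finset ι) :
    ∑ i ∈ s, (μ i)⁻¹ ≤ 2 / κ := by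
  have hi : ∀ i, IntervalIntegrable (fun x => e i x ^ 2 / μ i) volume 0 1 := fun i =>
    intervalIntegrable_of_continuousOn (((h.pair i).continuousOn.pow 2).div_const _)
  have h1 : ∫ x in (0 : ℝ)..1, ∑ i ∈ s, e i x ^ 2 / μ i = ∑ i ∈ s, (μ i)⁻¹ := by
    rw [intervalIntegral.integral_finsetSum fun i _ => hi i]
    refine Finset.sum_congr rfl fun i _ => ?_
    have := h.orthonormal i i
    simp only [← sq, if_true] at this
    rw [intervalIntegral.integral_div, this, one_div]
  rw [← h1]
  have h2 := intervalIntegral.integral_mono_on zero_le_one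
    (IntervalIntegrable.sum s fun i _ => hi i) (intervalIntegrable_const (c := 2 / κ))
    fun x hx => by simpa using h.sum_sq_div_le hV hκ0 hκ1 hκ s hx
  simpa using! h2

end IsEigenfamily

/-! ### Parseval's identity and eigenvalue growth -/

/-- Parseval's identity for a complete orthonormal system. -/
lemma hasSum_coeff_mul_coeff {e : ℕ → ℝ → ℝ} (he : ∀ n, MemL2 (e n))
    (horth : ∀ m n, ∫ x in (0 : ℝ)..1, e m x * e n x = if m = n then 1 else 0)
    (hcomp : ∀ f : ℝ → ℝ, MemL2 f → (∀ n, ∫ x in (0 : ℝ)..1, e n x * f x = 0) →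
      f =ᵐ[unitMeasure] 0) {f g : ℝ → ℝ} (hf : MemL2 f) (hg : MemL2 g) :
    HasSum (fun n => coeff e n f * coeff e n g) (∫ x in (0 : ℝ)..1, f x * g x) := by
  have ho : Orthonormal ℝ fun n => toL2 (he n) := by
    rw [orthonormal_iff_ite]
    intro i j
    rw [inner_toL2, horth]
  -- Completeness says exactly that the orthogonal complement is trivial, which is what a Hilbert
  -- basis requires.
  have hb : (Submodule.span ℝ (range fun n => toL2 (he n)))ᗮ = ⊥ := by
    rw [Submodule.eq_bot_iff]
    intro u hu
    have hu0 : ∀ n, ∫ x in (0 : ℝ)..1, e n x * u x = 0 := fun n => by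
      have h1 : toL2 (f := u) (Lp.memLp u) = u := Lp.toLp_coeFn u _
      rw [← inner_toL2 (he n) (Lp.memLp u), h1]
      exact Submodule.mem_orthogonal _ _ |>.1 hu _ (Submodule.subset_span ⟨n, rfl⟩)
    exact Lp.eq_zero_iff_ae_eq_zero.2 (hcomp u (Lp.memLp u) hu0)
  have h := (HilbertBasis.mkOfOrthogonalEqBot ho hb).hasSum_inner_mul_inner (toL2 hf) (toL2 hg)
  simp only [HilbertBasis.coe_mkOfOrthogonalEqBot, inner_toL2] at h
  have h1 : ∀ n, ∫ x in (0 : ℝ)..1, f x * e n x = coeff e n f := fun n => by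
    simp only [coeff, mul_comm]
  simp only [h1] at h
  exact h

namespace IsNeumannEigenbasis

variable {V : ℝ → ℝ} {μ : ℕ → ℝ} {e : ℕ → ℝ → ℝ}

lemma exists_isEigenfamily (h : IsNeumannEigenbasis V μ e) : ∃ e', IsEigenfamily V μ e e' := by
  choose e' he' using fun n => (h.eigen n).exists_isEigenpair
  exact ⟨e', he', h.orthonormal⟩

lemma continuousOn (h : IsNeumannEigenbasis V μ e) (n : ℕ) : ContinuousOn (e n) (Icc 0 1) := by
  obtain ⟨e', he'⟩ := h.exists_isEigenfamily
  exact (he'.pair n).continuousOn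

lemma memL2 (h : IsNeumannEigenbasis V μ e) (n : ℕ) : MemL2 (e n) :=
  memL2_of_continuousOn (h.continuousOn n)

lemma parseval (h : IsNeumannEigenbasis V μ e) {f g : ℝ → ℝ} (hf : MemL2 f) (hg : MemL2 g) :
    HasSum (fun n => coeff e n f * coeff e n g) (∫ x in (0 : ℝ)..1, f x * g x) :=
  hasSum_coeff_mul_coeff h.memL2 h.orthonormal h.complete hf hg

lemma eigenvalue_pos (h : IsNeumannEigenbasis V μ e) (hV : ContinuousOn V (Icc 0 1))
    (hVpos : ∀ x ∈ Icc (0 : ℝ) 1, 0 < V x) (n : ℕ) : 0 < μ n := by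
  obtain ⟨κ, h0, h1, h2⟩ := exists_pos_le V hV hVpos
  obtain ⟨e', he'⟩ := h.exists_isEigenfamily
  exact h0.trans_le (he'.le_eigenvalue hV h0 h1 h2 n)

lemma summable_inv (h : IsNeumannEigenbasis V μ e) (hV : ContinuousOn V (Icc 0 1))
    (hVpos : ∀ x ∈ Icc (0 : ℝ) 1, 0 < V x) : Summable fun n => (μ n)⁻¹ := by
  obtain ⟨κ, h0, h1, h2⟩ := exists_pos_le V hV hVpos
  obtain ⟨e', he'⟩ := h.exists_isEigenfamily
  exact summable_of_sum_le (fun n => (inv_pos.2 (h.eigenvalue_pos hV hVpos n)).le)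
    fun s => he'.sum_inv_le hV h0 h1 h2 s

/-- If the two eigenvalues coincided, simplicity would give $e_1(0)e_0=e_0(0)e_1$. Pairing with
$e_1$ and using orthonormality forces $e_0(0)=0$, so $e_0$ would have zero Cauchy data at $0$. -/
lemma eigenvalue_zero_lt_one (h : IsNeumannEigenbasis V μ e) (hV : ContinuousOn V (Icc 0 1)) :
    μ 0 < μ 1 := by
  refine (h.mono zero_le_one).lt_of_ne fun h01 => ?_
  obtain ⟨e', he'⟩ := h.exists_isEigenfamily
  have h1 := he'.pair 1
  rw [← h01] at h1
  have h2 := (he'.pair 0).mul_eq_mul hV h1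
  have i00 := h.orthonormal 0 0
  have i11 := h.orthonormal 1 1
  have i01 := h.orthonormal 0 1
  simp only [if_true, zero_ne_one, if_false] at i00 i11 i01
  have key : ∀ n, e 1 0 * ∫ x in (0 : ℝ)..1, e 0 x * e n x =
      e 0 0 * ∫ x in (0 : ℝ)..1, e 1 x * e n x := fun n => by
    rw [← intervalIntegral.integral_const_mul, ← intervalIntegral.integral_const_mul]
    refine intervalIntegral.integral_congr fun x hx => ?_
    rw [uIcc_of_le zero_le_one] at hx
    simp only [← mul_assoc, h2 x hx]
  have k0 := key 0
  have i10 := h.orthonormal 1 0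
  simp only [one_ne_zero, if_false] at i10
  rw [i00, i10, mul_one, mul_zero] at k0
  have k1 : e 0 0 = 0 := by
    have := key 1
    rw [i01, i11] at this
    linarith
  have := (he'.pair 0).eq_zero_of_cauchy hV (left_mem_Icc.2 zero_le_one) k1 (he'.pair 0).left
  have h3 : ∫ x in (0 : ℝ)..1, e 0 x * e 0 x = ∫ x in (0 : ℝ)..1, (0 : ℝ) :=
    intervalIntegral.integral_congr fun x hx => by
      rw [uIcc_of_le zero_le_one] at hx
      simp [this x hx]
  rw [i00] at h3
  simp at h3

/-- At an endpoint the Neumann condition already gives $e_0'=0$, so a zero of $e_0$ there would make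
$e_0$ vanish identically. -/
lemma pos_Icc (h : IsNeumannEigenbasis V μ e) (hV : ContinuousOn V (Icc 0 1)) :
    ∀ x ∈ Icc (0 : ℝ) 1, 0 < e 0 x := by
  obtain ⟨e', he'⟩ := h.exists_isEigenfamily
  have hnn : ∀ x ∈ Icc (0 : ℝ) 1, 0 ≤ e 0 x := by
    intro x hx
    rw [← closure_Ioo (zero_ne_one (α := ℝ))] at hx
    have hc := (h.continuousOn 0)
    rw [← closure_Ioo (zero_ne_one (α := ℝ))] at hc
    exact closure_minimal (s := Ioo 0 1) (t := closure (Ioo 0 1) ∩ e 0 ⁻¹' Ici 0)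
      (fun y hy => ⟨subset_closure hy, (h.pos y hy).le⟩)
      (hc.preimage_isClosed_of_isClosed isClosed_closure isClosed_Ici) hx |>.2
  have hne : ∀ z ∈ Icc (0 : ℝ) 1, e' 0 z = 0 → 0 < e 0 z := fun z hz h1 => by
    refine (hnn z hz).lt_of_ne fun h0 => ?_
    have := (he'.pair 0).eq_zero_of_cauchy hV hz h0.symm h1 (1 / 2) (by norm_num)
    exact (h.pos (1 / 2) (by norm_num)).ne' this
  intro x hx
  rcases hx.1.eq_or_lt with rfl | h0
  · exact hne _ hx (he'.pair 0).left
  rcases hx.2.eq_or_lt with rfl | h1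
  · exact hne _ hx (he'.pair 0).right
  · exact h.pos x ⟨h0, h1⟩

lemma coeff_zero_pos (h : IsNeumannEigenbasis V μ e) {f : ℝ → ℝ} (hf : ContinuousOn f (Icc 0 1))
    (hpos : ∀ x ∈ Icc (0 : ℝ) 1, 0 < f x) : 0 < coeff e 0 f :=
  intervalIntegral.intervalIntegral_pos_of_pos_on
    (intervalIntegrable_of_continuousOn ((h.continuousOn 0).mul hf))
    (fun x hx => mul_pos (h.pos x hx) (hpos x (Ioo_subset_Icc_self hx))) zero_lt_one

lemma mean_eq_coeff (e : ℕ → ℝ → ℝ) (n : ℕ) : mean e n = coeff e n 1 := by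
  simp [mean, coeff]

lemma mean_zero_pos (h : IsNeumannEigenbasis V μ e) : 0 < mean e 0 := by
  rw [mean_eq_coeff]
  exact h.coeff_zero_pos continuousOn_const fun _ _ => one_pos

/-- Polynomial growth of the eigenfunctions in the eigenvalue. -/
lemma exists_bound (h : IsNeumannEigenbasis V μ e) (hV : ContinuousOn V (Icc 0 1))
    (hVpos : ∀ x ∈ Icc (0 : ℝ) 1, 0 < V x) {e' : ℕ → ℝ → ℝ} (he' : IsEigenfamily V μ e e') :
    ∃ K : ℝ, 0 < K ∧ ∀ n, ∀ x ∈ Icc (0 : ℝ) 1,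
      |e n x| ≤ K * μ n ∧ |(V x - μ n) * e n x| ≤ K * μ n ^ 2 ∧ |e' n x| ≤ K * μ n ^ 2 := by
  obtain ⟨κ, h0, h1, h2⟩ := exists_pos_le V hV hVpos
  obtain ⟨M, hM⟩ := isCompact_Icc.exists_bound_of_continuousOn hV
  simp only [Real.norm_eq_abs] at hM
  have hM0 : 0 ≤ M := (abs_nonneg _).trans (hM 0 (by norm_num))
  have hκμ := he'.le_eigenvalue hV h0 h1 h2
  have hμ := h.eigenvalue_pos hV hVpos
  set A := 2 / κ
  have hA : 0 < A := by positivity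
  have b1 : ∀ n, ∀ x ∈ Icc (0 : ℝ) 1, |e n x| ≤ A * μ n := fun n x hx => by
    have := he'.sum_sq_div_le hV h0 h1 h2 {n} hx
    rw [Finset.sum_singleton, div_le_iff₀ (hμ n)] at this
    refine abs_le_of_sq_le_sq (this.trans ?_) (by have := hμ n; positivity)
    -- What has been shown is $e_n(x)^2\le A\mu_n$; since $A\mu_n\ge1$ the right side is at most its
    -- square, which trades the square root for a cruder integral power.
    have h3 : 1 ≤ A * μ n := by
      rw [div_mul_eq_mul_div, le_div_iff₀ h0]
      linarith [hκμ n]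
    nlinarith [mul_pos hA (hμ n)]
  have b2 : ∀ n, ∀ x ∈ Icc (0 : ℝ) 1,
      |(V x - μ n) * e n x| ≤ (A * (M / κ + 1)) * μ n ^ 2 := fun n x hx => by
    have h3 : |V x - μ n| ≤ (M / κ + 1) * μ n := by
      have h4 : M ≤ M / κ * μ n := by
        rw [div_mul_eq_mul_div, le_div_iff₀ h0]
        exact mul_le_mul_of_nonneg_left (hκμ n) hM0
      calc |V x - μ n| ≤ |V x| + |μ n| := abs_sub _ _
        _ ≤ M / κ * μ n + μ n := by
          rw [abs_of_pos (hμ n)]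
          linarith [hM x hx]
        _ = _ := by ring
    calc |(V x - μ n) * e n x| = |V x - μ n| * |e n x| := abs_mul _ _
      _ ≤ ((M / κ + 1) * μ n) * (A * μ n) := by
        exact mul_le_mul h3 (b1 n x hx) (abs_nonneg _) ((abs_nonneg _).trans h3)
      _ = _ := by ring
  refine ⟨A * (M / κ + 1), by positivity, fun n x hx => ⟨?_, b2 n x hx, ?_⟩⟩
  · refine (b1 n x hx).trans ?_
    have := hμ n
    gcongr
    have : 0 ≤ M / κ := by positivity
    nlinarith
  -- As $e_n'(0)=0$, the derivative is the integral of $e_n''=(V-\mu_n)e_n$ over an interval of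
  -- length at most $1$.
  · have h3 := integral_deriv_Icc (left_mem_Icc.2 zero_le_one) hx (he'.pair n).deriv'
      ((hV.sub continuousOn_const).mul (h.continuousOn n))
    rw [(he'.pair n).left, sub_zero] at h3
    rw [← h3]
    have h4 := intervalIntegral.norm_integral_le_of_norm_le_const (a := 0) (b := x)
      (f := fun x => (V x - μ n) * e n x) (C := A * (M / κ + 1) * μ n ^ 2) fun y hy => by
        rw [uIoc_of_le hx.1] at hy
        exact b2 n y ⟨hy.1.le, hy.2.trans hx.2⟩
    refine h4.trans ?_
    rw [sub_zero, abs_of_nonneg hx.1]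
    exact mul_le_of_le_one_right (by positivity) hx.2

/-- From $y^{p+1}/(p+1)!\le e^y$ at $y=\mu_nt$, each term is at most a constant times $1/\mu_n$. -/
lemma summable_pow_mul_exp (h : IsNeumannEigenbasis V μ e) (hV : ContinuousOn V (Icc 0 1))
    (hVpos : ∀ x ∈ Icc (0 : ℝ) 1, 0 < V x) (p : ℕ) {t : ℝ} (ht : 0 < t) :
    Summable fun n => μ n ^ p * Real.exp (-μ n * t) := by
  have hμ := h.eigenvalue_pos hV hVpos
  refine Summable.of_nonneg_of_le (fun n => mul_nonneg (pow_nonneg (hμ n).le _)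
    (Real.exp_pos _).le) (fun n => ?_)
    ((h.summable_inv hV hVpos).mul_left ((p + 1).factorial / t ^ (p + 1)))
  have h1 := Real.pow_div_factorial_le_exp (μ n * t) (mul_pos (hμ n) ht).le (p + 1)
  rw [neg_mul, Real.exp_neg]
  have h2 : (0 : ℝ) < (p + 1).factorial := by positivity
  have h3 := hμ n
  rw [div_le_iff₀ h2] at h1
  rw [← div_eq_mul_inv, ← div_eq_mul_inv, div_div, div_le_div_iff₀ (Real.exp_pos _) (by positivity)]
  calc μ n ^ p * (t ^ (p + 1) * μ n) = (μ n * t) ^ (p + 1) := by ring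
    _ ≤ _ := by linarith

/-- The exponential is at most $1$ and $\mu_q^3\ge\mu_0^2\mu_q$, so $\sum1/\mu_q$ dominates. -/
lemma summable_h2 (h : IsNeumannEigenbasis V μ e) (hV : ContinuousOn V (Icc 0 1))
    (hVpos : ∀ x ∈ Icc (0 : ℝ) 1, 0 < V x) {t : ℝ} (ht : 0 ≤ t) :
    Summable fun q : ℕ+ => Real.exp (-2 * (μ q - μ 0) * t) / μ q ^ 3 := by
  have hμ := h.eigenvalue_pos hV hVpos
  refine Summable.of_nonneg_of_le (fun n => div_nonneg (Real.exp_pos _).le (pow_nonneg (hμ n).le _))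
    (fun n => ?_) (((h.summable_inv hV hVpos).mul_left ((μ 0 ^ 2)⁻¹)).comp_injective
      PNat.coe_injective)
  have h0 := h.mono (Nat.zero_le (n : ℕ))
  have h1 : Real.exp (-2 * (μ n - μ 0) * t) ≤ 1 := Real.exp_le_one_iff.2 (by nlinarith)
  simp only [Function.comp_apply, ← mul_inv]
  refine (div_le_div_of_nonneg_right h1 (pow_nonneg (hμ n).le _)).trans ?_
  rw [one_div]
  have h2 := hμ 0
  have h3 := hμ n
  refine inv_anti₀ (by positivity) ?_
  rw [pow_succ]
  exact mul_le_mul_of_nonneg_right (pow_le_pow_left₀ h2.le h0 2) h3.le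

lemma h2_zero_pos (h : IsNeumannEigenbasis V μ e) (hV : ContinuousOn V (Icc 0 1))
    (hVpos : ∀ x ∈ Icc (0 : ℝ) 1, 0 < V x) : 0 < h2 μ 0 := by
  have hμ := h.eigenvalue_pos hV hVpos
  exact Real.sqrt_pos.2 ((h.summable_h2 hV hVpos le_rfl).tsum_pos
    (fun n => div_nonneg (Real.exp_pos _).le (pow_nonneg (hμ n).le _)) 1
    (div_pos (Real.exp_pos _) (pow_pos (hμ _) _)))

end IsNeumannEigenbasis

/-! ### Time dependence of the coefficients of a solution -/

lemma continuousOn_slice {F : ℝ → ℝ → ℝ}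
    (hF : ContinuousOn (fun p : ℝ × ℝ => F p.1 p.2) (Ioi 0 ×ˢ Icc 0 1)) {t : ℝ} (ht : 0 < t) :
    ContinuousOn (F t) (Icc 0 1) :=
  hF.comp (f := fun x => (t, x)) (continuousOn_const.prodMk continuousOn_id) fun _ hx => ⟨ht, hx⟩

/-- Differentiation under the integral sign. -/
lemma hasDerivAt_integral_param {F F' : ℝ → ℝ → ℝ}
    (hF : ContinuousOn (fun p : ℝ × ℝ => F p.1 p.2) (Ioi 0 ×ˢ Icc 0 1))
    (hF' : ContinuousOn (fun p : ℝ × ℝ => F' p.1 p.2) (Ioi 0 ×ˢ Icc 0 1))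
    (hd : ∀ t : ℝ, 0 < t → ∀ x ∈ Icc (0 : ℝ) 1, HasDerivAt (fun s => F s x) (F' t x) t)
    {t : ℝ} (ht : 0 < t) :
    HasDerivAt (fun s => ∫ x in (0 : ℝ)..1, F s x) (∫ x in (0 : ℝ)..1, F' t x) t := by
  -- A compact time window away from $0$, where nothing is controlled, supplies a constant
  -- dominating function.
  have hsub : Icc (t / 2) (2 * t) ×ˢ Icc (0 : ℝ) 1 ⊆ Ioi 0 ×ˢ Icc 0 1 :=
    prod_mono (fun s hs => lt_of_lt_of_le (half_pos ht) hs.1) Subset.rfl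
  obtain ⟨C, hC⟩ := (isCompact_Icc.prod isCompact_Icc).exists_bound_of_continuousOn (hF'.mono hsub)
  have hI : ∀ x ∈ uIoc (0 : ℝ) 1, x ∈ Icc (0 : ℝ) 1 := fun x hx => by
    rw [uIoc_of_le zero_le_one] at hx
    exact Ioc_subset_Icc_self hx
  have hmeas : ∀ {g : ℝ → ℝ}, ContinuousOn g (Icc 0 1) →
      AEStronglyMeasurable g (volume.restrict (uIoc (0 : ℝ) 1)) := fun hg =>
    (hg.mono hI).aestronglyMeasurable measurableSet_uIoc
  refine (intervalIntegral.hasDerivAt_integral_of_dominated_loc_of_deriv_le (bound := fun _ => C)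
    (Icc_mem_nhds (half_lt_self ht) (by linarith : t < 2 * t)) ?_
    (intervalIntegrable_of_continuousOn (continuousOn_slice hF ht))
    (hmeas (continuousOn_slice hF' ht)) ?_ intervalIntegrable_const ?_).2
  · filter_upwards [Ioi_mem_nhds ht] with s hs
    exact hmeas (continuousOn_slice hF hs)
  · exact ae_of_all _ fun x hx s hs => hC (s, x) ⟨hs, hI x hx⟩
  · exact ae_of_all _ fun x hx s hs => hd s (lt_of_lt_of_le (half_pos ht) hs.1) x (hI x hx)

/-- Green's formula for functions with vanishing normal derivative. -/
lemma integral_mul_deriv2_comm {f f' f'' g g' g'' : ℝ → ℝ}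
    (hf : ∀ x ∈ Icc (0 : ℝ) 1, HasDerivWithinAt f (f' x) (Icc 0 1) x)
    (hf' : ∀ x ∈ Icc (0 : ℝ) 1, HasDerivWithinAt f' (f'' x) (Icc 0 1) x)
    (hf'' : ContinuousOn f'' (Icc 0 1)) (hf0 : f' 0 = 0) (hf1 : f' 1 = 0)
    (hg : ∀ x ∈ Icc (0 : ℝ) 1, HasDerivWithinAt g (g' x) (Icc 0 1) x)
    (hg' : ∀ x ∈ Icc (0 : ℝ) 1, HasDerivWithinAt g' (g'' x) (Icc 0 1) x)
    (hg'' : ContinuousOn g'' (Icc 0 1)) (hg0 : g' 0 = 0) (hg1 : g' 1 = 0) :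
    ∫ x in (0 : ℝ)..1, f x * g'' x = ∫ x in (0 : ℝ)..1, f'' x * g x := by
  have h1 := integral_mul_deriv_Icc le_rfl zero_le_one le_rfl hf hg'
    (continuousOn_of_hasDerivWithinAt hf') hg''
  have h2 := integral_mul_deriv_Icc le_rfl zero_le_one le_rfl hg hf'
    (continuousOn_of_hasDerivWithinAt hg') hf''
  have h3 : ∫ x in (0 : ℝ)..1, f'' x * g x = ∫ x in (0 : ℝ)..1, g x * f'' x := by
    simp only [mul_comm]
  have h4 : ∫ x in (0 : ℝ)..1, f' x * g' x = ∫ x in (0 : ℝ)..1, g' x * f' x := by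
    simp only [mul_comm]
  rw [h1, h3, h2, h4, hf0, hf1, hg0, hg1]
  ring

/-- Two solutions of linear scalar equations whose coefficients differ by a constant. -/
lemma ratio_of_linear_ode {a y z : ℝ → ℝ} {α β y₀ z₀ : ℝ} (ha : ContinuousOn a (Ioi 0))
    (hy : ∀ t, 0 < t → HasDerivAt y ((a t - α) * y t) t)
    (hz : ∀ t, 0 < t → HasDerivAt z ((a t - β) * z t) t)
    (hy0 : Tendsto y (𝓝[>] 0) (𝓝 y₀)) (hz0 : Tendsto z (𝓝[>] 0) (𝓝 z₀)) (hne : z₀ ≠ 0)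
    {t : ℝ} (ht : 0 < t) :
    z t ≠ 0 ∧ y t / z t = Real.exp (-(α - β) * t) * (y₀ / z₀) := by
  -- The primitive is based at $1$, since `a` need not be integrable near $0$.
  have hA : ∀ t, 0 < t → HasDerivAt (fun t => ∫ s in (1 : ℝ)..t, a s) (a t) t := fun t ht => by
    refine intervalIntegral.integral_hasDerivAt_right
      (ContinuousOn.intervalIntegrable (ha.mono ?_))
      (ha.stronglyMeasurableAtFilter isOpen_Ioi t ht) (ha.continuousAt (Ioi_mem_nhds ht))
    exact fun s hs => lt_of_lt_of_le (lt_min one_pos ht) hs.1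
  have hconst : ∀ {y : ℝ → ℝ} {α : ℝ}, (∀ t, 0 < t → HasDerivAt y ((a t - α) * y t) t) →
      ∃ k, ∀ t, 0 < t → y t * Real.exp (α * t - ∫ s in (1 : ℝ)..t, a s) = k := by
    intro y α hy
    have hd : ∀ t, 0 < t →
        HasDerivAt (fun t => y t * Real.exp (α * t - ∫ s in (1 : ℝ)..t, a s)) 0 t := fun t ht => by
      convert! (hy t ht).mul (((hasDerivAt_id t).const_mul α).sub (hA t ht)).exp using 1
      simp only [id_eq, mul_one, Pi.sub_apply]
      ring
    refine ⟨_, fun t ht => isOpen_Ioi.is_const_of_deriv_eq_zero isPreconnected_Ioi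
      (fun t ht => (hd t ht).differentiableAt.differentiableWithinAt)
      (fun t ht => (hd t ht).deriv) ht (mem_Ioi.2 one_pos)⟩
  obtain ⟨k, hk⟩ := hconst hy
  obtain ⟨l, hl⟩ := hconst hz
  -- The constant can be read off at any time; for small times `z` is close to $z_0\ne0$. Then `z`
  -- never vanishes and the quotient makes sense.
  have hl0 : l ≠ 0 := by
    obtain ⟨s, hs, hs'⟩ := ((hz0.eventually_ne hne).and self_mem_nhdsWithin).exists
    rw [← hl s hs']
    exact mul_ne_zero hs (Real.exp_pos _).ne'
  have hzne : ∀ t, 0 < t → z t ≠ 0 := fun t ht h0 => by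
    have := hl t ht
    rw [h0, zero_mul] at this
    exact hl0 this.symm
  have hq : ∀ t, 0 < t → y t / z t * Real.exp ((α - β) * t) = k / l := fun t ht => by
    have e1 : Real.exp ((α - β) * t) = Real.exp (α * t - ∫ s in (1 : ℝ)..t, a s) /
        Real.exp (β * t - ∫ s in (1 : ℝ)..t, a s) := by
      rw [← Real.exp_sub]; ring_nf
    rw [e1, ← hk t ht, ← hl t ht]
    field_simp
  -- The unknown primitive has cancelled in the quotient, so the limit $t\to0^+$ may be taken
  -- although it may diverge in each factor's formula.
  have hlim : y₀ / z₀ = k / l := by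
    have h1 : Tendsto (fun t => y t / z t * Real.exp ((α - β) * t)) (𝓝[>] 0)
        (𝓝 (y₀ / z₀ * Real.exp ((α - β) * 0))) := by
      refine (hy0.div hz0 hne).mul (Tendsto.mono_left (Continuous.tendsto ?_ 0) nhdsWithin_le_nhds)
      fun_prop
    have h2 : Tendsto (fun t => y t / z t * Real.exp ((α - β) * t)) (𝓝[>] 0) (𝓝 (k / l)) :=
      tendsto_const_nhds.congr' (by
        filter_upwards [self_mem_nhdsWithin] with t ht using (hq t ht).symm)
    simpa using tendsto_nhds_unique h1 h2
  refine ⟨hzne t ht, ?_⟩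
  rw [hlim, ← hq t ht, mul_comm, mul_assoc, ← Real.exp_add,
    show (α - β) * t + -(α - β) * t = 0 by ring, Real.exp_zero, mul_one]

namespace IsNonlinearHeatSolution

variable {V v₀ : ℝ → ℝ} {v : ℝ → ℝ → ℝ}

lemma continuousOn (h : IsNonlinearHeatSolution V v₀ v) {t : ℝ} (ht : 0 < t) :
    ContinuousOn (v t) (Icc 0 1) := by
  obtain ⟨⟨vt, vx, vxx, hv, -⟩, -⟩ := h
  exact continuousOn_slice hv ht

/-- The weak form of the equation. -/
lemma hasDerivAt_integral (hV : ContinuousOn V (Icc 0 1)) (h : IsNonlinearHeatSolution V v₀ v)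
    {f f' f'' : ℝ → ℝ}
    (hf : ∀ x ∈ Icc (0 : ℝ) 1, HasDerivWithinAt f (f' x) (Icc 0 1) x)
    (hf' : ∀ x ∈ Icc (0 : ℝ) 1, HasDerivWithinAt f' (f'' x) (Icc 0 1) x)
    (hf'' : ContinuousOn f'' (Icc 0 1)) (hf0 : f' 0 = 0) (hf1 : f' 1 = 0) {t : ℝ} (ht : 0 < t) :
    HasDerivAt (fun s => ∫ x in (0 : ℝ)..1, f x * v s x)
      ((∫ x in (0 : ℝ)..1, (f'' x - V x * f x) * v t x) +
        (∫ x in (0 : ℝ)..1, V x * v t x) * ∫ x in (0 : ℝ)..1, f x * v t x) t := by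
  obtain ⟨⟨vt, vx, vxx, hv, hvt, hvx, hvxx, heq⟩, -, -⟩ := h
  have hfc := continuousOn_of_hasDerivWithinAt hf
  have hfp : ContinuousOn (fun p : ℝ × ℝ => f p.2) (Ioi 0 ×ˢ Icc 0 1) :=
    hfc.comp continuousOn_snd fun p hp => hp.2
  have h1 := hasDerivAt_integral_param (F := fun t x => f x * v t x) (F' := fun t x => f x * vt t x)
    (hfp.mul hv) (hfp.mul hvt) (fun t ht x hx => ((heq t ht).1 x hx).1.const_mul _) ht
  convert! h1 using 1
  have h2 := integral_mul_deriv2_comm hf hf' hf'' hf0 hf1 (fun x hx => ((heq t ht).1 x hx).2.1)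
    (fun x hx => ((heq t ht).1 x hx).2.2.1) (continuousOn_slice hvxx ht) (heq t ht).2.1
    (heq t ht).2.2
  have hvc := continuousOn_slice hv ht
  have i1 : IntervalIntegrable (fun x => f'' x * v t x) volume 0 1 :=
    intervalIntegrable_of_continuousOn (hf''.mul hvc)
  have i2 : IntervalIntegrable (fun x => V x * f x * v t x) volume 0 1 :=
    intervalIntegrable_of_continuousOn ((hV.mul hfc).mul hvc)
  have i3 : IntervalIntegrable (fun x => f x * vxx t x) volume 0 1 :=
    intervalIntegrable_of_continuousOn (hfc.mul (continuousOn_slice hvxx ht))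
  have i4 : IntervalIntegrable
      (fun x => (∫ x in (0 : ℝ)..1, V x * v t x) * (f x * v t x)) volume 0 1 :=
    intervalIntegrable_of_continuousOn (continuousOn_const.mul (hfc.mul hvc))
  have h3 : ∫ x in (0 : ℝ)..1, f x * vt t x = ∫ x in (0 : ℝ)..1, (f x * vxx t x -
      V x * f x * v t x + (∫ x in (0 : ℝ)..1, V x * v t x) * (f x * v t x)) :=
    intervalIntegral.integral_congr fun x hx => by
      rw [uIcc_of_le zero_le_one] at hx
      simp only [((heq t ht).1 x hx).2.2.2]
      ring
  rw [h3, intervalIntegral.integral_add (i3.sub i2) i4, intervalIntegral.integral_sub i3 i2, h2,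
    intervalIntegral.integral_const_mul, ← intervalIntegral.integral_sub i1 i2]
  simp only [sub_mul]

lemma continuousOn_integral (h : IsNonlinearHeatSolution V v₀ v) (hV : ContinuousOn V (Icc 0 1)) :
    ContinuousOn (fun t => ∫ x in (0 : ℝ)..1, V x * v t x) (Ioi 0) := by
  obtain ⟨⟨vt, vx, vxx, hv, hvt, hvx, hvxx, heq⟩, -, -⟩ := h
  have hfp : ContinuousOn (fun p : ℝ × ℝ => V p.2) (Ioi 0 ×ˢ Icc 0 1) :=
    hV.comp continuousOn_snd fun p hp => hp.2
  exact fun t ht => (hasDerivAt_integral_param (F := fun t x => V x * v t x)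
    (F' := fun t x => V x * vt t x) (hfp.mul hv) (hfp.mul hvt)
    (fun t ht x hx => ((heq t ht).1 x hx).1.const_mul _) ht).continuousAt.continuousWithinAt

/-- By Cauchy–Schwarz, $L^2$ convergence to the initial value passes to every moment, giving the
linear equations for the coefficients their initial data. -/
lemma tendsto_integral (h : IsNonlinearHeatSolution V v₀ v) (hv₀ : ContinuousOn v₀ (Icc 0 1))
    {f : ℝ → ℝ} (hf : MemL2 f) :
    Tendsto (fun t => ∫ x in (0 : ℝ)..1, f x * v t x) (𝓝[>] 0)
      (𝓝 (∫ x in (0 : ℝ)..1, f x * v₀ x)) := by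
  have h1 : Tendsto (fun t => l2Norm f * l2Norm fun x => v t x - v₀ x) (𝓝[>] 0) (𝓝 0) := by
    simpa using h.2.2.const_mul (l2Norm f)
  rw [tendsto_iff_norm_sub_tendsto_zero]
  refine squeeze_zero' (Eventually.of_forall fun _ => norm_nonneg _) ?_ h1
  filter_upwards [self_mem_nhdsWithin] with t ht
  have m1 := memL2_of_continuousOn (h.continuousOn ht)
  have m0 := memL2_of_continuousOn hv₀
  have h2 := abs_integral_mul_le hf (m1.sub m0)
  simp only [mul_sub] at h2
  rwa [intervalIntegral.integral_sub (hf.integrable_mul m1) (hf.integrable_mul m0)] at h2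

variable {μ : ℕ → ℝ} {e : ℕ → ℝ → ℝ}

/-- Testing against $e_n$ moves the operator onto the eigenfunction. The nonlocal term contributes a
factor independent of $n$, so the system decouples up to that factor. -/
lemma hasDerivAt_coeff (hV : ContinuousOn V (Icc 0 1)) (h : IsNonlinearHeatSolution V v₀ v)
    (he : IsNeumannEigenbasis V μ e) (n : ℕ) {t : ℝ} (ht : 0 < t) :
    HasDerivAt (fun s => coeff e n (v s))
      (((∫ x in (0 : ℝ)..1, V x * v t x) - μ n) * coeff e n (v t)) t := by
  obtain ⟨e', he'⟩ := he.exists_isEigenfamily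
  convert! h.hasDerivAt_integral hV (he'.pair n).deriv (he'.pair n).deriv'
    ((hV.sub continuousOn_const).mul (he.continuousOn n)) (he'.pair n).left (he'.pair n).right ht
    using 1
  have h1 : ∀ x, ((V x - μ n) * e n x - V x * e n x) * v t x = -μ n * (e n x * v t x) :=
    fun x => by ring
  simp only [h1, intervalIntegral.integral_const_mul, coeff]
  ring

lemma coeff_ratio (hV : ContinuousOn V (Icc 0 1)) (h : IsNonlinearHeatSolution V v₀ v)
    (he : IsNeumannEigenbasis V μ e) (hv₀ : v₀ ∈ P1) (n : ℕ) {t : ℝ} (ht : 0 < t) :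
    coeff e 0 (v t) ≠ 0 ∧ coeff e n (v t) / coeff e 0 (v t) =
      Real.exp (-(μ n - μ 0) * t) * (coeff e n v₀ / coeff e 0 v₀) :=
  ratio_of_linear_ode (h.continuousOn_integral hV) (fun _ ht => h.hasDerivAt_coeff hV he n ht)
    (fun _ ht => h.hasDerivAt_coeff hV he 0 ht) (h.tendsto_integral hv₀.1 (he.memL2 n))
    (h.tendsto_integral hv₀.1 (he.memL2 0)) (he.coeff_zero_pos hv₀.1 hv₀.2.2.1).ne' ht

/-- Testing with the constant $1$ shows that $\int v-1$ solves $\dot y=ay$, the equation of $c_0$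
with $\mu_0$ replaced by $0$, and tends to $0$ at time $0$; hence its ratio to $c_0$ is $0$. -/
lemma integral_eq_one (hV : ContinuousOn V (Icc 0 1)) (h : IsNonlinearHeatSolution V v₀ v)
    (he : IsNeumannEigenbasis V μ e) (hv₀ : v₀ ∈ P1) {t : ℝ} (ht : 0 < t) :
    ∫ x in (0 : ℝ)..1, v t x = 1 := by
  have hd : ∀ t, 0 < t → HasDerivAt (fun s => (∫ x in (0 : ℝ)..1, v s x) - 1)
      (((∫ x in (0 : ℝ)..1, V x * v t x) - 0) * ((∫ x in (0 : ℝ)..1, v t x) - 1)) t :=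
    fun t ht => by
    have h1 := h.hasDerivAt_integral hV (f := fun _ => 1) (f' := fun _ => 0) (f'' := fun _ => 0)
      (fun _ _ => hasDerivWithinAt_const _ _ _) (fun _ _ => hasDerivWithinAt_const _ _ _)
      continuousOn_const rfl rfl ht
    simp only [one_mul, mul_one, zero_sub, neg_mul, intervalIntegral.integral_neg] at h1
    convert! h1.sub_const 1 using 1
    ring
  have hlim : Tendsto (fun s => (∫ x in (0 : ℝ)..1, v s x) - 1) (𝓝[>] 0) (𝓝 0) := by
    have h1 := (h.tendsto_integral hv₀.1 (f := fun _ => 1)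
      (memL2_of_continuousOn continuousOn_const)).sub_const 1
    simp only [one_mul, hv₀.2.2.2, sub_self] at h1
    exact h1
  have := ratio_of_linear_ode (h.continuousOn_integral hV) hd
    (fun _ ht => h.hasDerivAt_coeff hV he 0 ht) hlim
    (h.tendsto_integral hv₀.1 (he.memL2 0)) (he.coeff_zero_pos hv₀.1 hv₀.2.2.1).ne' ht
  rw [zero_div, mul_zero, div_eq_zero_iff] at this
  linarith [this.2.resolve_right this.1]

/-- `ψ_ν` is an eigenfunctional of the Koopman semigroup. -/
lemma psi_eq (hV : ContinuousOn V (Icc 0 1)) (h : IsNonlinearHeatSolution V v₀ v)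
    (he : IsNeumannEigenbasis V μ e) (hv₀ : v₀ ∈ P1) (ν : B) {t : ℝ} (ht : 0 ≤ t) :
    psi e ν (v t) = Real.exp (-rate μ ν * t) * psi e ν v₀ := by
  rcases ht.eq_or_lt with rfl | ht
  · have h1 : ∀ n, coeff e n (v 0) = coeff e n v₀ := fun n => coeff_congr n h.2.1
    simp [psi, h1]
  · have h1 : Real.exp (-rate μ ν * t) = Real.exp (-(μ ν.2.1 - μ 0) * t) *
        ∏ i, Real.exp (-(μ (ν.2.2 i) - μ 0) * t) := by
      rw [← Real.exp_sum, ← Real.exp_add, ← Finset.sum_mul, Finset.sum_neg_distrib, rate]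
      ring_nf
    simp only [psi, (h.coeff_ratio hV he hv₀ _ ht).2, Finset.prod_mul_distrib, h1]
    ring

end IsNonlinearHeatSolution

/-! ### The Koopman series -/

/-- The $m$-th power of an absolutely convergent series is the sum over words of length $m$, by
splitting off the first letter. -/
lemma hasSum_prod_fin {ι : Type*} {β : ι → ℝ} (hβ : Summable fun i => |β i|) (m : ℕ) :
    (Summable fun q : Fin m → ι => |∏ i, β (q i)|) ∧
      HasSum (fun q : Fin m → ι => ∏ i, β (q i)) ((∑' i, β i) ^ m) := by
  induction m with
  | zero => 
    exact ⟨(hasSum_unique _).summable, by simp⟩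
  | succ m ih =>
    obtain ⟨E, hE⟩ : ∃ E : ι × (Fin m → ι) ≃ (Fin (m + 1) → ι),
        ∀ p, ∏ i, β (E p i) = β p.1 * ∏ i, β (p.2 i) :=
      ⟨Fin.consEquiv fun _ => ι, fun p => by simp [Fin.prod_univ_succ, Fin.consEquiv]⟩
    have hs : Summable fun p : ι × (Fin m → ι) => |β p.1 * ∏ i, β (p.2 i)| :=
      Summable.mul_norm (f := β) (g := fun q : Fin m → ι => ∏ i, β (q i)) hβ ih.1
    have h1 : HasSum β (∑' i, β i) := hβ.of_abs.hasSum
    have h2 := HasSum.mul h1 ih.2 hs.of_abs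
    rw [← pow_succ'] at h2
    constructor
    · rw [← E.summable_iff]
      simpa only [Function.comp_def, hE] using hs
    · rw [← E.hasSum_iff]
      simp only [Function.comp_def, hE]
      exact h2

lemma hasSum_mul_prod_fin {κ ι : Type*} {α : κ → ℝ} {β : ι → ℝ} (hα : Summable fun n => |α n|)
    (hβ : Summable fun i => |β i|) (m : ℕ) :
    (Summable fun p : κ × (Fin m → ι) => |α p.1 * ∏ i, β (p.2 i)|) ∧
      HasSum (fun p : κ × (Fin m → ι) => α p.1 * ∏ i, β (p.2 i))
        ((∑' n, α n) * (∑' i, β i) ^ m) := by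
  have hs : Summable fun p : κ × (Fin m → ι) => |α p.1 * ∏ i, β (p.2 i)| :=
    Summable.mul_norm (f := α) (g := fun q : Fin m → ι => ∏ i, β (q i)) hα (hasSum_prod_fin hβ m).1
  have h1 : HasSum α (∑' i, α i) := hα.of_abs.hasSum
  have h2 := HasSum.mul h1 (hasSum_prod_fin hβ m).2 hs.of_abs
  exact ⟨hs, h2⟩

/-- Summation over the words `(q₀, q₁, …, q_m)`, reduced to a geometric series. -/
lemma hasSum_words {α : ℕ → ℝ} {β : ℕ+ → ℝ} (hα : Summable fun n => |α n|)
    (hβ : Summable fun n => |β n|) (h1 : ∑' n, |β n| < 1) :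
    (Summable fun ν : B => |α ν.2.1| * ∏ i, |β (ν.2.2 i)|) ∧
      HasSum (fun ν : B => (-1) ^ ν.1 * α ν.2.1 * ∏ i, β (ν.2.2 i))
        ((∑' n, α n) / (1 + ∑' n, β n)) := by
  have hw : ∀ m, HasSum (fun p : ℕ × (Fin m → ℕ+) => |α p.1| * ∏ i, |β (p.2 i)|)
      ((∑' n, |α n|) * (∑' n, |β n|) ^ m) := fun m =>
    (hasSum_mul_prod_fin (α := fun n => |α n|) (β := fun n => |β n|) (by simpa using hα)
      (by simpa using hβ) m).2
  have h0 : 0 ≤ ∑' n, |β n| := tsum_nonneg fun _ => abs_nonneg _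
  -- The words with $m$ letters after the first contribute $(\sum|\alpha|)(\sum|\beta|)^m$, a
  -- convergent geometric series in $m$.
  have hsum : Summable fun ν : B => |α ν.2.1| * ∏ i, |β (ν.2.2 i)| := by
    refine (summable_sigma_of_nonneg fun ν => mul_nonneg (abs_nonneg _)
      (Finset.prod_nonneg fun _ _ => abs_nonneg _)).2 ⟨fun m => (hw m).summable, ?_⟩
    have h2 : ∀ m, ∑' p : ℕ × (Fin m → ℕ+), |α p.1| * ∏ i, |β (p.2 i)| =
      (∑' n, |α n|) * (∑' n, |β n|) ^ m := fun m => (hw m).tsum_eq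
    simp only [h2]
    exact (summable_geometric_of_lt_one h0 h1).mul_left _
  refine ⟨hsum, ?_⟩
  have hβlt : |-∑' n, β n| < 1 := by
    rw [abs_neg]
    have h4 : Summable fun n => ‖β n‖ := by simpa only [Real.norm_eq_abs] using hβ
    have h5 := norm_tsum_le_tsum_norm h4
    simp only [Real.norm_eq_abs] at h5
    exact h5.trans_lt h1
  have hgeo : HasSum (fun m : ℕ => (-1) ^ m * ((∑' n, α n) * (∑' n, β n) ^ m))
      ((∑' n, α n) / (1 + ∑' n, β n)) := by
    have h3 := (hasSum_geometric_of_abs_lt_one hβlt).mul_left (∑' n, α n)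
    rw [sub_neg_eq_add, ← div_eq_mul_inv] at h3
    refine h3.congr_fun fun m => ?_
    rw [neg_pow (∑' n, β n), mul_left_comm]
  have hs2 : Summable fun ν : B => (-1) ^ ν.1 * α ν.2.1 * ∏ i, β (ν.2.2 i) := by
    refine Summable.of_norm (hsum.congr fun ν => ?_)
    simp
  refine HasSum.sigma_of_hasSum hgeo (fun m => ?_) hs2
  have h3 := (hasSum_mul_prod_fin hα hβ m).2.mul_left ((-1 : ℝ) ^ m)
  simpa only [mul_assoc] using h3

/-! ### Synthesis of functions from their Fourier coefficients, and the Koopman series. -/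

lemma summable_of_abs_le {ι : Type*} {f b : ι → ℝ} (hb : Summable b) (h : ∀ n, |f n| ≤ b n) :
    Summable f :=
  Summable.of_norm_bounded hb (by simpa only [Real.norm_eq_abs] using h)

lemma mem_Icc_of_mem_uIoc {x : ℝ} (hx : x ∈ uIoc (0 : ℝ) 1) : x ∈ Icc (0 : ℝ) 1 := by
  rw [uIoc_of_le zero_le_one] at hx
  exact Ioc_subset_Icc_self hx

lemma hasSum_integral_mul {g : ℕ → ℝ → ℝ} {b : ℕ → ℝ} (hg : ∀ q, ContinuousOn (g q) (Icc 0 1))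
    (hb : Summable b) (hle : ∀ q, ∀ x ∈ Icc (0 : ℝ) 1, |g q x| ≤ b q) {f : ℝ → ℝ}
    (hf : ContinuousOn f (Icc 0 1)) :
    HasSum (fun q => ∫ x in (0 : ℝ)..1, f x * g q x)
      (∫ x in (0 : ℝ)..1, f x * ∑' q, g q x) := by
  obtain ⟨C, hC⟩ := isCompact_Icc.exists_bound_of_continuousOn hf
  simp only [Real.norm_eq_abs] at hC
  refine intervalIntegral.hasSum_integral_of_dominated_convergence (fun q _ => C * b q)
    (fun q => (((hf.mul (hg q)).mono fun _ => mem_Icc_of_mem_uIoc).aestronglyMeasurable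
      measurableSet_uIoc)) (fun q => ae_of_all _ fun x hx => ?_)
    (ae_of_all _ fun _ _ => hb.mul_left C) intervalIntegrable_const
    (ae_of_all _ fun x hx => ?_)
  · have hx' := mem_Icc_of_mem_uIoc hx
    rw [Real.norm_eq_abs, abs_mul]
    exact mul_le_mul (hC x hx') (hle q x hx') (abs_nonneg _) ((abs_nonneg _).trans (hC x hx'))
  · exact (summable_of_abs_le hb fun q => hle q x (mem_Icc_of_mem_uIoc hx)).hasSum.mul_left _

/-- The function with Fourier coefficients `u`. -/
def synth (e : ℕ → ℝ → ℝ) (u : ℕ → ℝ) (x : ℝ) : ℝ := ∑' n, u n * e n x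

namespace IsNeumannEigenbasis

variable {V : ℝ → ℝ} {μ : ℕ → ℝ} {e : ℕ → ℝ → ℝ}

lemma exists_abs_le (h : IsNeumannEigenbasis V μ e) (hV : ContinuousOn V (Icc 0 1))
    (hVpos : ∀ x ∈ Icc (0 : ℝ) 1, 0 < V x) :
    ∃ K : ℝ, 0 < K ∧ ∀ n, ∀ x ∈ Icc (0 : ℝ) 1, |e n x| ≤ K * μ n := by
  obtain ⟨e', he'⟩ := h.exists_isEigenfamily
  obtain ⟨K, hK, hb⟩ := h.exists_bound hV hVpos he'
  exact ⟨K, hK, fun n x hx => (hb n x hx).1⟩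

/-- Since $|e_n|\le K\mu_n$, summability of $|u_n|\mu_n$ is a Weierstrass condition. It gives
continuity and termwise integration, and the latter recovers the coefficients. -/
lemma synth_spec (h : IsNeumannEigenbasis V μ e) (hV : ContinuousOn V (Icc 0 1))
    (hVpos : ∀ x ∈ Icc (0 : ℝ) 1, 0 < V x) {u : ℕ → ℝ} (hu : Summable fun n => |u n| * μ n) :
    (∀ x ∈ Icc (0 : ℝ) 1, Summable fun n => |u n * e n x|) ∧
    ContinuousOn (synth e u) (Icc 0 1) ∧ (∀ f, ContinuousOn f (Icc 0 1) →
      HasSum (fun n => u n * coeff e n f) (∫ x in (0 : ℝ)..1, f x * synth e u x)) ∧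
    ∀ n, coeff e n (synth e u) = u n := by
  obtain ⟨K, hK, hb⟩ := h.exists_abs_le hV hVpos
  have hbs : Summable fun n => K * (|u n| * μ n) := hu.mul_left K
  have hle : ∀ n, ∀ x ∈ Icc (0 : ℝ) 1, |u n * e n x| ≤ K * (|u n| * μ n) := fun n x hx => by
    rw [abs_mul, mul_left_comm]
    exact mul_le_mul_of_nonneg_left (hb n x hx) (abs_nonneg _)
  have hc : ∀ n, ContinuousOn (fun x => u n * e n x) (Icc 0 1) := fun n =>
    continuousOn_const.mul (h.continuousOn n)
  have hsum : ∀ f, ContinuousOn f (Icc 0 1) →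
      HasSum (fun n => u n * coeff e n f) (∫ x in (0 : ℝ)..1, f x * synth e u x) := by
    intro f hf
    convert! hasSum_integral_mul hc hbs hle hf using 2 with n
    rw [coeff, ← intervalIntegral.integral_const_mul]
    congr 1; ext x; ring
  refine ⟨fun x hx => Summable.of_nonneg_of_le (fun _ => abs_nonneg _) (fun n => hle n x hx) hbs,
    continuousOn_tsum hc hbs hle, hsum, fun n => ?_⟩
  have h1 := hsum (e n) (h.continuousOn n)
  have h2 : ∀ m, u m * coeff e m (e n) = if m = n then u n else 0 := fun m => by
    rw [coeff, h.orthonormal]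
    split_ifs with hm
    · rw [hm, mul_one]
    · rw [mul_zero]
  simp only [h2] at h1
  exact h1.unique (hasSum_ite_eq n (u n))

/-- A continuous function is the sum of its eigenfunction expansion when the latter converges
uniformly. -/
lemma hasSum_of_coeff (h : IsNeumannEigenbasis V μ e) (hV : ContinuousOn V (Icc 0 1))
    (hVpos : ∀ x ∈ Icc (0 : ℝ) 1, 0 < V x) {f : ℝ → ℝ} (hf : ContinuousOn f (Icc 0 1))
    (hu : Summable fun n => |coeff e n f| * μ n) {x : ℝ} (hx : x ∈ Icc (0 : ℝ) 1) :
    HasSum (fun n => coeff e n f * e n x) (f x) := by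
  obtain ⟨hs, hc, -, hco⟩ := h.synth_spec hV hVpos hu
  -- All coefficients of the difference vanish, so completeness makes it zero almost everywhere and
  -- continuity makes it zero everywhere.
  have h0 : (fun x => f x - synth e (fun n => coeff e n f) x) =ᵐ[unitMeasure] 0 := by
    refine h.complete _ (memL2_of_continuousOn (hf.sub hc)) fun n => ?_
    simp only [mul_sub]
    rw [intervalIntegral.integral_sub
      ((h.memL2 n).integrable_mul (memL2_of_continuousOn hf))
      ((h.memL2 n).integrable_mul (memL2_of_continuousOn hc))]
    exact sub_eq_zero.2 (hco n).symm
  have h1 : f x = synth e (fun n => coeff e n f) x := eqOn_Icc_of_ae_eq hf hc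
    (h0.mono fun x hx => sub_eq_zero.1 hx) hx
  rw [h1]
  exact (hs x hx).of_abs.hasSum

lemma coeff_sub_mul (h : IsNeumannEigenbasis V μ e) {f : ℝ → ℝ} (hf : MemL2 f) (n : ℕ) :
    coeff e n (deviation e f) = if n = 0 then 0 else coeff e n f := by
  have h1 : coeff e n (deviation e f) =
      coeff e n f - coeff e 0 f * ∫ x in (0 : ℝ)..1, e n x * e 0 x := by
    rw [← intervalIntegral.integral_const_mul, coeff, coeff, ← intervalIntegral.integral_sub
      ((h.memL2 n).integrable_mul hf) (((h.memL2 n).integrable_mul (h.memL2 0)).const_mul _)]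
    refine intervalIntegral.integral_congr fun x _ => ?_
    simp only [deviation]
    ring
  rw [h1, h.orthonormal]
  split_ifs with hn
  · rw [hn]; ring
  · ring

lemma memL2_deviation (h : IsNeumannEigenbasis V μ e) {f : ℝ → ℝ} (hf : MemL2 f) :
    MemL2 (deviation e f) := hf.sub ((h.memL2 0).const_mul _)

/-- Passing to the deviation removes the mode $0$ and keeps the others. Parseval for deviations then
combines with the finite Cauchy–Schwarz inequality. -/
lemma sum_abs_coeff_mul_le (h : IsNeumannEigenbasis V μ e) {f g : ℝ → ℝ} (hf : MemL2 f)
    (hg : MemL2 g) (s : Finset ℕ+) :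
    ∑ q ∈ s, |coeff e q f| * |coeff e q g| ≤ l2Norm (deviation e f) * l2Norm (deviation e g) := by
  have key : ∀ {f : ℝ → ℝ}, MemL2 f → ∑ q ∈ s, |coeff e q f| ^ 2 ≤ l2Norm (deviation e f) ^ 2 := by
    intro f hf
    have h1 := h.parseval (h.memL2_deviation hf) (h.memL2_deviation hf)
    simp only [← sq] at h1
    rw [← l2Norm_sq] at h1
    have h2 := sum_le_hasSum (s.map ⟨fun q : ℕ+ => (q : ℕ), PNat.coe_injective⟩)
      (fun _ _ => sq_nonneg _) h1
    rw [Finset.sum_map] at h2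
    refine (Finset.sum_le_sum fun q _ => ?_).trans h2
    simp only [Function.Embedding.coeFn_mk, h.coeff_sub_mul hf, q.ne_zero, if_false, sq_abs]
    exact le_rfl
  refine abs_le_of_sq_le_sq' ?_ (mul_nonneg (l2Norm_nonneg _) (l2Norm_nonneg _)) |>.2
  rw [mul_pow]
  exact (Finset.sum_mul_sq_le_sq_mul_sq s _ _).trans (mul_le_mul (key hf) (key hg)
    (Finset.sum_nonneg fun _ _ => sq_nonneg _) (sq_nonneg _))

lemma abs_coeff_le (h : IsNeumannEigenbasis V μ e) {f : ℝ → ℝ} (hf : MemL2 f) (n : ℕ) :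
    |coeff e n f| ≤ l2Norm f := by
  have h1 := abs_integral_mul_le (h.memL2 n) hf
  have h2 : l2Norm (e n) = 1 := by
    have := h.orthonormal n n
    simp only [if_true, ← sq] at this
    rw [l2Norm, this, Real.sqrt_one]
  rwa [h2, one_mul] at h1

/-- Coefficients damped by the heat flow decay fast. -/
lemma summable_damped (h : IsNeumannEigenbasis V μ e) (hV : ContinuousOn V (Icc 0 1))
    (hVpos : ∀ x ∈ Icc (0 : ℝ) 1, 0 < V x) {f : ℝ → ℝ} (hf : MemL2 f) (p : ℕ) {t : ℝ}
    (ht : 0 < t) : Summable fun n => |coeff e n f| * (μ n ^ p * Real.exp (-μ n * t)) := by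
  have hμ := h.eigenvalue_pos hV hVpos
  refine Summable.of_nonneg_of_le (fun n => mul_nonneg (abs_nonneg _)
    (mul_nonneg (pow_nonneg (hμ n).le _) (Real.exp_pos _).le)) (fun n => ?_)
    ((h.summable_pow_mul_exp hV hVpos p ht).mul_left (l2Norm f))
  exact mul_le_mul_of_nonneg_right (h.abs_coeff_le hf n)
    (mul_nonneg (pow_nonneg (hμ n).le _) (Real.exp_pos _).le)

end IsNeumannEigenbasis

/-- The Koopman decomposition under the smallness condition that makes the geometric expansion
of the normalisation converge. -/
theorem hasKoopmanDecomposition_of_lt {V v₀ : ℝ → ℝ} {μ : ℕ → ℝ} {e : ℕ → ℝ → ℝ} {v : ℝ → ℝ → ℝ}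
    (hV : ContinuousOn V (Icc 0 1)) (hVpos : ∀ x ∈ Icc (0 : ℝ) 1, 0 < V x)
    (he : IsNeumannEigenbasis V μ e) (hv₀ : v₀ ∈ P1) (h : IsNonlinearHeatSolution V v₀ v)
    {t : ℝ} (ht : 0 < t)
    (hlt : Real.exp (-(μ 1 - μ 0) * t) * (l2Norm (deviation e v₀) * l2Norm (deviation e 1)) <
      coeff e 0 v₀ * mean e 0) :
    HasKoopmanDecomposition μ e v₀ t (v t) := by
  have hμ := he.eigenvalue_pos hV hVpos
  have hm0 := he.mean_zero_pos
  have hc0 := he.coeff_zero_pos hv₀.1 hv₀.2.2.1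
  have hv₀L := memL2_of_continuousOn hv₀.1
  have hvc := h.continuousOn ht
  obtain ⟨K, hK, hbe⟩ := he.exists_abs_le hV hVpos
  -- `u n` is the ratio $c_n/c_0$ at time `t`, expressed through the initial data.
  obtain ⟨u, hu⟩ : ∃ u : ℕ → ℝ, ∀ n, u n =
    Real.exp (-(μ n - μ 0) * t) * (coeff e n v₀ / coeff e 0 v₀) := ⟨_, fun _ => rfl⟩
  have hratio := fun n => h.coeff_ratio hV he hv₀ n ht
  have hcv : ∀ n, coeff e n (v t) = coeff e 0 (v t) * u n := fun n => by
    have := (hratio n).2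
    rw [div_eq_iff (hratio n).1] at this
    rw [this, hu, mul_comm]
  have hus : Summable fun n => |u n| * μ n := by
    refine ((he.summable_damped hV hVpos hv₀L 1 ht).mul_left
      (Real.exp (μ 0 * t) / coeff e 0 v₀)).congr fun n => ?_
    have e1 : Real.exp (-(μ n - μ 0) * t) = Real.exp (μ 0 * t) * Real.exp (-μ n * t) := by
      rw [← Real.exp_add]; ring_nf
    simp only [hu, abs_mul, abs_div, abs_of_pos hc0, abs_of_pos (Real.exp_pos _), e1]
    ring
  obtain ⟨β, hβ⟩ : ∃ β : ℕ+ → ℝ, ∀ q : ℕ+, β q = u q * (mean e q / mean e 0) := ⟨_, fun _ => rfl⟩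
  -- For $q\ge1$ the slowest factor $e^{-(\mu_1-\mu_0)t}$ comes out of the sum; the rest is the
  -- product of the coefficients of $v_0$ and of $1$.
  have hβle : ∀ s : Finset ℕ+, ∑ q ∈ s, |β q| ≤
      Real.exp (-(μ 1 - μ 0) * t) * (l2Norm (deviation e v₀) * l2Norm (deviation e 1)) /
        (coeff e 0 v₀ * mean e 0) := fun s => by
    have h1 := he.sum_abs_coeff_mul_le hv₀L
      (memL2_of_continuousOn (f := 1) continuousOn_const) s
    rw [mul_div_assoc]
    refine le_trans ?_ (mul_le_mul_of_nonneg_left (div_le_div_of_nonneg_right h1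
      (mul_pos hc0 hm0).le) (Real.exp_pos _).le)
    rw [Finset.sum_div, Finset.mul_sum]
    refine Finset.sum_le_sum fun q _ => ?_
    have e1 : |β q| = Real.exp (-(μ q - μ 0) * t) *
        (|coeff e q v₀| * |coeff e q 1| / (coeff e 0 v₀ * mean e 0)) := by
      simp only [hβ, hu, abs_mul, abs_div, abs_of_pos hc0, abs_of_pos hm0,
        abs_of_pos (Real.exp_pos _), ← IsNeumannEigenbasis.mean_eq_coeff]
      field_simp
    rw [e1]
    refine mul_le_mul_of_nonneg_right (Real.exp_le_exp.2 ?_) (by positivity)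
    have : μ 1 ≤ μ q := he.mono q.pos
    nlinarith
  have hβs : Summable fun q => |β q| := summable_of_sum_le (fun _ => abs_nonneg _) hβle
  have hβ1 : ∑' q, |β q| < 1 := by
    refine (Real.tsum_le_of_sum_le (fun _ => abs_nonneg _) hβle).trans_lt ?_
    rwa [div_lt_one (mul_pos hc0 hm0)]
  -- The rate is additive and $\psi_\nu$, $b_\nu$ are multiplicative in the letters, so each term
  -- splits into one factor per letter.
  have hterm : ∀ ν x, koopmanTerm μ e v₀ t ν x =
      (-1) ^ ν.1 * (u ν.2.1 * (e ν.2.1 x / mean e 0)) * ∏ i, β (ν.2.2 i) := fun ν x => by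
    have h1 : Real.exp (-rate μ ν * t) = Real.exp (-(μ ν.2.1 - μ 0) * t) *
        ∏ i, Real.exp (-(μ (ν.2.2 i) - μ 0) * t) := by
      rw [← Real.exp_sum, ← Real.exp_add, ← Finset.sum_mul, Finset.sum_neg_distrib, rate]
      ring_nf
    simp only [koopmanTerm, h1, psi, mode, hβ, hu, Finset.prod_mul_distrib]
    ring
  have hsup : ∀ ν : B, ∀ x ∈ Icc (0 : ℝ) 1, |koopmanTerm μ e v₀ t ν x| ≤
      |(|u ν.2.1| * μ ν.2.1) * (K / mean e 0)| * ∏ i, |β (ν.2.2 i)| := fun ν x hx => by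
    rw [hterm, abs_mul, abs_mul, abs_pow, abs_neg, abs_one, one_pow, one_mul, Finset.abs_prod,
      abs_of_nonneg (a := |u ν.2.1| * μ ν.2.1 * (K / mean e 0))
        (mul_nonneg (mul_nonneg (abs_nonneg _) (hμ _).le) (by positivity)), abs_mul, abs_div,
      abs_of_pos hm0]
    refine mul_le_mul_of_nonneg_right ?_ (Finset.prod_nonneg fun _ _ => abs_nonneg _)
    calc |u ν.2.1| * (|e ν.2.1 x| / mean e 0) ≤ |u ν.2.1| * (K * μ ν.2.1 / mean e 0) := by
          gcongr
          exact hbe _ _ hx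
      _ = _ := by ring
  constructor
  · refine Summable.of_nonneg_of_le (fun ν => Real.iSup_nonneg fun _ => abs_nonneg _) (fun ν => ?_)
      (hasSum_words (α := fun n => (|u n| * μ n) * (K / mean e 0)) ?_ hβs hβ1).1
    · have : Nonempty (Icc (0 : ℝ) 1) := ⟨⟨0, by norm_num⟩⟩
      exact ciSup_le fun x => hsup ν x x.2
    · exact (hus.mul_right _).abs
  · intro x hx
    obtain ⟨hs, hc, hint, hco⟩ := he.synth_spec hV hVpos hus
    have hcvs : Summable fun n => |coeff e n (v t)| * μ n := by
      refine (hus.mul_left |coeff e 0 (v t)|).congr fun n => ?_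
      rw [hcv n, abs_mul, mul_assoc]
    have hvx := he.hasSum_of_coeff hV hVpos hvc hcvs hx
    have hvx' : v t x = coeff e 0 (v t) * synth e u x := by
      rw [← hvx.tsum_eq, synth, ← tsum_mul_left]
      exact tsum_congr fun n => by rw [hcv n]; ring
    have hu0 : u 0 = 1 := by
      simp only [hu, sub_self, neg_zero, zero_mul, Real.exp_zero, one_mul]
      exact div_self hc0.ne'
    -- Unit mass, integrated term by term: the mode $0$ gives the summand $1$ because $u_0=1$, and
    -- the other modes give the `β q`.
    have hmass : 1 = coeff e 0 (v t) * (mean e 0 * (1 + ∑' q, β q)) := by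
      have h1 := (he.synth_spec hV hVpos hcvs).2.2.1 1 continuousOn_const
      have h2 : ∫ y in (0 : ℝ)..1, (1 : ℝ → ℝ) y * synth e (fun n => coeff e n (v t)) y = 1 := by
        refine Eq.trans ?_ (h.integral_eq_one hV he hv₀ ht)
        refine intervalIntegral.integral_congr fun y hy => ?_
        rw [uIcc_of_le zero_le_one] at hy
        simp only [Pi.one_apply, one_mul]
        exact (he.hasSum_of_coeff hV hVpos hvc hcvs hy).tsum_eq
      rw [h2] at h1
      have h3 : ∀ n, coeff e n (v t) * coeff e n 1 =
          coeff e 0 (v t) * (mean e 0 * (u n * (mean e n / mean e 0))) := fun n => by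
        rw [hcv n, ← IsNeumannEigenbasis.mean_eq_coeff]
        field_simp
      simp only [h3] at h1
      have h4 : Summable fun n => u n * (mean e n / mean e 0) := by
        have h5 := h1.summable.mul_left (coeff e 0 (v t) * mean e 0)⁻¹
        refine h5.congr fun n => ?_
        have := (hratio 0).1
        field_simp
      refine h1.tsum_eq.symm.trans ?_
      rw [tsum_mul_left, tsum_mul_left]
      congr 2
      simp only [hβ]
      rw [h4.tsum_eq_zero_add, hu0, div_self hm0.ne', one_mul, ← tsum_pnat_eq_tsum_succ
        (f := fun n => u n * (mean e n / mean e 0))]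
    have hw := (hasSum_words (α := fun n => u n * (e n x / mean e 0)) (β := β) ?_ hβs hβ1).2
    · simp only [hterm]
      convert! hw using 1
      have h1 : ∑' n, u n * (e n x / mean e 0) = synth e u x / mean e 0 := by
        rw [synth, ← tsum_div_const]
        exact tsum_congr fun n => by ring
      rw [hvx', h1, div_div]
      -- The mass identity itself excludes a vanishing denominator.
      have h2 : mean e 0 * (1 + ∑' q, β q) ≠ 0 := fun h0 => by
        rw [h0, mul_zero] at hmass
        exact one_ne_zero hmass
      rw [eq_div_iff h2]
      linear_combination (-synth e u x) * hmass
    · refine ((hs x hx).mul_right (mean e 0)⁻¹).congr fun n => ?_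
      rw [abs_mul, abs_mul, abs_div, abs_of_pos hm0, div_eq_mul_inv,
        mul_assoc]

/-! ### The space `H¹(0,1)` -/

/-- By the fundamental lemma of the calculus of variations. As `weakDeriv` is obtained by choice,
this is what allows `h1Norm` to be computed from any weak derivative. -/
lemma IsWeakDeriv.ae_eq {f g₁ g₂ : ℝ → ℝ} (hg₁ : MemL2 g₁) (hg₂ : MemL2 g₂)
    (h₁ : IsWeakDeriv f g₁) (h₂ : IsWeakDeriv f g₂) : g₁ =ᵐ[unitMeasure] g₂ := by
  have hint : IntegrableOn (fun x => g₁ x - g₂ x) (Ioo 0 1) :=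
    MemLp.integrable (by norm_num) (hg₁.sub hg₂)
  have h := isOpen_Ioo.ae_eq_zero_of_integral_contDiff_smul_eq_zero
    (f := fun x => g₁ x - g₂ x) hint.locallyIntegrableOn fun φ hφ hφc hφs => by
      have hφL : MemL2 φ := memL2_of_continuousOn hφ.continuous.continuousOn
      have e1 := (h₁ φ hφ hφc hφs).symm.trans (h₂ φ hφ hφc hφs)
      rw [neg_inj, ← sub_eq_zero, ← intervalIntegral.integral_sub (hg₁.integrable_mul hφL)
        (hg₂.integrable_mul hφL), ← integral_unitMeasure] at e1
      rw [← e1]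
      symm
      rw [setIntegral_eq_integral_of_forall_compl_eq_zero]
      · exact integral_congr_ae (ae_of_all _ fun x => by simp only [smul_eq_mul]; ring)
      · intro x hx
        have : φ x = 0 := image_eq_zero_of_notMem_tsupport fun hx' => hx (hφs hx')
        simp [this]
  rw [EventuallyEq, ae_restrict_iff' measurableSet_Ioo]
  filter_upwards [h] with x hx hx'
  exact sub_eq_zero.1 (hx hx')

lemma IsWeakDeriv.sub_const_mul {f f' g g' : ℝ → ℝ} (hf : MemL2 f) (hf' : MemL2 f')
    (hg : MemL2 g) (hg' : MemL2 g') (h₁ : IsWeakDeriv f f') (h₂ : IsWeakDeriv g g') (c : ℝ) :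
    IsWeakDeriv (fun x => f x - c * g x) fun x => f' x - c * g' x := by
  intro φ hφ hφc hφs
  have hφL : MemL2 φ := memL2_of_continuousOn hφ.continuous.continuousOn
  have hφL' : MemL2 (deriv φ) :=
    memL2_of_continuousOn (hφ.continuous_deriv (by simp)).continuousOn
  have e1 := h₁ φ hφ hφc hφs
  have e2 := h₂ φ hφ hφc hφs
  simp only [sub_mul, mul_assoc]
  rw [intervalIntegral.integral_sub (hf.integrable_mul hφL')
    ((hg.integrable_mul hφL').const_mul c), intervalIntegral.integral_sub (hf'.integrable_mul hφL)
    ((hg'.integrable_mul hφL).const_mul c), intervalIntegral.integral_const_mul,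
    intervalIntegral.integral_const_mul, e1, e2]
  ring

lemma isWeakDeriv_of_hasDerivWithinAt {f f' : ℝ → ℝ}
    (hf : ∀ x ∈ Icc (0 : ℝ) 1, HasDerivWithinAt f (f' x) (Icc 0 1) x)
    (hf' : ContinuousOn f' (Icc 0 1)) : IsWeakDeriv f f' := by
  intro φ hφ hφc hφs
  have hd : ∀ x ∈ Icc (0 : ℝ) 1, HasDerivWithinAt φ (deriv φ x) (Icc 0 1) x := fun x _ =>
    (hφ.differentiable (by simp) x).hasDerivAt.hasDerivWithinAt
  have h0 : φ 0 = 0 := image_eq_zero_of_notMem_tsupport fun h => (hφs h).1.false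
  have h1 : φ 1 = 0 := image_eq_zero_of_notMem_tsupport fun h => (hφs h).2.false
  rw [integral_mul_deriv_Icc le_rfl zero_le_one le_rfl hf hd hf'
    (hφ.continuous_deriv (by simp)).continuousOn, h0, h1]
  ring

lemma memH1_of_hasDerivWithinAt {f f' : ℝ → ℝ}
    (hf : ∀ x ∈ Icc (0 : ℝ) 1, HasDerivWithinAt f (f' x) (Icc 0 1) x)
    (hf' : ContinuousOn f' (Icc 0 1)) : MemH1 f :=
  ⟨memL2_of_continuousOn (continuousOn_of_hasDerivWithinAt hf), f', memL2_of_continuousOn hf',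
    isWeakDeriv_of_hasDerivWithinAt hf hf'⟩

lemma MemH1.weakDeriv_spec {f : ℝ → ℝ} (h : MemH1 f) :
    MemL2 (weakDeriv f) ∧ IsWeakDeriv f (weakDeriv f) := by
  rw [weakDeriv, dif_pos h.2]
  exact h.2.choose_spec

lemma l2Norm_weakDeriv {f g : ℝ → ℝ} (hf : MemL2 f) (hg : MemL2 g) (h : IsWeakDeriv f g) :
    l2Norm (weakDeriv f) = l2Norm g := by
  have hH : MemH1 f := ⟨hf, g, hg, h⟩
  exact l2Norm_congr (hH.weakDeriv_spec.2.ae_eq hH.weakDeriv_spec.1 hg h)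

lemma l2Norm_le_h1Norm (f : ℝ → ℝ) : l2Norm f ≤ h1Norm f :=
  Real.le_sqrt_of_sq_le (by nlinarith [sq_nonneg (l2Norm (weakDeriv f))])

lemma l2Norm_weakDeriv_le_h1Norm (f : ℝ → ℝ) : l2Norm (weakDeriv f) ≤ h1Norm f :=
  Real.le_sqrt_of_sq_le (by nlinarith [sq_nonneg (l2Norm f)])

lemma h1Norm_le_add (f : ℝ → ℝ) : h1Norm f ≤ l2Norm f + l2Norm (weakDeriv f) :=
  Real.sqrt_le_iff.2 ⟨add_nonneg (l2Norm_nonneg _) (l2Norm_nonneg _), by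
    nlinarith [mul_nonneg (l2Norm_nonneg f) (l2Norm_nonneg (weakDeriv f))]⟩

lemma h1Norm_nonneg (f : ℝ → ℝ) : 0 ≤ h1Norm f := Real.sqrt_nonneg _

lemma h1Norm_zero : h1Norm (fun _ => 0) = 0 := by
  have h : IsWeakDeriv (fun _ => 0) fun _ => 0 := fun φ _ _ _ => by simp
  have h0 : MemL2 (fun _ => 0) := memL2_of_continuousOn continuousOn_const
  rw [h1Norm, l2Norm_weakDeriv h0 h0 h]
  simp [l2Norm]

lemma l2Norm_sub_const_mul_le {f g : ℝ → ℝ} (hf : MemL2 f) (hg : MemL2 g) (c : ℝ) :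
    l2Norm (fun x => f x - c * g x) ≤ l2Norm f + |c| * l2Norm g := by
  have h := l2Norm_add_le hf (hg.const_mul (-c))
  rw [l2Norm_const_mul, abs_neg] at h
  simpa only [neg_mul, ← sub_eq_add_neg] using h

namespace IsNeumannEigenbasis

variable {V : ℝ → ℝ} {μ : ℕ → ℝ} {e : ℕ → ℝ → ℝ}

/-- The map `f ↦ f - c₀(f) e₀` is bounded in `H¹`. -/
lemma exists_h1Norm_deviation_le (h : IsNeumannEigenbasis V μ e) :
    ∃ C : ℝ, 0 < C ∧ ∀ f, MemH1 f → h1Norm (deviation e f) ≤ C * h1Norm f := by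
  obtain ⟨e', he'⟩ := h.exists_isEigenfamily
  have he0 := memL2_of_continuousOn (he'.pair 0).continuousOn'
  refine ⟨2 + l2Norm (e 0) + l2Norm (e' 0), by
    linarith [l2Norm_nonneg (e 0), l2Norm_nonneg (e' 0)], fun f hf => ?_⟩
  obtain ⟨hw, hw'⟩ := hf.weakDeriv_spec
  have h1 := hw'.sub_const_mul hf.1 hw (h.memL2 0) he0 (isWeakDeriv_of_hasDerivWithinAt
    (he'.pair 0).deriv (he'.pair 0).continuousOn') (coeff e 0 f)
  have h2 : l2Norm (weakDeriv (deviation e f)) = _ :=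
    l2Norm_weakDeriv (h.memL2_deviation hf.1) (hw.sub (he0.const_mul _)) h1
  have h3 : l2Norm (deviation e f) ≤ _ := l2Norm_sub_const_mul_le hf.1 (h.memL2 0) (coeff e 0 f)
  have h4 := l2Norm_sub_const_mul_le hw he0 (coeff e 0 f)
  have h5 := (h.abs_coeff_le hf.1 0).trans (l2Norm_le_h1Norm f)
  have h6 := l2Norm_weakDeriv_le_h1Norm f
  have h7 := l2Norm_le_h1Norm f
  have h8 := mul_le_mul_of_nonneg_right h5 (l2Norm_nonneg (e 0))
  have h9 := mul_le_mul_of_nonneg_right h5 (l2Norm_nonneg (e' 0))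
  refine (h1Norm_le_add _).trans ?_
  rw [h2]
  linarith

/-! ### The sink, its neighbourhood, and the time thresholds. -/

lemma coeff_zero_sink (h : IsNeumannEigenbasis V μ e) : coeff e 0 (sink e) = 1 / mean e 0 := by
  have := h.orthonormal 0 0
  simp only [coeff, sink, ← mul_div_assoc]
  rw [intervalIntegral.integral_div, this, if_pos rfl]

lemma memH1_sink (h : IsNeumannEigenbasis V μ e) : MemH1 (sink e) := by
  obtain ⟨e', he'⟩ := h.exists_isEigenfamily
  exact memH1_of_hasDerivWithinAt (fun x hx => ((he'.pair 0).deriv x hx).div_const _)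
    ((he'.pair 0).continuousOn'.div_const _)

lemma sink_mem_P1 (h : IsNeumannEigenbasis V μ e) (hV : ContinuousOn V (Icc 0 1)) :
    sink e ∈ P1 := by
  have hm := h.mean_zero_pos
  refine ⟨(h.continuousOn 0).div_const _, h.memH1_sink,
    fun x hx => div_pos (h.pos_Icc hV x hx) hm, ?_⟩
  simp only [sink]
  rw [intervalIntegral.integral_div]
  exact div_self hm.ne'

/-- This makes the quotient in `OmegaTildeN` a genuine one; with a zero denominator it would be $0$
and the set empty. -/
lemma threshold_pos (h : IsNeumannEigenbasis V μ e) (hV : ContinuousOn V (Icc 0 1))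
    (hVpos : ∀ x ∈ Icc (0 : ℝ) 1, 0 < V x) :
    0 < max (CV V * l2Norm V * h2 μ 0) (l2Norm (deviation e 1)) := by
  have h1 : 0 < CV V := lt_of_lt_of_le one_pos (le_max_left _ _)
  have h2 : 0 < l2Norm V := Real.sqrt_pos.2 <| intervalIntegral.intervalIntegral_pos_of_pos_on
    (intervalIntegrable_of_continuousOn (hV.pow 2))
    (fun x hx => pow_pos (hVpos x (Ioo_subset_Icc_self hx)) 2) zero_lt_one
  exact lt_max_of_lt_left (mul_pos (mul_pos h1 h2) (h.h2_zero_pos hV hVpos))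

lemma sink_mem_OmegaTildeN (h : IsNeumannEigenbasis V μ e) (hV : ContinuousOn V (Icc 0 1))
    (hVpos : ∀ x ∈ Icc (0 : ℝ) 1, 0 < V x) : sink e ∈ OmegaTildeN V μ e := by
  have hm := h.mean_zero_pos
  refine ⟨h.sink_mem_P1 hV, ?_⟩
  have h1 : deviation e (sink e) = fun _ => 0 := by
    ext x
    simp only [deviation, h.coeff_zero_sink, sink]
    ring
  rw [h1, h1Norm_zero, h.coeff_zero_sink]
  exact div_pos (mul_pos (one_div_pos.2 hm) hm) (h.threshold_pos hV hVpos)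

/-- The deviation is linear and kills the sink, so at distance $r$ from the sink it is at most $Cr$,
while $c_0(v_0)\ge1/\int e_0-r$. The required inequality follows from $CDr<1-r\int e_0$, which is
$r<1/(CD+\int e_0)$. -/
lemma exists_nhds_sink (h : IsNeumannEigenbasis V μ e) (hV : ContinuousOn V (Icc 0 1))
    (hVpos : ∀ x ∈ Icc (0 : ℝ) 1, 0 < V x) :
    ∃ ε : ℝ, 0 < ε ∧ ∀ v₀ ∈ P1, h1Norm (fun x => v₀ x - sink e x) < ε →
      v₀ ∈ OmegaTildeN V μ e := by
  obtain ⟨C, hC, hdev⟩ := h.exists_h1Norm_deviation_le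
  have hm := h.mean_zero_pos
  have hD := h.threshold_pos hV hVpos
  set D := max (CV V * l2Norm V * h2 μ 0) (l2Norm (deviation e 1)) with hDdef
  refine ⟨1 / (C * D + mean e 0), by positivity, fun v₀ hv₀ hlt => ⟨hv₀, ?_⟩⟩
  rw [← hDdef]
  have hs := h.memH1_sink
  have hw : MemH1 fun x => v₀ x - sink e x := by
    refine ⟨hv₀.2.1.1.sub hs.1, _, hv₀.2.1.weakDeriv_spec.1.sub
      (hs.weakDeriv_spec.1.const_mul 1), ?_⟩
    simpa only [one_mul] using hv₀.2.1.weakDeriv_spec.2.sub_const_mul hv₀.2.1.1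
      hv₀.2.1.weakDeriv_spec.1 hs.1 hs.weakDeriv_spec.1 hs.weakDeriv_spec.2 1
  have hco : coeff e 0 (fun x => v₀ x - sink e x) = coeff e 0 v₀ - 1 / mean e 0 := by
    rw [← h.coeff_zero_sink, coeff, coeff, coeff, ← intervalIntegral.integral_sub
      ((h.memL2 0).integrable_mul hv₀.2.1.1) ((h.memL2 0).integrable_mul hs.1)]
    simp only [mul_sub]
  have hd : deviation e (fun x => v₀ x - sink e x) = deviation e v₀ := by
    ext x
    rw [deviation, hco, deviation, sink]
    ring
  have h1 := hdev _ hw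
  rw [hd] at h1
  have h2 := (abs_le.1 ((h.abs_coeff_le hw.1 0).trans (l2Norm_le_h1Norm _))).1
  rw [hco] at h2
  set r := h1Norm fun x => v₀ x - sink e x
  rw [lt_div_iff₀ hD]
  rw [lt_div_iff₀ (by positivity)] at hlt
  have h3 : (1 / mean e 0 - r) * mean e 0 ≤ coeff e 0 v₀ * mean e 0 :=
    mul_le_mul_of_nonneg_right (by linarith) hm.le
  rw [sub_mul, one_div, inv_mul_cancel₀ hm.ne'] at h3
  have h4 := mul_le_mul_of_nonneg_right h1 hD.le
  nlinarith

lemma exp_mul_lt_of_tauN_lt (h : IsNeumannEigenbasis V μ e) (hV : ContinuousOn V (Icc 0 1))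
    {v₀ : ℝ → ℝ} (hv₀ : v₀ ∈ P1) {t : ℝ} (ht : tauN μ e v₀ < (t : EReal)) :
    Real.exp (-(μ 1 - μ 0) * t) * (l2Norm (deviation e v₀) * l2Norm (deviation e 1)) <
      coeff e 0 v₀ * mean e 0 := by
  have hpos := mul_pos (h.coeff_zero_pos hv₀.1 hv₀.2.2.1) h.mean_zero_pos
  have hδ := sub_pos.2 (h.eigenvalue_zero_lt_one hV)
  -- If the product of norms is $0$ the logarithm is $-\infty$ and cannot be exponentiated as a
  -- real; the claim is then positivity of the right side.
  rcases (mul_nonneg (l2Norm_nonneg (deviation e v₀))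
    (l2Norm_nonneg (deviation e 1))).eq_or_lt with h0 | h0
  · rwa [← h0, mul_zero]
  · rw [tauN, ENNReal.log_ofReal_of_pos (div_pos h0 hpos), ← EReal.coe_mul,
      EReal.coe_lt_coe_iff, one_div, inv_mul_lt_iff₀ hδ,
      Real.log_lt_iff_lt_exp (div_pos h0 hpos), div_lt_iff₀ hpos] at ht
    rw [neg_mul, Real.exp_neg, inv_mul_lt_iff₀ (Real.exp_pos _)]
    exact ht

/-- The second entry of the maximum defining the set gives the inequality at time $0$, with the
larger $H^1$ norm; the exponential only improves it. -/
lemma exp_mul_lt_of_mem_OmegaTildeN (h : IsNeumannEigenbasis V μ e)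
    (hV : ContinuousOn V (Icc 0 1)) (hVpos : ∀ x ∈ Icc (0 : ℝ) 1, 0 < V x)
    {v₀ : ℝ → ℝ} (hv₀ : v₀ ∈ OmegaTildeN V μ e) {t : ℝ} (ht : 0 < t) :
    Real.exp (-(μ 1 - μ 0) * t) * (l2Norm (deviation e v₀) * l2Norm (deviation e 1)) <
      coeff e 0 v₀ * mean e 0 := by
  have hδ := sub_pos.2 (h.eigenvalue_zero_lt_one hV)
  have h1 := hv₀.2
  rw [lt_div_iff₀ (h.threshold_pos hV hVpos)] at h1
  refine lt_of_le_of_lt ?_ h1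
  have h2 := mul_le_mul (l2Norm_le_h1Norm (deviation e v₀))
    (le_max_right (CV V * l2Norm V * h2 μ 0) (l2Norm (deviation e 1))) (l2Norm_nonneg _)
    (h1Norm_nonneg _)
  refine le_trans (mul_le_of_le_one_left (mul_nonneg (l2Norm_nonneg _) (l2Norm_nonneg _)) ?_) h2
  exact Real.exp_le_one_iff.2 (by nlinarith)

end IsNeumannEigenbasis

/-- The infimum runs over positive times, so it is nonnegative, also when the set is empty and it is
$+\infty$. -/
lemma pos_of_tauTildeN_lt {V v₀ : ℝ → ℝ} {μ : ℕ → ℝ} {e : ℕ → ℝ → ℝ} {t : ℝ}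
    (h : tauTildeN V μ e v₀ < (t : EReal)) : 0 < t := by
  have h0 : (0 : EReal) ≤ tauTildeN V μ e v₀ := le_sInf fun _ ⟨s, hs, hs'⟩ => by
    rw [← hs']
    exact EReal.coe_nonneg.2 hs.1.le
  exact EReal.coe_pos.1 (h0.trans_lt h)

/-! ### The Green function of the Neumann problem -/

/-- Truncation to `[-R, R]`. -/
def clip (R c : ℝ) : ℝ := max (-R) (min R c)

lemma abs_clip_sub_clip_le (R a b : ℝ) : |clip R a - clip R b| ≤ |a - b| :=
  (abs_max_sub_max_le_max _ _ _ _).trans <| max_le (by simp) <|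
    (abs_min_sub_min_le_max _ _ _ _).trans (by simp)

lemma abs_clip_le {R : ℝ} (hR : 0 ≤ R) (c : ℝ) : |clip R c| ≤ R :=
  abs_le.2 ⟨le_max_left _ _, max_le (by linarith) (min_le_left _ _)⟩

lemma clip_of_abs_le {R c : ℝ} (h : |c| ≤ R) : clip R c = c := by
  rw [abs_le] at h
  rw [clip, min_eq_right h.2, max_eq_right h.1]

/-- Global existence for the linear equation `φ'' = q φ` on `[0,1]`. -/
lemma exists_cauchy_left {q : ℝ → ℝ} (hq : ContinuousOn q (Icc 0 1)) :
    ∃ φ φ' : ℝ → ℝ, (∀ x ∈ Icc (0 : ℝ) 1, HasDerivWithinAt φ (φ' x) (Icc 0 1) x) ∧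
      (∀ x ∈ Icc (0 : ℝ) 1, HasDerivWithinAt φ' (q x * φ x) (Icc 0 1) x) ∧ φ 0 = 1 ∧ φ' 0 = 0 := by
  obtain ⟨M, hM⟩ := isCompact_Icc.exists_bound_of_continuousOn hq
  simp only [Real.norm_eq_abs] at hM
  obtain ⟨K, hK1, hKM⟩ : ∃ K : NNReal, (1 : ℝ) ≤ K ∧ ∀ x ∈ Icc (0 : ℝ) 1, |q x| ≤ K :=
    ⟨⟨max 1 M, le_trans zero_le_one (le_max_left _ _)⟩, le_max_left _ _,
      fun x hx => (hM x hx).trans (le_max_right _ _)⟩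
  obtain ⟨R, hR⟩ : ∃ R : NNReal, (R : ℝ) = Real.exp K := ⟨⟨Real.exp K, (Real.exp_pos _).le⟩, rfl⟩
  -- Truncation makes the field globally bounded by $KR$, so Picard–Lindelöf covers $[0,1]$ in one
  -- step. With $R=e^K$, the Gronwall bound for a solution of initial norm $1$, the truncation turns
  -- out to be inactive.
  set f : ℝ → ℝ × ℝ → ℝ × ℝ := fun t p => (clip R p.2, q t * clip R p.1) with hf
  have hK0 : (0 : ℝ) ≤ K := K.2
  have hlip : ∀ t ∈ Icc (0 : ℝ) 1, ∀ p p', ‖f t p - f t p'‖ ≤ K * ‖p - p'‖ := by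
    intro t ht p p'
    refine (Prod.norm_def _).trans_le (max_le ?_ ?_)
    · refine (abs_clip_sub_clip_le R p.2 p'.2).trans ?_
      refine (norm_snd_le (p - p')).trans (le_mul_of_one_le_left (norm_nonneg _) hK1)
    · have h1 : (f t p - f t p').2 = q t * (clip R p.1 - clip R p'.1) := by simp [hf, mul_sub]
      rw [h1, norm_mul]
      exact mul_le_mul (hKM t ht) ((abs_clip_sub_clip_le R p.1 p'.1).trans (norm_fst_le (p - p')))
        (norm_nonneg _) hK0
  have hf0 : ∀ t, f t 0 = 0 := fun t => by
    have h0 : clip R 0 = 0 := by simp [clip]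
    simp [hf, h0]
  have hP : IsPicardLindelof f (tmin := 0) (tmax := 1) ⟨0, by simp⟩ ((1, 0) : ℝ × ℝ) (K * R) 0
      (K * R) K := by
    refine ⟨fun t ht => LipschitzOnWith.of_dist_le_mul fun p _ p' _ => ?_, fun p _ => ?_,
      fun t ht p _ => ?_, by simp⟩
    · rw [dist_eq_norm, dist_eq_norm]
      exact hlip t ht p p'
    · exact continuousOn_const.prodMk (hq.mul continuousOn_const)
    · have hR1 : (0 : ℝ) ≤ R := R.2
      refine (Prod.norm_def _).trans_le (max_le ?_ ?_)
      · exact (abs_clip_le hR1 _).trans (le_mul_of_one_le_left hR1 hK1)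
      · simp only [hf, norm_mul]
        exact mul_le_mul (hKM t ht) (abs_clip_le hR1 _) (norm_nonneg _) hK0
  obtain ⟨α, hα0, hα⟩ := hP.exists_eq_forall_mem_Icc_hasDerivWithinAt₀
  have hbound : ∀ t ∈ Icc (0 : ℝ) 1, ‖α t‖ ≤ R := by
    intro t ht
    have h := norm_le_gronwallBound_of_norm_deriv_right_le (δ := 1) (K := K) (ε := 0)
      (fun t ht => (hα t ht).continuousWithinAt)
      (fun t ht => (hα t (Ico_subset_Icc_self ht)).mono_of_mem_nhdsWithin
        (mem_of_superset (Ico_mem_nhdsGE ht.2) fun y hy => ⟨ht.1.trans hy.1, hy.2.le⟩))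
      (by simp at hα0; simp [hα0]) (fun t ht => ?_) t ht
    · refine h.trans ?_
      rw [gronwallBound_ε0, hR, one_mul, sub_zero]
      exact Real.exp_le_exp.2 (mul_le_of_le_one_right hK0 ht.2)
    · have := hlip t (Ico_subset_Icc_self ht) (α t) 0
      simpa [hf0] using this
  have h1 : ∀ t ∈ Icc (0 : ℝ) 1, clip R (α t).1 = (α t).1 := fun t ht =>
    clip_of_abs_le ((norm_fst_le (α t)).trans (hbound t ht))
  have h2 : ∀ t ∈ Icc (0 : ℝ) 1, clip R (α t).2 = (α t).2 := fun t ht =>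
    clip_of_abs_le ((norm_snd_le (α t)).trans (hbound t ht))
  refine ⟨fun t => (α t).1, fun t => (α t).2, fun t ht => ?_, fun t ht => ?_, ?_, ?_⟩
  · have := (hasFDerivAt_fst (𝕜 := ℝ)).comp_hasDerivWithinAt t (hα t ht)
    simpa [hf, h2 t ht] using! this
  · have := (hasFDerivAt_snd (𝕜 := ℝ)).comp_hasDerivWithinAt t (hα t ht)
    simpa [hf, h1 t ht] using! this
  · simp at hα0; simp [hα0]
  · simp at hα0; simp [hα0]

lemma exists_cauchy_right {q : ℝ → ℝ} (hq : ContinuousOn q (Icc 0 1)) :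
    ∃ ψ ψ' : ℝ → ℝ, (∀ x ∈ Icc (0 : ℝ) 1, HasDerivWithinAt ψ (ψ' x) (Icc 0 1) x) ∧
      (∀ x ∈ Icc (0 : ℝ) 1, HasDerivWithinAt ψ' (q x * ψ x) (Icc 0 1) x) ∧ ψ 1 = 1 ∧ ψ' 1 = 0 := by
  have hm : MapsTo (fun x : ℝ => 1 - x) (Icc 0 1) (Icc 0 1) := fun x hx =>
    ⟨by linarith [hx.2], by linarith [hx.1]⟩
  obtain ⟨φ, φ', h1, h2, h3, h4⟩ := exists_cauchy_left (q := fun x => q (1 - x))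
    (hq.comp (by fun_prop) hm)
  have hd : ∀ x, HasDerivWithinAt (fun x : ℝ => 1 - x) (-1) (Icc 0 1) x := fun x =>
    ((hasDerivAt_id x).const_sub 1).hasDerivWithinAt
  refine ⟨fun x => φ (1 - x), fun x => -φ' (1 - x), fun x hx => ?_, fun x hx => ?_, by simp [h3],
    by simp [h4]⟩
  · simpa using! (h1 (1 - x) (hm hx)).scomp x (hd x) hm
  · have := ((h2 (1 - x) (hm hx)).scomp x (hd x) hm).neg
    simpa using! this

/-- The homogeneous Neumann problem has only the trivial solution. -/
lemma IsEigenpair.eq_zero_of_zero {V f f' : ℝ → ℝ} (hV : ContinuousOn V (Icc 0 1))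
    (hVpos : ∀ x ∈ Icc (0 : ℝ) 1, 0 < V x) (h : IsEigenpair V 0 f f') :
    ∀ x ∈ Icc (0 : ℝ) 1, f x = 0 := by
  obtain ⟨κ, h0, h1, h2⟩ := exists_pos_le V hV hVpos
  have h3 := mul_integral_sq_add_le hV h1 h2 h.continuousOn h.continuousOn'
  rw [h.weak hV h.deriv h.continuousOn', zero_mul] at h3
  intro x hx
  have h4 := sq_le_integral_sq_add h.deriv h.continuousOn' hx
  have h5 : f x ^ 2 ≤ 0 := by nlinarith
  exact pow_eq_zero_iff two_ne_zero |>.1 (le_antisymm h5 (sq_nonneg _))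

/-- A fundamental system for the Neumann problem `-u'' + V u = f`. -/
structure IsNeumannSystem (V φ φ' ψ ψ' : ℝ → ℝ) (W : ℝ) : Prop where
  dφ : ∀ x ∈ Icc (0 : ℝ) 1, HasDerivWithinAt φ (φ' x) (Icc 0 1) x
  dφ' : ∀ x ∈ Icc (0 : ℝ) 1, HasDerivWithinAt φ' (V x * φ x) (Icc 0 1) x
  dψ : ∀ x ∈ Icc (0 : ℝ) 1, HasDerivWithinAt ψ (ψ' x) (Icc 0 1) x
  dψ' : ∀ x ∈ Icc (0 : ℝ) 1, HasDerivWithinAt ψ' (V x * ψ x) (Icc 0 1) x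
  left : φ' 0 = 0
  right : ψ' 1 = 0
  wronskian : ∀ x ∈ Icc (0 : ℝ) 1, φ' x * ψ x - φ x * ψ' x = W
  ne_zero : W ≠ 0

/-- The Wronskian is constant and equals $\varphi'(1)$, by the data of $\psi$ at $1$. Were it $0$,
$\varphi$ would solve the homogeneous Neumann problem, hence vanish, against $\varphi(0)=1$. -/
lemma exists_isNeumannSystem {V : ℝ → ℝ} (hV : ContinuousOn V (Icc 0 1))
    (hVpos : ∀ x ∈ Icc (0 : ℝ) 1, 0 < V x) : ∃ φ φ' ψ ψ' W, IsNeumannSystem V φ φ' ψ ψ' W := by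
  obtain ⟨φ, φ', h1, h2, h3, h4⟩ := exists_cauchy_left hV
  obtain ⟨ψ, ψ', k1, k2, k3, k4⟩ := exists_cauchy_right hV
  refine ⟨φ, φ', ψ, ψ', φ' 1, h1, h2, k1, k2, h4, k4, fun x hx => ?_, fun h0 => ?_⟩
  · have hd : ∀ x ∈ Icc (0 : ℝ) 1, HasDerivWithinAt (fun x => φ' x * ψ x - φ x * ψ' x) 0
        (Icc 0 1) x := fun x hx => by
      convert! ((h2 x hx).mul (k1 x hx)).sub ((h1 x hx).mul (k2 x hx)) using 1
      ring
    have := integral_deriv_Icc hx (right_mem_Icc.2 zero_le_one) hd continuousOn_const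
    simp only [intervalIntegral.integral_zero, k3, k4] at this
    linarith
  · have := IsEigenpair.eq_zero_of_zero (f := φ) (f' := φ') hV hVpos
      ⟨h1, fun x hx => by simpa using h2 x hx, h4, h0⟩ 0 (by norm_num)
    rw [h3] at this
    exact one_ne_zero this

/-- The Green function built from a fundamental system. -/
def greenKernel (φ ψ : ℝ → ℝ) (W x y : ℝ) : ℝ := φ (min x y) * ψ (max x y) / W

lemma greenKernel_comm (φ ψ : ℝ → ℝ) (W x y : ℝ) :
    greenKernel φ ψ W x y = greenKernel φ ψ W y x := by
  rw [greenKernel, greenKernel, min_comm, max_comm]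

namespace IsNeumannSystem

variable {V φ φ' ψ ψ' : ℝ → ℝ} {W : ℝ}

lemma continuousOn_greenKernel (h : IsNeumannSystem V φ φ' ψ ψ' W) :
    ContinuousOn (fun p : ℝ × ℝ => greenKernel φ ψ W p.1 p.2) (Icc 0 1 ×ˢ Icc 0 1) := by
  refine (ContinuousOn.mul ?_ ?_).div_const _
  · exact (continuousOn_of_hasDerivWithinAt h.dφ).comp (by fun_prop) fun p hp =>
      ⟨le_min hp.1.1 hp.2.1, (min_le_left _ _).trans hp.1.2⟩
  · exact (continuousOn_of_hasDerivWithinAt h.dψ).comp (by fun_prop) fun p hp =>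
      ⟨hp.1.1.trans (le_max_left _ _), max_le hp.1.2 hp.2.2⟩

/-- The solution of the Neumann problem `-u'' + V u = f`. -/
lemma exists_solution (h : IsNeumannSystem V φ φ' ψ ψ' W) {f : ℝ → ℝ}
    (hf : ContinuousOn f (Icc 0 1)) :
    ∃ u' : ℝ → ℝ,
      (∀ x ∈ Icc (0 : ℝ) 1, HasDerivWithinAt
        (fun x => ∫ y in (0 : ℝ)..1, greenKernel φ ψ W x y * f y) (u' x) (Icc 0 1) x) ∧
      (∀ x ∈ Icc (0 : ℝ) 1, HasDerivWithinAt u'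
        (V x * (∫ y in (0 : ℝ)..1, greenKernel φ ψ W x y * f y) - f x) (Icc 0 1) x) ∧
      u' 0 = 0 ∧ u' 1 = 0 := by
  have hφ := continuousOn_of_hasDerivWithinAt h.dφ
  have hψ := continuousOn_of_hasDerivWithinAt h.dψ
  have h0 : (0 : ℝ) ∈ Icc (0 : ℝ) 1 := by norm_num
  have h1 : (1 : ℝ) ∈ Icc (0 : ℝ) 1 := by norm_num
  have hP := hasDerivWithinAt_integral_Icc (f := fun y => φ y * f y) (hφ.mul hf) h0
  have hQ := hasDerivWithinAt_integral_Icc (f := fun y => ψ y * f y) (hψ.mul hf) h1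
  -- Splitting at $y=x$ gives variation of constants. Each primitive starts at an endpoint, so that
  -- the boundary conditions are inherited from $\varphi$ at $0$ and $\psi$ at $1$.
  have hform : ∀ x ∈ Icc (0 : ℝ) 1, ∫ y in (0 : ℝ)..1, greenKernel φ ψ W x y * f y =
      (ψ x * (∫ y in (0 : ℝ)..x, φ y * f y) - φ x * ∫ y in (1 : ℝ)..x, ψ y * f y) / W := by
    intro x hx
    have i1 : ∫ y in (0 : ℝ)..x, greenKernel φ ψ W x y * f y =
        ψ x / W * ∫ y in (0 : ℝ)..x, φ y * f y := by
      rw [← intervalIntegral.integral_const_mul]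
      refine intervalIntegral.integral_congr fun y hy => ?_
      rw [uIcc_of_le hx.1] at hy
      simp only [greenKernel, min_eq_right hy.2, max_eq_left hy.2]
      ring
    have i2 : ∫ y in x..(1 : ℝ), greenKernel φ ψ W x y * f y =
        φ x / W * ∫ y in x..(1 : ℝ), ψ y * f y := by
      rw [← intervalIntegral.integral_const_mul]
      refine intervalIntegral.integral_congr fun y hy => ?_
      rw [uIcc_of_le hx.2] at hy
      simp only [greenKernel, min_eq_left hy.1, max_eq_right hy.1]
      ring
    have hG : ContinuousOn (fun y => greenKernel φ ψ W x y * f y) (Icc 0 1) :=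
      (h.continuousOn_greenKernel.comp (f := fun y => (x, y)) (by fun_prop)
        fun y hy => ⟨hx, hy⟩).mul hf
    rw [← intervalIntegral.integral_add_adjacent_intervals
      (hG.mono (uIcc_subset_Icc h0 hx)).intervalIntegrable
      (hG.mono (uIcc_subset_Icc hx h1)).intervalIntegrable, i1, i2,
      intervalIntegral.integral_symm 1 x]
    ring
  refine ⟨fun x => (ψ' x * (∫ y in (0 : ℝ)..x, φ y * f y) -
    φ' x * ∫ y in (1 : ℝ)..x, ψ y * f y) / W, fun x hx => ?_, fun x hx => ?_, ?_, ?_⟩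
  · refine HasDerivWithinAt.congr ?_ hform (hform x hx)
    convert! (((h.dψ x hx).mul (hP x hx)).sub ((h.dφ x hx).mul (hQ x hx))).div_const W using 1
    ring
  · rw [hform x hx]
    convert! (((h.dψ' x hx).mul (hP x hx)).sub ((h.dφ' x hx).mul (hQ x hx))).div_const W using 1
    have := h.ne_zero
    field_simp
    rw [← h.wronskian x hx]
    ring
  · simp [h.left]
  · simp [h.right]

end IsNeumannSystem

/-! ### Integral operators with continuous kernel -/

lemma l2Norm_le_of_abs_le {f : ℝ → ℝ} {C : ℝ} (hC : 0 ≤ C) (hf : MemL2 f)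
    (h : ∀ x ∈ Icc (0 : ℝ) 1, |f x| ≤ C) : l2Norm f ≤ C := by
  refine Real.sqrt_le_iff.2 ⟨hC, ?_⟩
  have hi : IntervalIntegrable (fun x => f x ^ 2) volume 0 1 := by
    simpa only [← sq] using hf.integrable_mul hf
  have := intervalIntegral.integral_mono_on zero_le_one hi
    (intervalIntegrable_const (c := C ^ 2)) fun x hx => sq_le_sq' (abs_le.1 (h x hx)).1
      (abs_le.1 (h x hx)).2
  simpa using this

lemma toL2_sub {f g : ℝ → ℝ} (hf : MemL2 f) (hg : MemL2 g) :
    toL2 (hf.sub hg) = toL2 hf - toL2 hg := rfl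

lemma inner_toL2_left {f : ℝ → ℝ} (hf : MemL2 f) (u : Lp ℝ 2 unitMeasure) :
    inner ℝ (toL2 hf) u = ∫ x in (0 : ℝ)..1, f x * u x := by
  have h1 : toL2 (f := u) (Lp.memLp u) = u := Lp.toLp_coeFn u _
  rw [← inner_toL2 hf (Lp.memLp u), h1]

open BoundedContinuousFunction in
/-- The embedding of the continuous functions on `[0,1]` into `L²(0,1)`. -/
def ofBCF : (Icc (0 : ℝ) 1 →ᵇ ℝ) →L[ℝ] Lp ℝ 2 unitMeasure :=
  LinearMap.mkContinuous
    { toFun := fun g => toL2 (f := IccExtend zero_le_one g)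
        (memL2_of_continuousOn (g.continuous.Icc_extend').continuousOn)
      map_add' := fun _ _ => rfl
      map_smul' := fun _ _ => rfl } 1 fun g => by
    change ‖toL2 (f := IccExtend zero_le_one g)
      (memL2_of_continuousOn (g.continuous.Icc_extend').continuousOn)‖ ≤ _
    rw [norm_toL2, one_mul]
    exact l2Norm_le_of_abs_le (norm_nonneg _)
      (memL2_of_continuousOn (g.continuous.Icc_extend').continuousOn) fun x _ =>
      g.norm_coe_le_norm _

open BoundedContinuousFunction in
lemma ofBCF_apply (g : Icc (0 : ℝ) 1 →ᵇ ℝ) : ofBCF g = toL2 (f := IccExtend zero_le_one g)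
    (memL2_of_continuousOn (g.continuous.Icc_extend').continuousOn) := rfl

open BoundedContinuousFunction in
/-- A continuous curve `k` in a Hilbert space defines a compact operator `u ↦ ⟨k(·), u⟩`. -/
lemma exists_compact_of_curve {H : Type*} [NormedAddCommGroup H] [InnerProductSpace ℝ H]
    (k : C(Icc (0 : ℝ) 1, H)) :
    ∃ S : H →L[ℝ] (Icc (0 : ℝ) 1 →ᵇ ℝ), IsCompactOperator S ∧ ∀ u x, S u x = inner ℝ (k x) u := by
  let S : H →L[ℝ] (Icc (0 : ℝ) 1 →ᵇ ℝ) := LinearMap.mkContinuous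
    { toFun := fun u => mkOfCompact ⟨fun x => inner ℝ (k x) u, by fun_prop⟩
      map_add' := fun u v => by ext x; simp [inner_add_right]
      map_smul' := fun c u => by ext x; simp [inner_smul_right] } ‖k‖ fun u => by
    refine (norm_le (mul_nonneg (norm_nonneg _) (norm_nonneg _))).2 fun x => ?_
    exact (norm_inner_le_norm (𝕜 := ℝ) (k x) u).trans
      (mul_le_mul_of_nonneg_right (k.norm_coe_le_norm x) (norm_nonneg _))
  have hS : ∀ u x, S u x = inner ℝ (k x) u := fun u x => rfl
  refine ⟨S, ?_, hS⟩
  refine (isCompactOperator_iff_isCompact_closure_image_closedBall S.toLinearMap one_pos).2 ?_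
  -- The image of the unit ball is equicontinuous because $|Su(x)-Su(y)|\le\|k(x)-k(y)\|$ for
  -- $\|u\|\le1$.
  refine arzela_ascoli (Metric.closedBall 0 ‖k‖) (isCompact_closedBall _ _) _ ?_ ?_
  · rintro _ x ⟨u, hu, rfl⟩
    rw [mem_closedBall_zero_iff] at hu ⊢
    exact (norm_inner_le_norm (𝕜 := ℝ) (k x) u).trans
      ((mul_le_mul (k.norm_coe_le_norm x) hu (norm_nonneg _) (norm_nonneg _)).trans (mul_one _).le)
  · intro x
    rw [Metric.equicontinuousAt_iff]
    intro ε hε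
    obtain ⟨δ, hδ, h⟩ := Metric.continuousAt_iff.1 k.continuous.continuousAt ε hε
    refine ⟨δ, hδ, fun y hy => ?_⟩
    rintro ⟨_, u, hu, rfl⟩
    rw [mem_closedBall_zero_iff] at hu
    change dist (inner ℝ (k x) u) (inner ℝ (k y) u) < ε
    rw [dist_comm, Real.dist_eq, ← inner_sub_left]
    refine (abs_real_inner_le_norm _ _).trans_lt ?_
    refine (mul_le_of_le_one_right (norm_nonneg _) hu).trans_lt ?_
    rw [← dist_eq_norm]
    exact h hy

/-- A symmetric continuous kernel defines a compact self-adjoint operator on `L²(0,1)`. -/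
lemma exists_kernel_operator {G : ℝ → ℝ → ℝ}
    (hG : ContinuousOn (fun p : ℝ × ℝ => G p.1 p.2) (Icc 0 1 ×ˢ Icc 0 1))
    (hsymm : ∀ x y, G x y = G y x) :
    ∃ T : Lp ℝ 2 unitMeasure →L[ℝ] Lp ℝ 2 unitMeasure, IsCompactOperator T ∧ T.IsSymmetric ∧
      ∀ u, (T u =ᵐ[unitMeasure] fun x => ∫ y in (0 : ℝ)..1, G x y * u y) ∧
        ContinuousOn (fun x => ∫ y in (0 : ℝ)..1, G x y * u y) (Icc 0 1) := by
  -- Composing with the projection onto $[0,1]$ extends the kernel continuously to the plane without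
  -- changing the operator.
  set P : ℝ → ℝ := fun x => projIcc (0 : ℝ) 1 zero_le_one x with hP
  have hPc : Continuous P := continuous_subtype_val.comp continuous_projIcc
  have hPm : ∀ x, P x ∈ Icc (0 : ℝ) 1 := fun x => (projIcc (0 : ℝ) 1 zero_le_one x).2
  have hPe : ∀ x ∈ Icc (0 : ℝ) 1, P x = x := fun x hx => by simp [hP, projIcc_of_mem _ hx]
  set G' : ℝ → ℝ → ℝ := fun x y => G (P x) (P y) with hG'
  have hG'c : Continuous fun p : ℝ × ℝ => G' p.1 p.2 :=
    hG.comp_continuous (f := fun p : ℝ × ℝ => (P p.1, P p.2)) (by fun_prop)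
      fun p => ⟨hPm _, hPm _⟩
  have hGc1 : ∀ x, Continuous (G' x) := fun x =>
    hG'c.comp (Continuous.prodMk continuous_const continuous_id)
  have hGL : ∀ x, MemL2 (G' x) := fun x => memL2_of_continuousOn (hGc1 x).continuousOn
  have hkc : Continuous fun x => toL2 (hGL x) := by
    rw [continuous_iff_continuousAt]
    intro x₀
    rw [ContinuousAt, tendsto_iff_norm_sub_tendsto_zero]
    have h1 : ∀ x, ‖toL2 (hGL x) - toL2 (hGL x₀)‖ =
        Real.sqrt (∫ y in (0 : ℝ)..1, (G' x y - G' x₀ y) ^ 2) := fun x => by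
      rw [← toL2_sub, norm_toL2, l2Norm]
    simp only [h1]
    have h2 : Continuous fun x => Real.sqrt (∫ y in (0 : ℝ)..1, (G' x y - G' x₀ y) ^ 2) := by
      refine Real.continuous_sqrt.comp
        (intervalIntegral.continuous_parametric_intervalIntegral_of_continuous' ?_ 0 1)
      exact (hG'c.sub ((hGc1 x₀).comp continuous_snd)).pow 2
    simpa using h2.tendsto x₀
  obtain ⟨S, hS, hSa⟩ := exists_compact_of_curve
    (⟨fun x => toL2 (hGL x), hkc.comp continuous_subtype_val⟩ :
      C(Icc (0 : ℝ) 1, Lp ℝ 2 unitMeasure))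
  have hSe : ∀ (u : Lp ℝ 2 unitMeasure), ∀ x ∈ Icc (0 : ℝ) 1,
      IccExtend zero_le_one (S u) x = ∫ y in (0 : ℝ)..1, G x y * u y := fun u x hx' => by
    rw [IccExtend_of_mem _ _ hx', hSa]
    change inner ℝ (toL2 (hGL x)) u = _
    rw [inner_toL2_left]
    refine intervalIntegral.integral_congr fun y hy => ?_
    rw [uIcc_of_le zero_le_one] at hy
    simp only [hG', hPe x hx', hPe y hy]
  have hTa : ∀ u : Lp ℝ 2 unitMeasure, (ofBCF.comp S) u =ᵐ[unitMeasure]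
      fun x => ∫ y in (0 : ℝ)..1, G x y * u y := by
    intro u
    rw [ContinuousLinearMap.comp_apply, ofBCF_apply]
    filter_upwards [MemLp.coeFn_toLp (memL2_of_continuousOn
      ((S u).continuous.Icc_extend' (h := zero_le_one)).continuousOn),
      ae_restrict_mem measurableSet_Ioo] with x h1 hx
    exact h1.trans (hSe u x (Ioo_subset_Icc_self hx))
  refine ⟨ofBCF.comp S, hS.clm_comp ofBCF, fun u v => ?_, fun u => ⟨hTa u,
    ((S u).continuous.Icc_extend' (h := zero_le_one)).continuousOn.congr fun x hx =>
      (hSe u x hx).symm⟩⟩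
  have hform : ∀ u v : Lp ℝ 2 unitMeasure, inner ℝ ((ofBCF.comp S) u) v =
      ∫ x, ∫ y, v x * (G' x y * u y) ∂unitMeasure ∂unitMeasure := by
    intro u v
    rw [L2.inner_def]
    refine integral_congr_ae ?_
    filter_upwards [hTa u, ae_restrict_mem measurableSet_Ioo] with x h1 hx
    have hx' := Ioo_subset_Icc_self hx
    rw [h1, integral_const_mul, integral_unitMeasure]
    simp only [RCLike.inner_apply, conj_trivial]
    congr 1
    refine intervalIntegral.integral_congr fun y hy => ?_
    rw [uIcc_of_le zero_le_one] at hy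
    simp only [hG', hPe x hx', hPe y hy]
  have hint : ∀ u v : Lp ℝ 2 unitMeasure, Integrable
      (Function.uncurry fun x y => v x * (G' x y * u y)) (unitMeasure.prod unitMeasure) := by
    intro u v
    have hu : Integrable u unitMeasure := MemLp.integrable (by norm_num) (Lp.memLp u)
    have hv : Integrable v unitMeasure := MemLp.integrable (by norm_num) (Lp.memLp v)
    obtain ⟨C, hC⟩ := (isCompact_Icc.prod isCompact_Icc).exists_bound_of_continuousOn hG
    refine ((hv.mul_prod hu).bdd_mul (c := C) hG'c.aestronglyMeasurable
      (ae_of_all _ fun p => hC (P p.1, P p.2) ⟨hPm _, hPm _⟩)).congr (ae_of_all _ fun p => ?_)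
    simp only [Function.uncurry, hG']
    ring
  change inner ℝ ((ofBCF.comp S) u) v = inner ℝ u ((ofBCF.comp S) v)
  rw [← real_inner_comm u, hform, hform, integral_integral_swap (hint u v)]
  refine integral_congr_ae (ae_of_all _ fun x => integral_congr_ae (ae_of_all _ fun y => ?_))
  simp only [hG', hsymm (P y) (P x)]
  ring

/-! ### Existence of the eigenbasis -/

lemma integral_congr_ae_unitMeasure {f g : ℝ → ℝ} (h : f =ᵐ[unitMeasure] g) :
    ∫ x in (0 : ℝ)..1, f x = ∫ x in (0 : ℝ)..1, g x := by
  rw [← integral_unitMeasure, ← integral_unitMeasure]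
  exact integral_congr_ae h

lemma integral_congr_Icc {f g : ℝ → ℝ} (h : ∀ x ∈ Icc (0 : ℝ) 1, f x = g x) :
    ∫ x in (0 : ℝ)..1, f x = ∫ x in (0 : ℝ)..1, g x :=
  integral_congr_ae_unitMeasure (ae_unitMeasure_of_forall h)

lemma coeFn_toL2 {f : ℝ → ℝ} (hf : MemL2 f) : toL2 hf =ᵐ[unitMeasure] f := MemLp.coeFn_toLp hf

/-- A function orthogonal to all smooth functions with compact support vanishes. -/
lemma ae_eq_zero_of_forall_test {g : ℝ → ℝ} (hg : MemL2 g)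
    (h : ∀ φ : ℝ → ℝ, ContDiff ℝ ∞ φ → HasCompactSupport φ → tsupport φ ⊆ Ioo (0 : ℝ) 1 →
      ∫ x in (0 : ℝ)..1, φ x * g x = 0) : g =ᵐ[unitMeasure] 0 := by
  -- The hypothesis says that $g$ is a weak derivative of $0$.
  refine IsWeakDeriv.ae_eq (f := fun _ => 0) hg (memL2_of_continuousOn (f := 0) continuousOn_const)
    (fun φ h1 h2 h3 => ?_) fun φ h1 h2 h3 => by simp
  have := h φ h1 h2 h3
  simp only [mul_comm] at this
  simp [this]

/-- The eigenfunctions span `L²(0,1)`. -/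
lemma ae_eq_zero_of_orthogonal {V : ℝ → ℝ} (hV : ContinuousOn V (Icc 0 1))
    (hVpos : ∀ x ∈ Icc (0 : ℝ) 1, 0 < V x) {g : ℝ → ℝ} (hg : MemL2 g)
    (horth : ∀ μ f f', IsEigenpair V μ f f' → ∫ x in (0 : ℝ)..1, f x * g x = 0) :
    g =ᵐ[unitMeasure] 0 := by
  obtain ⟨φ, φ', ψ, ψ', W, hN⟩ := exists_isNeumannSystem hV hVpos
  obtain ⟨T, hTc, hTs, hT⟩ := exists_kernel_operator hN.continuousOn_greenKernel
    (greenKernel_comm φ ψ W)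
  -- Every test function $\chi$ equals $T(V\chi-\chi'')$, since the difference solves the
  -- homogeneous Neumann problem. By symmetry, $Tu=0$ makes $u$ orthogonal to all test functions.
  have hker : ∀ u, T u = 0 → u = 0 := by
    intro u hu
    refine Lp.eq_zero_iff_ae_eq_zero.2 (ae_eq_zero_of_forall_test (Lp.memLp u)
      fun χ hχ hχc hχs => ?_)
    have hχ1 : ContDiff ℝ ∞ (deriv χ) := (contDiff_infty_iff_deriv.1 hχ).2
    have hχ2 : ContDiff ℝ ∞ (deriv (deriv χ)) := (contDiff_infty_iff_deriv.1 hχ1).2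
    have hχL : MemL2 χ := memL2_of_continuousOn hχ.continuous.continuousOn
    have hb : ∀ x, x ∉ Ioo (0 : ℝ) 1 → deriv χ x = 0 := fun x hx => by
      have h1 := notMem_tsupport_iff_eventuallyEq.1 fun h => hx (hχs h)
      rw [h1.deriv_eq]
      simp
    set h : ℝ → ℝ := fun x => V x * χ x - deriv (deriv χ) x with hh
    have hhc : ContinuousOn h (Icc 0 1) :=
      (hV.mul hχ.continuous.continuousOn).sub hχ2.continuous.continuousOn
    obtain ⟨w', h1, h2, h3, h4⟩ := hN.exists_solution hhc
    have hz := IsEigenpair.eq_zero_of_zero (V := V) (f' := fun x => deriv χ x - w' x)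
      (f := fun x => χ x - ∫ y in (0 : ℝ)..1, greenKernel φ ψ W x y * h y) hV hVpos
      ⟨fun x hx => ((hχ.differentiable (by simp) x).hasDerivAt.hasDerivWithinAt).sub (h1 x hx),
        fun x hx => by
          convert! ((hχ1.differentiable (by simp) x).hasDerivAt.hasDerivWithinAt).sub (h2 x hx)
            using 1
          simp only [hh]
          ring,
        by simp [h3, hb], by simp [h4, hb]⟩
    have hTe : T (toL2 (memL2_of_continuousOn hhc)) = toL2 hχL := by
      refine Lp.ext ?_
      filter_upwards [(hT (toL2 (memL2_of_continuousOn hhc))).1, coeFn_toL2 hχL,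
        ae_restrict_mem measurableSet_Ioo] with x e1 e2 hx
      rw [e1, e2, sub_eq_zero.1 (hz x (Ioo_subset_Icc_self hx))]
      refine integral_congr_ae_unitMeasure ?_
      filter_upwards [coeFn_toL2 (memL2_of_continuousOn hhc)] with y e3
      rw [e3]
    rw [← inner_toL2_left hχL, ← hTe]
    have := hTs (toL2 (memL2_of_continuousOn hhc)) u
    change inner ℝ (T _) u = inner ℝ _ (T u) at this
    rw [this, hu, inner_zero_right]
  -- Eigenvectors of $T$ for $l\ne0$ have a representative `f` that is a Neumann eigenfunction with
  -- eigenvalue $1/l$, hence are orthogonal to $g$. The spectral theorem for compact symmetric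
  -- operators then leaves only $g=0$.
  have hle : (⨆ l, Module.End.eigenspace (T : Module.End ℝ (Lp ℝ 2 unitMeasure)) l) ≤
      (Submodule.span ℝ {toL2 hg})ᗮ := by
    refine iSup_le fun l u hu => Submodule.mem_orthogonal_singleton_iff_inner_right.2 ?_
    rw [Module.End.mem_eigenspace_iff] at hu
    change T u = l • u at hu
    rcases eq_or_ne l 0 with rfl | hl
    · rw [zero_smul] at hu
      rw [hker u hu, inner_zero_right]
    obtain ⟨e1, e2⟩ := hT u
    obtain ⟨f, hf⟩ : ∃ f : ℝ → ℝ, ∀ x, f x =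
        l⁻¹ * ∫ y in (0 : ℝ)..1, greenKernel φ ψ W x y * u y := ⟨_, fun _ => rfl⟩
    have huf : u =ᵐ[unitMeasure] f := by
      rw [hu] at e1
      filter_upwards [e1, Lp.coeFn_smul l u] with x h1 h2
      rw [h2, Pi.smul_apply, smul_eq_mul] at h1
      rw [hf, ← h1]
      field_simp
    have hff : ∀ x, l⁻¹ * ∫ y in (0 : ℝ)..1, greenKernel φ ψ W x y * f y = f x := fun x => by
      rw [hf x]
      congr 1
      exact integral_congr_ae_unitMeasure (huf.symm.mono fun y hy => by simp only [hy])
    obtain ⟨w', h1, h2, h3, h4⟩ := hN.exists_solution (f := f)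
      ((continuousOn_const.mul e2).congr fun x _ => hf x)
    have hpair : IsEigenpair V l⁻¹ f fun x => l⁻¹ * w' x := by
      refine ⟨fun x hx => ?_, fun x hx => ?_, by simp [h3], by simp [h4]⟩
      · exact ((h1 x hx).const_mul l⁻¹).congr (fun y _ => (hff y).symm) (hff x).symm
      · convert! (h2 x hx).const_mul l⁻¹ using 1
        linear_combination V x * (-hff x)
    rw [inner_toL2_left]
    refine Eq.trans ?_ (horth _ _ _ hpair)
    exact integral_congr_ae_unitMeasure (huf.mono fun y hy => by simp only [hy, mul_comm])
  have hmem : toL2 hg ∈ (⨆ l, Module.End.eigenspace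
      (T : Module.End ℝ (Lp ℝ 2 unitMeasure)) l)ᗮ := by
    refine (Submodule.mem_orthogonal _ _).2 fun u hu => ?_
    rw [real_inner_comm]
    exact Submodule.mem_orthogonal_singleton_iff_inner_right.1 (hle hu)
  rw [ContinuousLinearMap.orthogonalComplement_iSup_eigenspaces_eq_bot hTc hTs,
    Submodule.mem_bot] at hmem
  exact (coeFn_toL2 hg).symm.trans (Lp.eq_zero_iff_ae_eq_zero.1 hmem)

/-! ### Enumeration of the eigenvalues and positivity of the ground state. -/

lemma IsEigenpair.eq_zero_of_integral_sq {V f f' : ℝ → ℝ} {μ : ℝ} (hV : ContinuousOn V (Icc 0 1))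
    (h : IsEigenpair V μ f f') {a b : ℝ} (ha : 0 ≤ a) (hab : a < b) (hb : b ≤ 1)
    (h0 : ∫ x in a..b, f x * f x = 0) : ∀ x ∈ Icc (0 : ℝ) 1, f x = 0 := by
  have hs : Icc a b ⊆ Icc 0 1 := Icc_subset_Icc ha hb
  have hz : ∀ x ∈ Icc a b, f x = 0 := by
    by_contra! hne
    obtain ⟨c, hc, hc0⟩ := hne
    exact (intervalIntegral.integral_pos hab ((h.continuousOn.mul h.continuousOn).mono hs)
      (fun x _ => mul_self_nonneg _) ⟨c, hc, mul_self_pos.2 hc0⟩).ne' h0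
  obtain ⟨c, hc⟩ := nonempty_Ioo.2 hab
  have hcI := Ioo_subset_Icc_self hc
  refine h.eq_zero_of_cauchy hV (hs hcI) (hz c hcI) ?_
  have hd := (h.deriv c (hs hcI)).hasDerivAt
    (mem_of_superset (Icc_mem_nhds hc.1 hc.2) hs)
  refine hd.unique ((hasDerivAt_const c (0 : ℝ)).congr_of_eventuallyEq ?_)
  filter_upwards [Icc_mem_nhds hc.1 hc.2] with x hx using hz x hx

/-- Finite initial segments give a least element and successors, and infinity excludes a last
element. -/
lemma nonempty_nat_orderIso {ι : Type*} [LinearOrder ι] [Infinite ι]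
    (h : ∀ b : ι, (Iic b).Finite) : Nonempty (ℕ ≃o ι) := by
  obtain ⟨b⟩ := (inferInstance : Nonempty ι)
  obtain ⟨m, -, hm⟩ := Set.exists_min_image (Iic b) id (h b) ⟨b, le_rfl⟩
  let : OrderBot ι :=
    { bot := m
      bot_le := fun a => (le_total a b).elim (fun hab => hm a hab)
        fun hab => (hm b le_rfl).trans hab }
  let : LocallyFiniteOrder ι :=
    LocallyFiniteOrder.ofFiniteIcc fun a b => (h b).subset Icc_subset_Iic_self
  let := LinearLocallyFiniteOrder.succOrder ι
  let := LinearLocallyFiniteOrder.predOrder ι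
  have : NoMaxOrder ι := ⟨fun a => by
    obtain ⟨c, hc⟩ := (h a).exists_notMem
    exact ⟨c, not_le.1 hc⟩⟩
  exact ⟨orderIsoNatOfLinearSuccPredArch.symm⟩

lemma IsEigenpair.orthogonal {V f f' g g' : ℝ → ℝ} {μ ν : ℝ} (hV : ContinuousOn V (Icc 0 1))
    (hf : IsEigenpair V μ f f') (hg : IsEigenpair V ν g g') (hne : μ ≠ ν) :
    ∫ x in (0 : ℝ)..1, f x * g x = 0 := by
  have h1 := hg.weak hV hf.deriv hf.continuousOn'
  have h2 := hf.weak hV hg.deriv hg.continuousOn'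
  simp only [mul_comm (g _), mul_comm (g' _)] at h2
  rw [h1] at h2
  exact (mul_eq_zero.1 (by linear_combination h2 :
    (ν - μ) * ∫ x in (0 : ℝ)..1, f x * g x = 0)).resolve_left (sub_ne_zero.2 hne.symm)

/-- The normalised eigenfunctions, indexed by the eigenvalues, form a complete family. -/
lemma exists_complete_isEigenfamily {V : ℝ → ℝ} (hV : ContinuousOn V (Icc 0 1))
    (hVpos : ∀ x ∈ Icc (0 : ℝ) 1, 0 < V x) :
    ∃ (Λ : Set ℝ) (e e' : Λ → ℝ → ℝ), IsEigenfamily V (fun i : Λ => (i : ℝ)) e e' ∧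
      ∀ g : ℝ → ℝ, MemL2 g → (∀ i, ∫ x in (0 : ℝ)..1, e i x * g x = 0) → g =ᵐ[unitMeasure] 0 := by
  -- The eigenvalues index the family themselves: simplicity makes one normalised eigenfunction per
  -- eigenvalue enough.
  let Λ : Set ℝ := {μ | ∃ f f', IsEigenpair V μ f f' ∧ ∫ x in (0 : ℝ)..1, f x * f x = 1}
  choose e e' he hn using fun i : Λ => i.2
  refine ⟨Λ, e, e', ⟨he, fun i j => ?_⟩, fun g hg h => ?_⟩
  · split_ifs with hij
    · rw [hij, hn]
    · exact (he i).orthogonal hV (he j) fun h => hij (Subtype.ext h)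
  refine ae_eq_zero_of_orthogonal hV hVpos hg fun μ f f' hf => ?_
  by_cases h0 : ∀ x ∈ Icc (0 : ℝ) 1, f x = 0
  · rw [integral_congr_Icc (g := fun _ => 0) fun x hx => by rw [h0 x hx, zero_mul]]
    simp
  have hI : 0 < ∫ x in (0 : ℝ)..1, f x * f x :=
    lt_of_le_of_ne (intervalIntegral.integral_nonneg zero_le_one fun _ _ => mul_self_nonneg _)
      fun hI => h0 (hf.eq_zero_of_integral_sq hV le_rfl zero_lt_one le_rfl hI.symm)
  set I := ∫ x in (0 : ℝ)..1, f x * f x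
  have hμ : μ ∈ Λ := by
    refine ⟨_, _, hf.const_mul (Real.sqrt I)⁻¹, ?_⟩
    have : ∀ x, (Real.sqrt I)⁻¹ * f x * ((Real.sqrt I)⁻¹ * f x) = I⁻¹ * (f x * f x) := fun x => by
      rw [mul_mul_mul_comm, ← mul_inv, Real.mul_self_sqrt hI.le]
    simp only [this]
    rw [intervalIntegral.integral_const_mul]
    exact inv_mul_cancel₀ hI.ne'
  have hpair := he ⟨μ, hμ⟩
  have he0 : e ⟨μ, hμ⟩ 0 ≠ 0 := fun h0 => by
    have h1 := hpair.eq_zero_of_cauchy hV (left_mem_Icc.2 zero_le_one) h0 hpair.left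
    have h2 := hn ⟨μ, hμ⟩
    rw [integral_congr_Icc (g := fun _ => 0) fun x hx => by rw [h1 x hx, zero_mul]] at h2
    simp at h2
  have hff : ∀ x ∈ Icc (0 : ℝ) 1, f x * g x =
      f 0 / e ⟨μ, hμ⟩ 0 * (e ⟨μ, hμ⟩ x * g x) := fun x hx => by
    have := hf.mul_eq_mul hV hpair x hx
    field_simp
    linear_combination g x * this
  rw [integral_congr_Icc hff, intervalIntegral.integral_const_mul, h, mul_zero]

/-- Any $n$ eigenvalues below $b$ contribute at least $n/b$ to a sum of reciprocals bounded by
$2/\kappa$. -/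
lemma IsEigenfamily.finite_Iic {Λ : Set ℝ} {V : ℝ → ℝ} {e e' : Λ → ℝ → ℝ}
    (h : IsEigenfamily V (fun i : Λ => (i : ℝ)) e e') (hV : ContinuousOn V (Icc 0 1))
    (hVpos : ∀ x ∈ Icc (0 : ℝ) 1, 0 < V x) (b : Λ) : (Iic b).Finite := by
  obtain ⟨κ, h0, h1, h2⟩ := exists_pos_le V hV hVpos
  have hμ := h.le_eigenvalue hV h0 h1 h2
  by_contra hinf
  obtain ⟨n, hn⟩ := exists_nat_gt (2 / κ * (b : ℝ))
  obtain ⟨s, hs, hc⟩ := (show (Iic b).Infinite from hinf).exists_subset_card_eq n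
  have h3 := h.sum_inv_le hV h0 h1 h2 s
  have hb : 0 < (b : ℝ) := h0.trans_le (hμ b)
  have h4 : s.card • ((b : ℝ))⁻¹ ≤ ∑ i ∈ s, ((i : ℝ))⁻¹ :=
    Finset.card_nsmul_le_sum _ _ _ fun i hi =>
      inv_anti₀ (h0.trans_le (hμ i)) (Subtype.coe_le_coe.2 (hs hi))
  rw [nsmul_eq_mul, hc] at h4
  have h5 := h4.trans h3
  rw [← div_eq_mul_inv, div_le_iff₀ hb] at h5
  linarith

/-- A finite complete family would make every continuous function a finite combination of
differentiable ones, which $|x-1/2|$ is not. -/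
lemma IsEigenfamily.infinite {ι : Type*} [DecidableEq ι] {V : ℝ → ℝ} {μ : ι → ℝ}
    {e e' : ι → ℝ → ℝ} (h : IsEigenfamily V μ e e')
    (hcomp : ∀ g : ℝ → ℝ, MemL2 g → (∀ i, ∫ x in (0 : ℝ)..1, e i x * g x = 0) →
      g =ᵐ[unitMeasure] 0) : Infinite ι := by
  by_contra hfin
  rw [not_infinite_iff_finite] at hfin
  cases nonempty_fintype ι
  obtain ⟨f, hf⟩ : ∃ f : ℝ → ℝ, ∀ x, f x = |x - 1 / 2| := ⟨_, fun _ => rfl⟩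
  have hfc : ContinuousOn f (Icc 0 1) := by
    rw [funext hf]
    fun_prop
  set k : ι → ℝ := fun i => ∫ x in (0 : ℝ)..1, e i x * f x
  have hsum := h.hasDerivWithinAt_sum Finset.univ k
  have hsc := continuousOn_of_hasDerivWithinAt hsum
  have hz := hcomp (fun x => f x - ∑ i, k i * e i x)
    (memL2_of_continuousOn (hfc.sub hsc)) fun i => by
      have i1 : IntervalIntegrable (fun x => e i x * f x) volume 0 1 :=
        intervalIntegrable_of_continuousOn ((h.pair i).continuousOn.mul hfc)
      have i2 : IntervalIntegrable (fun x => (∑ j, k j * e j x) * e i x) volume 0 1 :=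
        intervalIntegrable_of_continuousOn (hsc.mul (h.pair i).continuousOn)
      have : ∀ x, e i x * (f x - ∑ j, k j * e j x) = e i x * f x - (∑ j, k j * e j x) * e i x :=
        fun x => by ring
      simp only [this]
      rw [intervalIntegral.integral_sub i1 i2, h.integral_sum_mul _ _ (Finset.mem_univ i), sub_self]
  have heq : ∀ x ∈ Icc (0 : ℝ) 1, f x - ∑ i, k i * e i x = 0 :=
    eqOn_Icc_of_ae_eq (hfc.sub hsc) continuousOn_const hz
  have hm : Icc (0 : ℝ) 1 ∈ 𝓝 (1 / 2 : ℝ) := Icc_mem_nhds (by norm_num) (by norm_num)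
  have hd : DifferentiableAt ℝ (fun x : ℝ => |x - 1 / 2|) (1 / 2) := by
    refine DifferentiableAt.congr_of_eventuallyEq
      ((hsum (1 / 2) (mem_of_mem_nhds hm)).hasDerivAt hm).differentiableAt ?_
    filter_upwards [hm] with x hx
    rw [← hf]
    linarith [heq x hx]
  refine not_differentiableAt_abs_zero ?_
  have h2 : DifferentiableAt ℝ (fun x : ℝ => |x + 1 / 2 - 1 / 2|) 0 := by
    refine DifferentiableAt.comp (g := fun x : ℝ => |x - 1 / 2|) (f := fun x : ℝ => x + 1 / 2) 0 ?_
      (by fun_prop)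
    simpa using hd
  simpa using! h2

/-- The first eigenfunction has no zero. -/
lemma IsEigenfamily.ground_state_ne_zero {V : ℝ → ℝ} {μ : ℕ → ℝ} {e e' : ℕ → ℝ → ℝ}
    (h : IsEigenfamily V μ e e') (hV : ContinuousOn V (Icc 0 1))
    (hVpos : ∀ x ∈ Icc (0 : ℝ) 1, 0 < V x) (hμ : StrictMono μ)
    (hcomp : ∀ g : ℝ → ℝ, MemL2 g → (∀ i, ∫ x in (0 : ℝ)..1, e i x * g x = 0) →
      g =ᵐ[unitMeasure] 0) {z : ℝ} (hz : z ∈ Ioo (0 : ℝ) 1) : e 0 z ≠ 0 := by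
  intro hz0
  have hzI := Ioo_subset_Icc_self hz
  have hc := fun n => (h.pair n).continuousOn
  have hc' := fun n => (h.pair n).continuousOn'
  have hL := fun n => memL2_of_continuousOn (hc n)
  have hsub : ∀ {a b : ℝ}, 0 ≤ a → a ≤ b → b ≤ 1 → ∀ {g : ℝ → ℝ}, ContinuousOn g (Icc 0 1) →
      IntervalIntegrable g volume a b := fun h1 h2 h3 g hg =>
    (hg.mono (by rw [uIcc_of_le h2]; exact Icc_subset_Icc h1 h3)).intervalIntegrable
  -- If $e_0(z)=0$, cutting $e_0$ off beyond $z$ keeps the Rayleigh quotient at its minimum $\mu_0$.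
  -- The cut-off is then a multiple of $e_0$, which unique continuation forbids.
  set w : ℝ → ℝ := indicator {x | x ≤ z} (e 0) with hw
  have hwL : MemL2 w := (hL 0).indicator measurableSet_Iic
  obtain ⟨a, ha⟩ : ∃ a : ℕ → ℝ, ∀ n, a n = ∫ x in (0 : ℝ)..z, e 0 x * e n x := ⟨_, fun _ => rfl⟩
  have hgw : ∀ g : ℝ → ℝ, ∫ x in (0 : ℝ)..1, g x * w x = ∫ x in (0 : ℝ)..z, e 0 x * g x := by
    intro g
    rw [← intervalIntegral.integral_indicator hzI]
    congr 1
    ext x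
    by_cases hx : x ≤ z <;> simp [hw, indicator, hx, mul_comm]
  have hpars : HasSum (fun n => a n ^ 2) (a 0) := by
    have h1 := hasSum_coeff_mul_coeff hL h.orthonormal hcomp hwL hwL
    simp only [coeff, hgw, ← ha] at h1
    have h2 : ∫ x in (0 : ℝ)..z, e 0 x * w x = a 0 := by
      rw [ha]
      refine intervalIntegral.integral_congr fun x hx => ?_
      rw [uIcc_of_le hz.1.le] at hx
      simp [hw, hx.2]
    rw [h2] at h1
    simpa only [sq] using h1
  -- Bessel's inequality for the energy: expand $0\le\mathcal E_{[0,z]}(e_0-u)$ for a partial sum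
  -- $u$ and use $\mathcal E_{[0,z]}(u)\le\mathcal E_{[0,1]}(u)$. The boundary terms at $z$ carry
  -- the factor $e_0(z)=0$.
  have henergy : ∀ s : Finset ℕ, ∑ n ∈ s, μ n * a n ^ 2 ≤ μ 0 * a 0 := by
    intro s
    obtain ⟨u, hu⟩ : ∃ u : ℝ → ℝ, ∀ x, u x = ∑ n ∈ s, a n * e n x := ⟨_, fun _ => rfl⟩
    obtain ⟨u', hu'⟩ : ∃ u' : ℝ → ℝ, ∀ x, u' x = ∑ n ∈ s, a n * e' n x := ⟨_, fun _ => rfl⟩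
    have huc : ContinuousOn u (Icc 0 1) := by
      rw [funext hu]
      exact continuousOn_of_hasDerivWithinAt (h.hasDerivWithinAt_sum s a)
    have huc' : ContinuousOn u' (Icc 0 1) := by
      rw [funext hu']
      exact h.continuousOn_sum' s a
    have e1 : ∫ x in (0 : ℝ)..z, (e' 0 x * e' 0 x + V x * (e 0 x * e 0 x)) = μ 0 * a 0 := by
      rw [(h.pair 0).weak_on hV (h.pair 0).deriv (hc' 0) le_rfl hz.1.le hz.2.le, hz0,
        (h.pair 0).left, ha]
      ring
    have e2 : ∫ x in (0 : ℝ)..z, (e' 0 x * u' x + V x * (e 0 x * u x)) =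
        ∑ n ∈ s, μ n * a n ^ 2 := by
      have h1 : ∀ x, e' 0 x * u' x + V x * (e 0 x * u x) =
          ∑ n ∈ s, a n * (e' 0 x * e' n x + V x * (e 0 x * e n x)) := fun x => by
        simp only [hu, hu', Finset.mul_sum, ← Finset.sum_add_distrib]
        exact Finset.sum_congr rfl fun n _ => by ring
      simp only [h1]
      have i : ∀ n, IntervalIntegrable (fun x => a n * (e' 0 x * e' n x + V x * (e 0 x * e n x)))
          volume 0 z := fun n => hsub le_rfl hz.1.le hz.2.le
        (continuousOn_const.mul (((hc' 0).mul (hc' n)).add (hV.mul ((hc 0).mul (hc n)))))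
      rw [intervalIntegral.integral_finsetSum fun n _ => i n]
      refine Finset.sum_congr rfl fun n _ => ?_
      rw [intervalIntegral.integral_const_mul, (h.pair n).weak_on hV (h.pair 0).deriv (hc' 0) le_rfl
        hz.1.le hz.2.le, hz0, (h.pair n).left, ← ha]
      ring
    have e3 : ∫ x in (0 : ℝ)..1, (u' x * u' x + V x * (u x * u x)) = ∑ n ∈ s, μ n * a n ^ 2 := by
      simp only [hu, hu']
      exact h.energy_sum hV s a
    have c0 : ContinuousOn (fun x => e' 0 x * e' 0 x + V x * (e 0 x * e 0 x)) (Icc 0 1) :=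
      ((hc' 0).mul (hc' 0)).add (hV.mul ((hc 0).mul (hc 0)))
    have c1 : ContinuousOn (fun x => e' 0 x * u' x + V x * (e 0 x * u x)) (Icc 0 1) :=
      ((hc' 0).mul huc').add (hV.mul ((hc 0).mul huc))
    have c2 : ContinuousOn (fun x => u' x * u' x + V x * (u x * u x)) (Icc 0 1) :=
      (huc'.mul huc').add (hV.mul (huc.mul huc))
    have p1 : 0 ≤ ∫ x in (0 : ℝ)..z, ((e' 0 x * e' 0 x + V x * (e 0 x * e 0 x)) -
        2 * (e' 0 x * u' x + V x * (e 0 x * u x)) + (u' x * u' x + V x * (u x * u x))) := by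
      refine intervalIntegral.integral_nonneg hz.1.le fun x hx => ?_
      nlinarith [mul_nonneg (hVpos x ⟨hx.1, hx.2.trans hz.2.le⟩).le (sq_nonneg (e 0 x - u x)),
        sq_nonneg (e' 0 x - u' x)]
    have p2 : 0 ≤ ∫ x in z..1, (u' x * u' x + V x * (u x * u x)) := by
      refine intervalIntegral.integral_nonneg hz.2.le fun x hx => ?_
      exact add_nonneg (mul_self_nonneg _)
        (mul_nonneg (hVpos x ⟨hz.1.le.trans hx.1, hx.2⟩).le (mul_self_nonneg _))
    have i0 := hsub le_rfl hz.1.le hz.2.le c0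
    have i1 := (hsub le_rfl hz.1.le hz.2.le c1).const_mul 2
    have i2 := hsub le_rfl hz.1.le hz.2.le c2
    have i01 : IntervalIntegrable (fun x => (e' 0 x * e' 0 x + V x * (e 0 x * e 0 x)) -
      2 * (e' 0 x * u' x + V x * (e 0 x * u x))) volume 0 z := i0.sub i1
    rw [intervalIntegral.integral_add i01 i2, intervalIntegral.integral_sub i0 i1,
      intervalIntegral.integral_const_mul, e1, e2] at p1
    have e4 := intervalIntegral.integral_add_adjacent_intervals i2
      (hsub hz.1.le hz.2.le le_rfl c2)
    rw [e3] at e4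
    linarith
  -- Together with Parseval, $\sum a_n^2=a_0$, the energy bound gives $\sum(\mu_n-\mu_0)a_n^2\le0$.
  have hzero : ∀ m, m ≠ 0 → a m = 0 := by
    intro m hm
    have hpos : 0 < μ m - μ 0 := sub_pos.2 (hμ (Nat.pos_of_ne_zero hm))
    have hlim : Tendsto (fun N => μ 0 * (a 0 - ∑ n ∈ Finset.range N, a n ^ 2)) atTop (𝓝 0) := by
      have := (hpars.tendsto_sum_nat.const_sub (a 0)).const_mul (μ 0)
      simpa using this
    have h1 : (μ m - μ 0) * a m ^ 2 ≤ 0 := by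
      refine ge_of_tendsto hlim ?_
      filter_upwards [eventually_gt_atTop m] with N hN
      have h2 := Finset.single_le_sum (s := Finset.range N)
        (f := fun n => (μ n - μ 0) * a n ^ 2)
        (fun n _ => mul_nonneg (sub_nonneg.2 (hμ.monotone (Nat.zero_le n))) (sq_nonneg _))
        (Finset.mem_range.2 hN)
      have h3 := henergy (Finset.range N)
      simp only [sub_mul, Finset.sum_sub_distrib, ← Finset.mul_sum] at h2
      linarith
    have h2 : a m ^ 2 ≤ 0 := by
      by_contra! h3
      exact absurd (mul_pos hpos h3) (not_lt.2 h1)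
    exact pow_eq_zero_iff two_ne_zero |>.1 (le_antisymm h2 (sq_nonneg _))
  -- So $a_0=\int_0^ze_0^2$ is $0$ or $1$: $e_0$ vanishes on one side of $z$, hence everywhere.
  have h01 : a 0 ^ 2 = a 0 :=
    (hasSum_single 0 fun m hm => by rw [hzero m hm]; ring).unique hpars
  have hne : ¬ ∀ x ∈ Icc (0 : ℝ) 1, e 0 x = 0 := fun h0 => by
    have h1 := h.orthonormal 0 0
    rw [integral_congr_Icc (g := fun _ => 0) fun x hx => by rw [h0 x hx, zero_mul]] at h1
    simp at h1
  rcases mul_eq_zero.1 (by linear_combination h01 : a 0 * (a 0 - 1) = 0) with h0 | h1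
  · rw [ha] at h0
    exact hne ((h.pair 0).eq_zero_of_integral_sq hV le_rfl hz.1 hz.2.le h0)
  · have e4 := intervalIntegral.integral_add_adjacent_intervals
      (hsub le_rfl hz.1.le hz.2.le ((hc 0).mul (hc 0)))
      (hsub hz.1.le hz.2.le le_rfl ((hc 0).mul (hc 0)))
    have e5 := h.orthonormal 0 0
    rw [if_pos rfl] at e5
    simp only [Pi.mul_apply] at e4
    rw [e5, ← ha] at e4
    exact hne ((h.pair 0).eq_zero_of_integral_sq hV hz.1.le hz.2 le_rfl (by linarith))

lemma exists_sign {f : ℝ → ℝ} (hf : ContinuousOn f (Ioo 0 1))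
    (h0 : ∀ x ∈ Ioo (0 : ℝ) 1, f x ≠ 0) :
    ∃ s : ℝ, s * s = 1 ∧ ∀ x ∈ Ioo (0 : ℝ) 1, 0 < s * f x := by
  have hiv : ∀ x ∈ Ioo (0 : ℝ) 1, ∀ y ∈ Ioo (0 : ℝ) 1, f x < 0 → ¬ 0 < f y := by
    intro x hx y hy h1 h2
    obtain ⟨c, hc, hc0⟩ := isPreconnected_Ioo.intermediate_value hx hy hf ⟨h1.le, h2.le⟩
    exact h0 c hc hc0
  have hm : (1 / 2 : ℝ) ∈ Ioo (0 : ℝ) 1 := by norm_num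
  rcases lt_or_gt_of_ne (h0 _ hm) with h | h
  · exact ⟨-1, by norm_num, fun x hx => by
      have := (lt_or_gt_of_ne (h0 x hx)).resolve_right (hiv _ hm x hx h)
      linarith⟩
  · exact ⟨1, by norm_num, fun x hx => by
      have := (lt_or_gt_of_ne (h0 x hx)).resolve_left fun h' => hiv x hx _ hm h' h
      linarith⟩

theorem exists_isNeumannEigenbasis {V : ℝ → ℝ} (hV : ContinuousOn V (Icc 0 1))
    (hVpos : ∀ x ∈ Icc (0 : ℝ) 1, 0 < V x) :
    ∃ (μ : ℕ → ℝ) (e : ℕ → ℝ → ℝ), IsNeumannEigenbasis V μ e := by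
  obtain ⟨Λ, e, e', h, hcomp⟩ := exists_complete_isEigenfamily hV hVpos
  have := h.infinite hcomp
  obtain ⟨Φ⟩ := nonempty_nat_orderIso (h.finite_Iic hV hVpos)
  have hmono : StrictMono fun n => (Φ n : ℝ) := fun m n hmn => Φ.strictMono hmn
  have hfam : IsEigenfamily V (fun n => (Φ n : ℝ)) (fun n => e (Φ n)) fun n => e' (Φ n) :=
    ⟨fun n => h.pair _, fun m n => by simp [h.orthonormal]⟩
  have hcomp' : ∀ g : ℝ → ℝ, MemL2 g → (∀ n, ∫ x in (0 : ℝ)..1, e (Φ n) x * g x = 0) →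
      g =ᵐ[unitMeasure] 0 := fun g hg hg0 => hcomp g hg fun i => by
    simpa using hg0 (Φ.symm i)
  obtain ⟨s, hs, hpos⟩ := exists_sign ((hfam.pair 0).continuousOn.mono Ioo_subset_Icc_self)
    fun z hz => hfam.ground_state_ne_zero hV hVpos hmono hcomp' hz
  have hs0 : s ≠ 0 := fun h => by simp [h] at hs
  refine ⟨fun n => Φ n, fun n x => s * e (Φ n) x, fun n => ((hfam.pair n).const_mul s).solves,
    hmono.monotone, fun m n => ?_, fun f hf hf0 => hcomp' f hf fun n => ?_, hpos⟩
  · simp only [mul_mul_mul_comm s, hs, one_mul]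
    exact hfam.orthonormal m n
  · have := hf0 n
    simp only [mul_assoc] at this
    rw [intervalIntegral.integral_const_mul] at this
    exact (mul_eq_zero.1 this).resolve_left hs0

/-! ### The linear heat equation -/

/-- `w` is a solution, with derivatives `wt` and `wx`, of `∂ₜw = ∂ₓₓw - V w` with Neumann boundary
conditions, attaining the initial value `w₀` in `L²(0,1)`. -/
structure IsLinearHeatSolution (V w₀ : ℝ → ℝ) (w wt wx : ℝ → ℝ → ℝ) : Prop where
  cont : ContinuousOn (fun p : ℝ × ℝ => w p.1 p.2) (Ioi 0 ×ˢ Icc 0 1)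
  cont_t : ContinuousOn (fun p : ℝ × ℝ => wt p.1 p.2) (Ioi 0 ×ˢ Icc 0 1)
  cont_x : ContinuousOn (fun p : ℝ × ℝ => wx p.1 p.2) (Ioi 0 ×ˢ Icc 0 1)
  deriv_t : ∀ t, 0 < t → ∀ x ∈ Icc (0 : ℝ) 1, HasDerivAt (fun s => w s x) (wt t x) t
  deriv_x : ∀ t, 0 < t → ∀ x ∈ Icc (0 : ℝ) 1, HasDerivWithinAt (w t) (wx t x) (Icc 0 1) x
  deriv_xx : ∀ t, 0 < t → ∀ x ∈ Icc (0 : ℝ) 1,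
    HasDerivWithinAt (wx t) (wt t x + V x * w t x) (Icc 0 1) x
  left : ∀ t, 0 < t → wx t 0 = 0
  right : ∀ t, 0 < t → wx t 1 = 0
  lim : Tendsto (fun t => l2Norm fun x => w t x - w₀ x) (𝓝[>] 0) (𝓝 0)

/-- The series `∑ c_n e^{-μ_n t} φ_n(x)`. -/
def heatSeries (μ c : ℕ → ℝ) (φ : ℕ → ℝ → ℝ) (t x : ℝ) : ℝ :=
  synth φ (fun n => c n * Real.exp (-μ n * t)) x

section

variable {μ c : ℕ → ℝ} {φ φ' : ℕ → ℝ → ℝ} {K : ℝ} {p q : ℕ}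

lemma abs_heatSeries_term_le (hμ : ∀ n, 0 < μ n)
    (hb : ∀ n, ∀ x ∈ Icc (0 : ℝ) 1, |φ n x| ≤ K * μ n ^ p) {δ t x : ℝ} (ht : δ ≤ t)
    (hx : x ∈ Icc (0 : ℝ) 1) (n : ℕ) :
    |c n * Real.exp (-μ n * t) * φ n x| ≤ K * (|c n| * (μ n ^ p * Real.exp (-μ n * δ))) := by
  rw [abs_mul, abs_mul, Real.abs_exp]
  have h1 : Real.exp (-μ n * t) ≤ Real.exp (-μ n * δ) := Real.exp_le_exp.2 (by nlinarith [hμ n])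
  calc |c n| * Real.exp (-μ n * t) * |φ n x|
      ≤ |c n| * Real.exp (-μ n * δ) * (K * μ n ^ p) :=
        mul_le_mul (mul_le_mul_of_nonneg_left h1 (abs_nonneg _)) (hb n x hx) (abs_nonneg _)
          (mul_nonneg (abs_nonneg _) (Real.exp_pos _).le)
    _ = _ := by ring

lemma hasSum_heatSeries (hμ : ∀ n, 0 < μ n)
    (hs : ∀ δ, 0 < δ → Summable fun n => |c n| * (μ n ^ p * Real.exp (-μ n * δ)))
    (hb : ∀ n, ∀ x ∈ Icc (0 : ℝ) 1, |φ n x| ≤ K * μ n ^ p) {t x : ℝ} (ht : 0 < t)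
    (hx : x ∈ Icc (0 : ℝ) 1) :
    HasSum (fun n => c n * Real.exp (-μ n * t) * φ n x) (heatSeries μ c φ t x) :=
  (summable_of_abs_le ((hs t ht).mul_left K)
    fun n => abs_heatSeries_term_le hμ hb le_rfl hx n).hasSum

lemma continuousOn_heatSeries (hμ : ∀ n, 0 < μ n)
    (hs : ∀ δ, 0 < δ → Summable fun n => |c n| * (μ n ^ p * Real.exp (-μ n * δ)))
    (hφ : ∀ n, ContinuousOn (φ n) (Icc 0 1))
    (hb : ∀ n, ∀ x ∈ Icc (0 : ℝ) 1, |φ n x| ≤ K * μ n ^ p) :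
    ContinuousOn (fun p : ℝ × ℝ => heatSeries μ c φ p.1 p.2) (Ioi 0 ×ˢ Icc 0 1) := by
  rintro ⟨t, x⟩ ⟨ht, hx⟩
  have ht : 0 < t := ht
  have h1 : ContinuousOn (fun p : ℝ × ℝ => heatSeries μ c φ p.1 p.2)
      (Ioi (t / 2) ×ˢ Icc 0 1) := by
    refine continuousOn_tsum (fun n => ?_) ((hs _ (half_pos ht)).mul_left K)
      fun n p hp => abs_heatSeries_term_le hμ hb (le_of_lt hp.1) hp.2 n
    refine ContinuousOn.mul (Continuous.continuousOn (by fun_prop))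
      ((hφ n).comp continuousOn_snd fun p hp => hp.2)
  refine (h1 (t, x) ⟨half_lt_self ht, hx⟩).mono_of_mem_nhdsWithin ?_
  refine mem_nhdsWithin.2 ⟨Ioi (t / 2) ×ˢ univ, isOpen_Ioi.prod isOpen_univ,
    ⟨half_lt_self ht, mem_univ _⟩, fun p hp => ⟨hp.1.1, hp.2.2⟩⟩

lemma hasDerivAt_heatSeries (hμ : ∀ n, 0 < μ n)
    (hs : ∀ p δ, 0 < δ → Summable fun n => |c n| * (μ n ^ p * Real.exp (-μ n * δ)))
    (hb : ∀ n, ∀ x ∈ Icc (0 : ℝ) 1, |φ n x| ≤ K * μ n ^ p) {t x : ℝ} (ht : 0 < t)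
    (hx : x ∈ Icc (0 : ℝ) 1) :
    HasDerivAt (fun s => heatSeries μ c φ s x)
      (heatSeries μ c (fun n x => -μ n * φ n x) t x) t := by
  have hb' : ∀ n, ∀ x ∈ Icc (0 : ℝ) 1, |-μ n * φ n x| ≤ K * μ n ^ (p + 1) := fun n x hx => by
    rw [abs_mul, abs_neg, abs_of_pos (hμ n), pow_succ, ← mul_assoc, mul_comm (μ n)]
    exact mul_le_mul_of_nonneg_right (hb n x hx) (hμ n).le
  have hd : ∀ n s, s ∈ Ioi (t / 2) → HasDerivAt (fun s => c n * Real.exp (-μ n * s) * φ n x)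
      (c n * Real.exp (-μ n * s) * (-μ n * φ n x)) s := fun n s _ => by
    convert! ((((hasDerivAt_id s).const_mul (-μ n)).exp.const_mul (c n)).mul_const (φ n x)) using 1
    simp only [id_eq]
    ring
  have hle : ∀ n s, s ∈ Ioi (t / 2) → ‖c n * Real.exp (-μ n * s) * (-μ n * φ n x)‖ ≤
      K * (|c n| * (μ n ^ (p + 1) * Real.exp (-μ n * (t / 2)))) := fun n s hs' => by
    rw [Real.norm_eq_abs]
    exact abs_heatSeries_term_le (φ := fun n x => -μ n * φ n x) hμ hb' (le_of_lt hs') hx n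
  exact hasDerivAt_tsum_of_isPreconnected ((hs _ _ (half_pos ht)).mul_left K) isOpen_Ioi
    isPreconnected_Ioi hd hle (half_lt_self ht) (hasSum_heatSeries hμ (hs _) hb ht hx).summable
    (half_lt_self ht)

/-- To include the endpoints, the derivative is obtained by integrating the differentiated series
term by term and recognising the original series as its primitive. -/
lemma hasDerivWithinAt_heatSeries (hμ : ∀ n, 0 < μ n)
    (hs : ∀ p δ, 0 < δ → Summable fun n => |c n| * (μ n ^ p * Real.exp (-μ n * δ)))
    (hb : ∀ n, ∀ x ∈ Icc (0 : ℝ) 1, |φ n x| ≤ K * μ n ^ p)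
    (hd : ∀ n, ∀ x ∈ Icc (0 : ℝ) 1, HasDerivWithinAt (φ n) (φ' n x) (Icc 0 1) x)
    (hφ' : ∀ n, ContinuousOn (φ' n) (Icc 0 1))
    (hb' : ∀ n, ∀ x ∈ Icc (0 : ℝ) 1, |φ' n x| ≤ K * μ n ^ q) {t x : ℝ} (ht : 0 < t)
    (hx : x ∈ Icc (0 : ℝ) 1) :
    HasDerivWithinAt (heatSeries μ c φ t) (heatSeries μ c φ' t x) (Icc 0 1) x := by
  have h0 : (0 : ℝ) ∈ Icc (0 : ℝ) 1 := left_mem_Icc.2 zero_le_one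
  have hc := continuousOn_slice (continuousOn_heatSeries hμ (hs q) hφ' hb') ht
  have hint : ∀ y ∈ Icc (0 : ℝ) 1, heatSeries μ c φ t y =
      heatSeries μ c φ t 0 + ∫ z in (0 : ℝ)..y, heatSeries μ c φ' t z := by
    intro y hy
    have hsub : ∀ z ∈ uIoc 0 y, z ∈ Icc (0 : ℝ) 1 := fun z hz =>
      uIcc_subset_Icc h0 hy (uIoc_subset_uIcc hz)
    have h1 := intervalIntegral.hasSum_integral_of_dominated_convergence (a := 0) (b := y)
      (μ := volume) (F := fun n z => c n * Real.exp (-μ n * t) * φ' n z)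
      (f := heatSeries μ c φ' t)
      (fun n _ => K * (|c n| * (μ n ^ q * Real.exp (-μ n * t))))
      (fun n => ((continuousOn_const.mul (hφ' n)).mono hsub).aestronglyMeasurable
        measurableSet_uIoc)
      (fun n => ae_of_all _ fun z hz => abs_heatSeries_term_le hμ hb' le_rfl (hsub z hz) n)
      (ae_of_all _ fun _ _ => (hs q t ht).mul_left K) intervalIntegrable_const
      (ae_of_all _ fun z hz => hasSum_heatSeries hμ (hs q) hb' ht (hsub z hz))
    have h2 := (hasSum_heatSeries hμ (hs p) hb ht hy).sub (hasSum_heatSeries hμ (hs p) hb ht h0)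
    have h3 : ∀ n, ∫ z in (0 : ℝ)..y, c n * Real.exp (-μ n * t) * φ' n z =
        c n * Real.exp (-μ n * t) * φ n y - c n * Real.exp (-μ n * t) * φ n 0 := fun n => by
      rw [intervalIntegral.integral_const_mul, integral_deriv_Icc h0 hy (hd n) (hφ' n)]
      ring
    simp only [h3] at h1
    rw [h1.unique h2]
    ring
  exact ((hasDerivWithinAt_integral_Icc hc h0 x hx).const_add _).congr hint (hint x hx)

end

/-- Parseval turns the squared norm into $\sum(e^{-\mu_nt}-1)^2c_n^2$, dominated by $\sum c_n^2$. -/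
lemma l2Norm_tendsto_zero {e : ℕ → ℝ → ℝ} {V : ℝ → ℝ} {μ : ℕ → ℝ}
    (h : IsNeumannEigenbasis V μ e) (hV : ContinuousOn V (Icc 0 1))
    (hVpos : ∀ x ∈ Icc (0 : ℝ) 1, 0 < V x) {v₀ : ℝ → ℝ} (hv₀ : MemL2 v₀) :
    Tendsto (fun t => l2Norm fun x => heatSeries μ (fun n => coeff e n v₀) e t x - v₀ x)
      (𝓝[>] 0) (𝓝 0) := by
  have hμ := h.eigenvalue_pos hV hVpos
  have hpar := h.parseval hv₀ hv₀
  have hlim : Tendsto (fun t => ∑' n, ((Real.exp (-μ n * t) - 1) * coeff e n v₀) ^ 2)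
      (𝓝[>] 0) (𝓝 (∑' _ : ℕ, 0)) := by
    refine tendsto_tsum_of_dominated_convergence hpar.summable (fun n => ?_) ?_
    · refine Tendsto.mono_left ?_ nhdsWithin_le_nhds
      have : Continuous fun t => ((Real.exp (-μ n * t) - 1) * coeff e n v₀) ^ 2 := by fun_prop
      simpa using this.tendsto 0
    · filter_upwards [self_mem_nhdsWithin] with t ht n
      have h1 : Real.exp (-μ n * t) ≤ 1 :=
        Real.exp_le_one_iff.2 (by nlinarith [hμ n, mem_Ioi.1 ht])
      have h2 := Real.exp_pos (-μ n * t)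
      rw [Real.norm_eq_abs, abs_of_nonneg (sq_nonneg _), mul_pow, sq (coeff e n v₀)]
      exact mul_le_of_le_one_left (mul_self_nonneg _) (by nlinarith)
  rw [tsum_zero] at hlim
  have h1 := (Real.continuous_sqrt.tendsto 0).comp hlim
  rw [Real.sqrt_zero] at h1
  refine h1.congr' ?_
  filter_upwards [self_mem_nhdsWithin] with t ht
  have hsum : Summable fun n => |coeff e n v₀ * Real.exp (-μ n * t)| * μ n := by
    refine (h.summable_damped hV hVpos hv₀ 1 ht).congr fun n => ?_
    rw [abs_mul, Real.abs_exp, pow_one]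
    ring
  obtain ⟨-, hc, -, hco⟩ := h.synth_spec hV hVpos hsum
  have hm := memL2_of_continuousOn hc
  have hcoeff : ∀ n, coeff e n (fun x => heatSeries μ (fun n => coeff e n v₀) e t x - v₀ x) =
      (Real.exp (-μ n * t) - 1) * coeff e n v₀ := fun n => by
    have h2 : coeff e n (fun x => heatSeries μ (fun n => coeff e n v₀) e t x - v₀ x) =
        coeff e n (synth e fun n => coeff e n v₀ * Real.exp (-μ n * t)) - coeff e n v₀ := by
      simp only [coeff, mul_sub]
      exact intervalIntegral.integral_sub ((h.memL2 n).integrable_mul hm)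
        ((h.memL2 n).integrable_mul hv₀)
    rw [h2, hco]
    ring
  have h3 := h.parseval (hm.sub hv₀) (hm.sub hv₀)
  change HasSum (fun n => coeff e n (fun x => heatSeries μ (fun n => coeff e n v₀) e t x - v₀ x) *
    coeff e n (fun x => heatSeries μ (fun n => coeff e n v₀) e t x - v₀ x)) _ at h3
  simp only [hcoeff, ← sq] at h3
  rw [Function.comp_apply, h3.tsum_eq]
  rfl

/-- The linear heat equation is solved by the eigenfunction expansion. -/
lemma exists_isLinearHeatSolution {V : ℝ → ℝ} (hV : ContinuousOn V (Icc 0 1))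
    (hVpos : ∀ x ∈ Icc (0 : ℝ) 1, 0 < V x) {v₀ : ℝ → ℝ} (hv₀ : MemL2 v₀) :
    ∃ w wt wx, IsLinearHeatSolution V v₀ w wt wx := by
  obtain ⟨μ, e, h⟩ := exists_isNeumannEigenbasis hV hVpos
  obtain ⟨e', he'⟩ := h.exists_isEigenfamily
  obtain ⟨K, hK, hb⟩ := h.exists_bound hV hVpos he'
  have hμ := h.eigenvalue_pos hV hVpos
  set c : ℕ → ℝ := fun n => coeff e n v₀
  have hs : ∀ p δ, 0 < δ → Summable fun n => |c n| * (μ n ^ p * Real.exp (-μ n * δ)) :=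
    fun p δ hδ => h.summable_damped hV hVpos hv₀ p hδ
  have b0 : ∀ n, ∀ x ∈ Icc (0 : ℝ) 1, |e n x| ≤ K * μ n ^ 1 := fun n x hx => by
    simpa using (hb n x hx).1
  have b1 : ∀ n, ∀ x ∈ Icc (0 : ℝ) 1, |e' n x| ≤ K * μ n ^ 2 := fun n x hx => (hb n x hx).2.2
  have b2 : ∀ n, ∀ x ∈ Icc (0 : ℝ) 1, |(V x - μ n) * e n x| ≤ K * μ n ^ 2 := fun n x hx =>
    (hb n x hx).2.1
  have bt : ∀ n, ∀ x ∈ Icc (0 : ℝ) 1, |-μ n * e n x| ≤ K * μ n ^ 2 := fun n x hx => by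
    rw [abs_mul, abs_neg, abs_of_pos (hμ n), sq, ← mul_assoc, mul_comm (μ n)]
    exact mul_le_mul_of_nonneg_right (hb n x hx).1 (hμ n).le
  have hcV : ∀ n, ContinuousOn (fun x => (V x - μ n) * e n x) (Icc 0 1) := fun n =>
    (hV.sub continuousOn_const).mul (h.continuousOn n)
  have hbd : ∀ z : ℝ, (∀ n, e' n z = 0) → ∀ t, heatSeries μ c e' t z = 0 := fun z hz t => by
    simp [heatSeries, synth, hz]
  refine ⟨heatSeries μ c e, heatSeries μ c fun n x => -μ n * e n x, heatSeries μ c e',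
    continuousOn_heatSeries hμ (hs 1) h.continuousOn b0,
    continuousOn_heatSeries hμ (hs 2) (fun n => continuousOn_const.mul (h.continuousOn n)) bt,
    continuousOn_heatSeries hμ (hs 2) (fun n => (he'.pair n).continuousOn') b1,
    fun t ht x hx => hasDerivAt_heatSeries hμ hs b0 ht hx,
    fun t ht x hx => hasDerivWithinAt_heatSeries hμ hs b0 (fun n => (he'.pair n).deriv)
      (fun n => (he'.pair n).continuousOn') b1 ht hx,
    fun t ht x hx => ?_, fun t _ => hbd 0 (fun n => (he'.pair n).left) t,
    fun t _ => hbd 1 (fun n => (he'.pair n).right) t, l2Norm_tendsto_zero h hV hVpos hv₀⟩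
  convert! hasDerivWithinAt_heatSeries hμ hs b1 (fun n => (he'.pair n).deriv') hcV b2 ht hx using 1
  have h1 := hasSum_heatSeries hμ (hs 2) bt ht hx
  have h2 := (hasSum_heatSeries hμ (hs 1) b0 ht hx).mul_left (V x)
  refine (h1.add h2).unique ?_
  convert! hasSum_heatSeries hμ (hs 2) b2 ht hx using 2 with n
  ring

/-! ### Positivity -/

/-- Composition of a function that is flat at `0` with the negative part. -/
lemma hasDerivAt_comp_negPart {g g' : ℝ → ℝ} (hg : ∀ p, 0 ≤ p → HasDerivAt g (g' p) p)
    (h0 : g' 0 = 0) (z : ℝ) :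
    HasDerivAt (fun z => g (max (-z) 0)) (-g' (max (-z) 0)) z := by
  have hneg : ∀ y, y ≤ 0 → HasDerivAt (fun z => g (-z)) (-g' (-y)) y := fun y hy => by
    convert! (hg (-y) (by linarith)).comp y (hasDerivAt_neg y) using 1
    ring
  rcases lt_trichotomy z 0 with hz | rfl | hz
  · rw [max_eq_left (by linarith)]
    refine (hneg z hz.le).congr_of_eventuallyEq ?_
    filter_upwards [Iio_mem_nhds hz] with y hy
    rw [max_eq_left (by linarith [mem_Iio.1 hy])]
  · have h1 : HasDerivWithinAt (fun z => g (max (-z) 0)) 0 (Iic 0) 0 := by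
      have := (hneg 0 le_rfl).hasDerivWithinAt (s := Iic 0)
      rw [neg_zero, h0, neg_zero] at this
      exact this.congr (fun y hy => by rw [max_eq_left (by linarith [mem_Iic.1 hy])]) (by simp)
    have h2 : HasDerivWithinAt (fun z => g (max (-z) 0)) 0 (Ici 0) 0 :=
      (hasDerivWithinAt_const 0 (Ici 0) (g 0)).congr
        (fun y hy => by rw [max_eq_right (by linarith [mem_Ici.1 hy])]) (by simp)
    have h3 := h1.union h2
    rw [Iic_union_Ici, hasDerivWithinAt_univ] at h3
    simpa [h0] using h3
  · rw [max_eq_right (by linarith), h0, neg_zero]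
    refine (hasDerivAt_const z (g 0)).congr_of_eventuallyEq ?_
    filter_upwards [Ioi_mem_nhds hz] with y hy
    rw [max_eq_right (by linarith [mem_Ioi.1 hy])]

/-- A convex function of class `C²` that vanishes exactly on `[0,∞)` and is at most quadratic. -/
lemma exists_penalty : ∃ Φ Φ' Φ'' : ℝ → ℝ, (∀ z, HasDerivAt Φ (Φ' z) z) ∧
    (∀ z, HasDerivAt Φ' (Φ'' z) z) ∧ Continuous Φ'' ∧ (∀ z, 0 ≤ Φ'' z) ∧ (∀ z, Φ' z ≤ 0) ∧
    (∀ z, 0 ≤ Φ' z * z) ∧ (∀ z, 0 ≤ Φ z) ∧ (∀ z, Φ z = 0 → 0 ≤ z) ∧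
    ∀ z y, 0 ≤ y → Φ z ≤ (z - y) ^ 2 := by
  have hp : ∀ z : ℝ, 0 ≤ max (-z) 0 := fun z => le_max_right _ _
  -- The penalty is $p^3/(1+p)$ at the negative part $p$: cubic at $0$, hence $C^2$ after
  -- composition, and at most $p^2$, hence controlled by $L^2$ convergence.
  have hg : ∀ p : ℝ, 0 ≤ p → HasDerivAt (fun p : ℝ => p ^ 3 / (1 + p))
      ((3 * p ^ 2 + 2 * p ^ 3) / (1 + p) ^ 2) p := fun p hp => by
    convert! (hasDerivAt_pow 3 p).div ((hasDerivAt_id p).const_add 1)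
      (by simp only [id_eq]; positivity) using 1
    simp only [id_eq]
    congr 1
    norm_num
    ring
  have hg' : ∀ p : ℝ, 0 ≤ p → HasDerivAt (fun p : ℝ => (3 * p ^ 2 + 2 * p ^ 3) / (1 + p) ^ 2)
      ((6 * p + 6 * p ^ 2 + 2 * p ^ 3) / (1 + p) ^ 3) p := fun p hp => by
    have h1 : 1 + p ≠ 0 := by positivity
    convert! (((hasDerivAt_pow 2 p).const_mul 3).add ((hasDerivAt_pow 3 p).const_mul 2)).div
      (((hasDerivAt_id p).const_add 1).pow 2) (by simp only [id_eq, Pi.pow_apply]; positivity)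
      using 1
    simp only [id_eq, Pi.pow_apply, Pi.add_apply]
    field_simp
    norm_num
    ring
  refine ⟨_, _, _, hasDerivAt_comp_negPart hg (by simp),
    fun z => (hasDerivAt_comp_negPart hg' (by simp) z).neg, ?_, fun z => ?_, fun z => ?_,
    fun z => ?_, fun z => ?_, fun z hz => ?_, fun z y hy => ?_⟩
  · simp only [neg_neg]
    refine Continuous.div (by fun_prop) (by fun_prop) fun z => ?_
    have := hp z
    positivity
  · have := hp z
    rw [neg_neg]
    positivity
  · have := hp z
    rw [neg_nonpos]
    positivity
  · have := hp z
    rcases le_total 0 z with h | h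
    · rw [max_eq_right (by linarith)]
      simp
    · rw [neg_mul, ← mul_neg]
      exact mul_nonneg (by positivity) (by linarith)
  · have := hp z
    positivity
  · have h1 := hp z
    rw [div_eq_zero_iff, or_iff_left (by positivity)] at hz
    have h2 := pow_eq_zero_iff three_ne_zero |>.1 hz
    linarith [le_max_left (-z) 0]
  · have h1 := hp z
    have h2 : max (-z) 0 ^ 3 / (1 + max (-z) 0) ≤ max (-z) 0 ^ 2 := by
      rw [div_le_iff₀ (by positivity)]
      nlinarith [pow_nonneg h1 2]
    refine h2.trans ?_
    rcases le_total 0 z with h | h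
    · rw [max_eq_right (by linarith)]
      nlinarith [sq_nonneg (z - y)]
    · rw [max_eq_left (by linarith)]
      nlinarith

namespace IsLinearHeatSolution

variable {V w₀ : ℝ → ℝ} {w wt wx : ℝ → ℝ → ℝ}

lemma memL2_slice (h : IsLinearHeatSolution V w₀ w wt wx) {t : ℝ} (ht : 0 < t) : MemL2 (w t) :=
  memL2_of_continuousOn (continuousOn_slice h.cont ht)

/-- The heat flow of a function that is bounded below by a positive constant is positive. -/
lemma le_of_le (h : IsLinearHeatSolution V w₀ w wt wx) (hV : ContinuousOn V (Icc 0 1))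
    (hVpos : ∀ x ∈ Icc (0 : ℝ) 1, 0 < V x) (hw₀ : ContinuousOn w₀ (Icc 0 1)) {δ M : ℝ}
    (hδ : 0 ≤ δ) (hM : ∀ x ∈ Icc (0 : ℝ) 1, V x ≤ M) (hle : ∀ x ∈ Icc (0 : ℝ) 1, δ ≤ w₀ x)
    {t : ℝ} (ht : 0 < t) : ∀ x ∈ Icc (0 : ℝ) 1, δ * Real.exp (-M * t) ≤ w t x := by
  obtain ⟨Φ, Φ', Φ'', h1, h2, h3, h4, h5, h6, h7, h8, h9⟩ := exists_penalty
  have c1 : Continuous Φ := continuous_iff_continuousAt.2 fun z => (h1 z).continuousAt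
  have c2 : Continuous Φ' := continuous_iff_continuousAt.2 fun z => (h2 z).continuousAt
  -- `g` is a spatially constant subsolution because $V\le M$. The functional $\int\Phi(w-g)$ is
  -- shown to be nonincreasing with limit $0$ at time $0$, so $w\ge g$.
  obtain ⟨g, hg⟩ : ∃ g : ℝ → ℝ, ∀ t, g t = δ * Real.exp (-M * t) := ⟨_, fun _ => rfl⟩
  have hgd : ∀ t, HasDerivAt g (-M * g t) t := fun t => by
    have := (((hasDerivAt_id t).const_mul (-M)).exp).const_mul δ
    rw [funext hg]
    convert! this using 1
    simp only [id_eq]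
    ring
  have hg0 : ∀ t, 0 ≤ g t := fun t => by rw [hg]; positivity
  have hgc : Continuous g := continuous_iff_continuousAt.2 fun z => (hgd z).continuousAt
  have hgp : ContinuousOn (fun p : ℝ × ℝ => g p.1) (Ioi 0 ×ˢ Icc 0 1) :=
    (hgc.comp continuous_fst).continuousOn
  have cz : ContinuousOn (fun p : ℝ × ℝ => w p.1 p.2 - g p.1) (Ioi 0 ×ˢ Icc 0 1) := h.cont.sub hgp
  have hE : ∀ t, 0 < t → HasDerivAt (fun s => ∫ x in (0 : ℝ)..1, Φ (w s x - g s))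
      (∫ x in (0 : ℝ)..1, Φ' (w t x - g t) * (wt t x - -M * g t)) t := fun t ht =>
    hasDerivAt_integral_param (F := fun s x => Φ (w s x - g s))
      (F' := fun s x => Φ' (w s x - g s) * (wt s x - -M * g s))
      (c1.comp_continuousOn cz)
      ((c2.comp_continuousOn cz).mul (h.cont_t.sub (continuousOn_const.mul hgp)))
      (fun t ht x hx => (h1 _).comp t ((h.deriv_t t ht x hx).sub (hgd t))) ht
  have hE' : ∀ t, 0 < t →
      ∫ x in (0 : ℝ)..1, Φ' (w t x - g t) * (wt t x - -M * g t) ≤ 0 := fun t ht => by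
    have cw := continuousOn_slice h.cont ht
    have cwt := continuousOn_slice h.cont_t ht
    have cwx := continuousOn_slice h.cont_x ht
    have cs : ContinuousOn (fun x => w t x - g t) (Icc 0 1) := cw.sub continuousOn_const
    have cxx : ContinuousOn (fun x => wt t x + V x * w t x) (Icc 0 1) := cwt.add (hV.mul cw)
    have k1 := integral_mul_deriv_Icc le_rfl zero_le_one le_rfl
      (u := fun x => Φ' (w t x - g t)) (u' := fun x => Φ'' (w t x - g t) * wx t x)
      (fun x hx => (h2 _).comp_hasDerivWithinAt x ((h.deriv_x t ht x hx).sub_const (g t)))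
      (h.deriv_xx t ht) ((h3.comp_continuousOn cs).mul cwx) cxx
    rw [h.left t ht, h.right t ht] at k1
    have k2 : 0 ≤ ∫ x in (0 : ℝ)..1, Φ'' (w t x - g t) * wx t x * wx t x :=
      intervalIntegral.integral_nonneg zero_le_one fun x _ => by
        rw [mul_assoc]
        exact mul_nonneg (h4 _) (mul_self_nonneg _)
    have k3 : ∫ x in (0 : ℝ)..1, Φ' (w t x - g t) * (wt t x - -M * g t) ≤
        ∫ x in (0 : ℝ)..1, Φ' (w t x - g t) * (wt t x + V x * w t x) := by
      refine intervalIntegral.integral_mono_on zero_le_one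
        (intervalIntegrable_of_continuousOn ((c2.comp_continuousOn cs).mul
          (cwt.sub continuousOn_const)))
        (intervalIntegrable_of_continuousOn ((c2.comp_continuousOn cs).mul cxx)) fun x hx => ?_
      -- The sign comes from $\Phi'\cdot(Vw-Mg)=V\,\Phi'\cdot(w-g)+(-\Phi')(M-V)g\ge0$.
      have a1 := mul_nonneg (hVpos x hx).le (h6 (w t x - g t))
      have a2 := mul_nonneg (mul_nonneg (neg_nonneg.2 (h5 (w t x - g t))) (sub_nonneg.2 (hM x hx)))
        (hg0 t)
      nlinarith
    linarith
  have hanti : AntitoneOn (fun s => ∫ x in (0 : ℝ)..1, Φ (w s x - g s)) (Ioi 0) := by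
    refine antitoneOn_of_deriv_nonpos (convex_Ioi 0)
      (fun s hs => (hE s hs).continuousAt.continuousWithinAt) (fun s hs => ?_) fun s hs => ?_
    · rw [interior_Ioi] at hs
      exact (hE s hs).differentiableAt.differentiableWithinAt
    · rw [interior_Ioi] at hs
      rw [(hE s hs).deriv]
      exact hE' s hs
  have hm₀ := memL2_of_continuousOn hw₀
  have hbound : ∀ s, 0 < s → ∫ x in (0 : ℝ)..1, Φ (w s x - g s) ≤
      (l2Norm (fun x => w s x - w₀ x) + |δ - g s|) ^ 2 := fun s hs => by
    have cw := continuousOn_slice h.cont hs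
    have m1 : MemL2 fun x => w s x - w₀ x := memL2_of_continuousOn (cw.sub hw₀)
    have m2 : MemL2 fun _ : ℝ => δ - g s := memL2_of_continuousOn continuousOn_const
    have h10 := l2Norm_add_le m1 m2
    have h11 : l2Norm (fun _ => δ - g s) = |δ - g s| := by
      simp [l2Norm, Real.sqrt_sq_eq_abs]
    rw [h11] at h10
    refine le_trans ?_ (pow_le_pow_left₀ (l2Norm_nonneg _) h10 2)
    rw [l2Norm_sq]
    refine intervalIntegral.integral_mono_on zero_le_one
      (intervalIntegrable_of_continuousOn (c1.comp_continuousOn (cw.sub continuousOn_const)))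
      (intervalIntegrable_of_continuousOn (((cw.sub hw₀).add continuousOn_const).pow 2))
      fun x hx => (h9 (w s x - g s) (w₀ x - δ) (sub_nonneg.2 (hle x hx))).trans (le_of_eq ?_)
    ring
  have hzero : ∫ x in (0 : ℝ)..1, Φ (w t x - g t) ≤ 0 := by
    have hlim : Tendsto (fun s => (l2Norm (fun x => w s x - w₀ x) + |δ - g s|) ^ 2)
        (𝓝[>] 0) (𝓝 0) := by
      have hgl : Tendsto (fun s => |δ - g s|) (𝓝[>] 0) (𝓝 0) := by
        refine Tendsto.mono_left ?_ nhdsWithin_le_nhds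
        have := (continuous_const.sub hgc).abs.tendsto (0 : ℝ) (f := fun s => |δ - g s|)
        simpa [hg 0] using this
      simpa using (h.lim.add hgl).pow 2
    refine ge_of_tendsto hlim ?_
    filter_upwards [self_mem_nhdsWithin, nhdsWithin_le_nhds (Iio_mem_nhds ht)] with s hs hst
    exact (hanti hs ht (le_of_lt hst)).trans (hbound s hs)
  intro x hx
  have cΦ : ContinuousOn (fun x => Φ (w t x - g t)) (Icc 0 1) :=
    c1.comp_continuousOn ((continuousOn_slice h.cont ht).sub continuousOn_const)
  have hx0 : Φ (w t x - g t) = 0 := by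
    by_contra hne
    exact absurd hzero (not_le.2 (intervalIntegral.integral_pos zero_lt_one cΦ (fun y _ => h7 _)
      ⟨x, hx, lt_of_le_of_ne (h7 _) (Ne.symm hne)⟩))
  rw [← hg]
  linarith [h8 _ hx0]

lemma pos (h : IsLinearHeatSolution V w₀ w wt wx) (hV : ContinuousOn V (Icc 0 1))
    (hVpos : ∀ x ∈ Icc (0 : ℝ) 1, 0 < V x) (hw₀ : ContinuousOn w₀ (Icc 0 1))
    (hpos : ∀ x ∈ Icc (0 : ℝ) 1, 0 < w₀ x) {t : ℝ} (ht : 0 < t) :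
    ∀ x ∈ Icc (0 : ℝ) 1, 0 < w t x := by
  obtain ⟨δ, hδ, -, hle⟩ := exists_pos_le w₀ hw₀ hpos
  obtain ⟨M, hM⟩ := isCompact_Icc.exists_bound_of_continuousOn hV
  exact fun x hx => (mul_pos hδ (Real.exp_pos (-M * t))).trans_le
    (h.le_of_le hV hVpos hw₀ hδ.le (fun x hx => (le_abs_self _).trans (hM x hx)) hle ht x hx)

end IsLinearHeatSolution

/-! ### The nonlinear flow -/

namespace IsLinearHeatSolution

variable {V w₀ : ℝ → ℝ} {w wt wx : ℝ → ℝ → ℝ}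

lemma hasDerivAt_integral (h : IsLinearHeatSolution V w₀ w wt wx) (hV : ContinuousOn V (Icc 0 1))
    {t : ℝ} (ht : 0 < t) : HasDerivAt (fun s => ∫ x in (0 : ℝ)..1, w s x)
      (-∫ x in (0 : ℝ)..1, V x * w t x) t := by
  have cw := continuousOn_slice h.cont ht
  have cwt := continuousOn_slice h.cont_t ht
  have i1 : IntervalIntegrable (fun x => V x * w t x) volume 0 1 :=
    intervalIntegrable_of_continuousOn (hV.mul cw)
  convert! hasDerivAt_integral_param h.cont h.cont_t h.deriv_t ht using 1
  have h1 := integral_deriv_Icc (left_mem_Icc.2 zero_le_one) (right_mem_Icc.2 zero_le_one)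
    (h.deriv_xx t ht) (cwt.add (hV.mul cw))
  rw [h.left t ht, h.right t ht,
    intervalIntegral.integral_add (intervalIntegrable_of_continuousOn cwt) i1] at h1
  linarith

lemma tendsto_integral (h : IsLinearHeatSolution V w₀ w wt wx) (hw₀ : MemL2 w₀) :
    Tendsto (fun t => ∫ x in (0 : ℝ)..1, w t x) (𝓝[>] 0) (𝓝 (∫ x in (0 : ℝ)..1, w₀ x)) := by
  have hL : MemL2 fun _ => 1 := memL2_of_continuousOn continuousOn_const
  have h1 : Tendsto (fun t => l2Norm (fun _ => 1) * l2Norm fun x => w t x - w₀ x) (𝓝[>] 0)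
      (𝓝 0) := by
    simpa using h.lim.const_mul (l2Norm fun _ => 1)
  rw [tendsto_iff_norm_sub_tendsto_zero]
  refine squeeze_zero' (Eventually.of_forall fun _ => norm_nonneg _) ?_ h1
  filter_upwards [self_mem_nhdsWithin] with t ht
  have h2 := abs_integral_mul_le hL ((h.memL2_slice ht).sub hw₀)
  simp only [one_mul] at h2
  have i1 := hL.integrable_mul (h.memL2_slice ht)
  have i2 := hL.integrable_mul hw₀
  simp only [one_mul] at i1 i2
  rwa [intervalIntegral.integral_sub i1 i2] at h2

end IsLinearHeatSolution

/-- The normalised linear flow solves the nonlinear heat equation. -/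
theorem exists_isNonlinearHeatSolution {V : ℝ → ℝ} (hV : ContinuousOn V (Icc 0 1))
    (hVpos : ∀ x ∈ Icc (0 : ℝ) 1, 0 < V x) {v₀ : ℝ → ℝ} (hv₀ : v₀ ∈ P1) :
    ∃ v : ℝ → ℝ → ℝ, IsNonlinearHeatSolution V v₀ v ∧ ∀ t : ℝ, 0 ≤ t → v t ∈ P1 := by
  obtain ⟨hv₀c, hv₀H, hv₀pos, hv₀1⟩ := id hv₀
  have hm₀ := memL2_of_continuousOn hv₀c
  obtain ⟨w, wt, wx, h⟩ := exists_isLinearHeatSolution hV hVpos hm₀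
  -- The mass satisfies $\dot m=-I$, so dividing $w$ by $m$ adds the term $(I/m)v$, and $I/m=\int
  -- Vv$ is exactly the nonlocal coefficient.
  obtain ⟨m, hm⟩ : ∃ m : ℝ → ℝ, ∀ t, m t = ∫ x in (0 : ℝ)..1, w t x := ⟨_, fun _ => rfl⟩
  obtain ⟨I, hI⟩ : ∃ I : ℝ → ℝ, ∀ t, I t = ∫ x in (0 : ℝ)..1, V x * w t x := ⟨_, fun _ => rfl⟩
  have hVp : ContinuousOn (fun p : ℝ × ℝ => V p.2) (Ioi 0 ×ˢ Icc 0 1) :=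
    hV.comp continuousOn_snd fun p hp => hp.2
  have hmpos : ∀ t, 0 < t → 0 < m t := fun t ht => by
    rw [hm]
    exact intervalIntegral.intervalIntegral_pos_of_pos_on
      (intervalIntegrable_of_continuousOn (continuousOn_slice h.cont ht))
      (fun x hx => h.pos hV hVpos hv₀c hv₀pos ht x (Ioo_subset_Icc_self hx)) zero_lt_one
  have hmd : ∀ t, 0 < t → HasDerivAt m (-I t) t := fun t ht => by
    rw [funext hm, hI]
    exact h.hasDerivAt_integral hV ht
  have hmc : ContinuousOn m (Ioi 0) := fun t ht => (hmd t ht).continuousAt.continuousWithinAt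
  have hIc : ContinuousOn I (Ioi 0) := fun t ht => by
    rw [funext hI]
    exact (hasDerivAt_integral_param (F := fun t x => V x * w t x)
      (F' := fun t x => V x * wt t x) (hVp.mul h.cont) (hVp.mul h.cont_t)
      (fun t ht x hx => (h.deriv_t t ht x hx).const_mul _) ht).continuousAt.continuousWithinAt
  have hm1 : Tendsto m (𝓝[>] 0) (𝓝 1) := by
    have h1 := h.tendsto_integral hm₀
    rw [hv₀1] at h1
    rwa [funext hm]
  have hfst : ∀ {F : ℝ → ℝ}, ContinuousOn F (Ioi 0) →
      ContinuousOn (fun p : ℝ × ℝ => F p.1) (Ioi 0 ×ˢ Icc 0 1) := fun hF =>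
    hF.comp continuousOn_fst fun p hp => hp.1
  have hmp := hfst hmc
  have hIp := hfst hIc
  have hmne : ∀ p ∈ Ioi (0 : ℝ) ×ˢ Icc (0 : ℝ) 1, m p.1 ≠ 0 := fun p hp => (hmpos _ hp.1).ne'
  obtain ⟨v, hv⟩ : ∃ v : ℝ → ℝ → ℝ, ∀ t, v t = if 0 < t then fun x => w t x / m t else v₀ :=
    ⟨_, fun _ => rfl⟩
  have hvt : ∀ t, 0 < t → v t = fun x => w t x / m t := fun t ht => by rw [hv, if_pos ht]
  have hv0 : v 0 = v₀ := by rw [hv, if_neg (lt_irrefl 0)]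
  have hcw : ContinuousOn (fun p : ℝ × ℝ => w p.1 p.2 / m p.1) (Ioi 0 ×ˢ Icc 0 1) :=
    h.cont.div hmp hmne
  have hct : ContinuousOn (fun p : ℝ × ℝ => wt p.1 p.2 / m p.1 + I p.1 / m p.1 *
      (w p.1 p.2 / m p.1)) (Ioi 0 ×ˢ Icc 0 1) :=
    (h.cont_t.div hmp hmne).add ((hIp.div hmp hmne).mul hcw)
  refine ⟨v, ⟨⟨fun t x => wt t x / m t + I t / m t * (w t x / m t), fun t x => wx t x / m t,
    fun t x => (wt t x + V x * w t x) / m t, ?_, hct, h.cont_x.div hmp hmne,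
    (h.cont_t.add (hVp.mul h.cont)).div hmp hmne,
    fun t ht => ⟨fun x hx => ⟨?_, ?_, ?_, ?_⟩, ?_, ?_⟩⟩,
    fun x _ => by rw [hv0], ?_⟩, fun t ht => ?_⟩
  · exact hcw.congr fun p hp => by rw [hvt _ hp.1]
  · have h1 := (h.deriv_t t ht x hx).div (hmd t ht) (hmpos t ht).ne'
    have h2 : HasDerivAt (fun s => w s x / m s) (wt t x / m t + I t / m t * (w t x / m t)) t := by
      convert! h1 using 1
      have := (hmpos t ht).ne'
      field_simp
      ring
    refine h2.congr_of_eventuallyEq ?_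
    filter_upwards [Ioi_mem_nhds ht] with s hs
    rw [hvt s hs]
  · rw [hvt t ht]
    exact (h.deriv_x t ht x hx).div_const _
  · exact (h.deriv_xx t ht x hx).div_const _
  · have h1 : ∫ y in (0 : ℝ)..1, V y * v t y = I t / m t := by
      simp only [hvt t ht, ← mul_div_assoc]
      rw [intervalIntegral.integral_div, hI]
    rw [h1, hvt t ht]
    ring
  · simp [h.left t ht]
  · simp [h.right t ht]
  -- From $w/m-v_0=m^{-1}(w-v_0)+(m^{-1}-1)v_0$ and $m\to1$.
  · have hlim : Tendsto (fun t => (m t)⁻¹ * l2Norm (fun x => w t x - v₀ x) +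
        |(m t)⁻¹ - 1| * l2Norm v₀) (𝓝[>] 0) (𝓝 0) := by
      have hinv := hm1.inv₀ one_ne_zero
      have h1 := (hinv.mul h.lim).add ((hinv.sub_const 1).abs.mul_const (l2Norm v₀))
      simpa using h1
    refine squeeze_zero' (Eventually.of_forall fun _ => l2Norm_nonneg _) ?_ hlim
    filter_upwards [self_mem_nhdsWithin] with t ht
    have h1 := l2Norm_add_le (((h.memL2_slice ht).sub hm₀).const_mul (m t)⁻¹)
      (hm₀.const_mul ((m t)⁻¹ - 1))
    rw [l2Norm_const_mul, l2Norm_const_mul, abs_of_pos (inv_pos.2 (hmpos t ht))] at h1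
    refine le_of_eq_of_le ?_ h1
    rw [hvt t ht]
    congr 1
    ext x
    ring
  · rcases ht.eq_or_lt with rfl | ht
    · rwa [hv0]
    · rw [hvt t ht]
      refine ⟨(continuousOn_slice h.cont ht).div_const _,
        memH1_of_hasDerivWithinAt (fun x hx => (h.deriv_x t ht x hx).div_const _)
          ((continuousOn_slice h.cont_x ht).div_const _),
        fun x hx => div_pos (h.pos hV hVpos hv₀c hv₀pos ht x hx) (hmpos t ht), ?_⟩
      rw [intervalIntegral.integral_div, ← hm]
      exact div_self (hmpos t ht).ne'

end KoopmanHeat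

end


theorem mainTheorem6 (V : ℝ → ℝ) (hV : ContinuousOn V (Icc 0 1))
    (hVpos : ∀ x ∈ Icc (0 : ℝ) 1, 0 < V x) :
    -- the spectral data and the flow exist
    (∃ (μ : ℕ → ℝ) (e : ℕ → ℝ → ℝ), IsNeumannEigenbasis V μ e) ∧
    (∀ v₀ ∈ P1, ∃ v : ℝ → ℝ → ℝ,
      IsNonlinearHeatSolution V v₀ v ∧ ∀ t : ℝ, 0 ≤ t → v t ∈ P1) ∧
    ∀ (μ : ℕ → ℝ) (e : ℕ → ℝ → ℝ), IsNeumannEigenbasis V μ e →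
      -- the series defining `h₂` converges for all `t ≥ 0`
      (∀ t : ℝ, 0 ≤ t →
        Summable fun q : ℕ+ => Real.exp (-2 * (μ q - μ 0) * t) / μ q ^ 3) ∧
      (∀ v₀ ∈ P1, ∀ v : ℝ → ℝ → ℝ, IsNonlinearHeatSolution V v₀ v →
        -- `ψ_ν` is an eigenfunctional of the Koopman operators, with eigenvalue `e^{-λ_ν t}`
        (∀ ν : B, ∀ t : ℝ, 0 ≤ t →
          psi e ν (v t) = Real.exp (-rate μ ν * t) * psi e ν v₀) ∧
        -- the Koopman decomposition, absolutely convergent for the sup norm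
        ∀ t : ℝ, max (tauTildeN V μ e v₀) (tauN μ e v₀) < (t : EReal) →
          HasKoopmanDecomposition μ e v₀ t (v t)) ∧
      -- `Ω̃_N` is a neighbourhood of the sink in `𝒫₁`
      sink e ∈ OmegaTildeN V μ e ∧
      (∃ ε : ℝ, 0 < ε ∧ ∀ v₀ ∈ P1, h1Norm (fun x => v₀ x - sink e x) < ε →
        v₀ ∈ OmegaTildeN V μ e) ∧
      (∀ v₀ ∈ OmegaTildeN V μ e, ∀ v : ℝ → ℝ → ℝ, IsNonlinearHeatSolution V v₀ v →
        ∀ t : ℝ, 0 < t → HasKoopmanDecomposition μ e v₀ t (v t)) := by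
  refine ⟨exists_isNeumannEigenbasis hV hVpos,
    fun v₀ hv₀ => exists_isNonlinearHeatSolution hV hVpos hv₀,
    fun μ e he => ⟨fun t ht => he.summable_h2 hV hVpos ht,
    fun v₀ hv₀ v hv => ⟨fun ν t ht => hv.psi_eq hV he hv₀ ν ht, fun t ht => ?_⟩,
    he.sink_mem_OmegaTildeN hV hVpos, he.exists_nhds_sink hV hVpos,
    fun v₀ hv₀ v hv t ht => hasKoopmanDecomposition_of_lt hV hVpos he hv₀.1 hv ht
      (he.exp_mul_lt_of_mem_OmegaTildeN hV hVpos hv₀ ht)⟩⟩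
  -- The first threshold gives $t>0$, hence smoothing; the second gives the smallness that makes the
  -- geometric series converge.
  rw [max_lt_iff] at ht
  exact hasKoopmanDecomposition_of_lt hV hVpos he hv₀ hv (pos_of_tauTildeN_lt ht.1)
    (he.exp_mul_lt_of_tauN_lt hV hv₀ ht.2)
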